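/- Let $q$ be a prime power, $\rho\in(0,1)$, $0<\delta<(1-1/q)(1-\sqrt\rho)/2$ and $\epsilon=1-H_q\big(2\delta/(1-\sqrt\rho)\big)$, where $H_q(x)=-x\log_q x-(1-x)\log_q(1-x)+x\log_q(q-1)$ and $H_q^{-1}$ denotes the inverse of $H_q$ on $[0,1-1/q]$. **Setting.** Let $b,n,s\in\mathbb N$ with $n>2b$ and $s\ge\lceil\log_q n\rceil$. Let $\mathcal A\subset\mathbb R$ be an alphabet with $q$ elements, $0\in\mathcal A$, identified with $\mathbb F_q$ by a bijection $\phi$ with $\phi(0)=0$, and let $\mathcal S_q\subset\mathbb F_q^n$ be the set of vectors $(\phi(z_1),\dots,\phi(z_n))$ with $z\in\mathcal A^n$ having at most $b$ nonzero entries. Let $\alpha$ be a primitive element of $\mathbb F_{q^s}$; for a matrix $A''$ over $\mathbb F_q$ with $2bs$ rows, $\phi_s(A'')$ is the matrix over $\mathbb F_{q^s}$ with $2b$ rows whose $k$-th row is $\sum_{\tau=0}^{s-1}\alpha^\tau\cdot(\text{row }(k-1)s+\tau+1\text{ of }A'')$. For $t\in\mathbb N$, a code $\mathcal D_{con}(t,\epsilon,\rho)$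 is a concatenated linear code over $\mathbb F_q$ of length $tq^{\lfloor\epsilon t\rfloor}$ and dimension $\lfloor\epsilon t\rfloor\lceil\rho q^{\lfloor\epsilon t\rfloor}\rceil$: its outer code is a Reed–Solomon code of length $q^{\lfloor\epsilon t\rfloor}$ and dimension $\lceil\rho q^{\lfloor\epsilon t\rfloor}\rceil$ over $\mathbb F_{q^{\lfloor\epsilon t\rfloor}}$, and its inner code is a linear code over $\mathbb F_q$ of length $t$, dimension $\lfloor\epsilon t\rfloor$ and minimum distance at least $H_q^{-1}(1-\epsilon)\,t$ (so the minimum distance of the concatenated code is at least $H_q^{-1}(1-\epsilon)(1-\rho)\,tq^{\lfloor\epsilon t\rfloor}$). Reed–Solomon codes are evaluation codes at distinct points; arbitrary nonzero column multipliers are allowed. **Claim.** There are constants $C,c_1,c_2>0$ and thresholds $b_0,n_0$, depending only on $q,\rho,\delta$, such that the following holds whenever $b\ge b_0$, $n\ge n_0$, $n>2b$ and $s\ge\lceil\log_q n\rceil$. The equation $\epsilon\rho\,x\,q^{\epsilon x}=4qbs$ has exactly one real solution $t^*$. Put $t=\lceil t^*\rceil$ and $m=tq^{\lfloor\epsilon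 t\rfloor}$. Then: 1. $c_1bs\le m\le c_2bs$; and if $s=\lceil\log_q n\rceil$, then $c_1b\log_q n\le m\le c_2b\log_q n$. 2. There exist a generator matrix $G$ ($m$ rows, its columns a basis of the code) of a code $\mathcal D_{con}(t,\epsilon,\rho)$ and a matrix $A'$ over $\mathbb F_q$ with $n$ columns and as many rows as $G$ has columns, such that some $2bs$ rows of $A'$ form a matrix $A''$ for which $\phi_s(A'')$ is a parity check matrix of an $[n,n-2b,2b+1]_{q^s}$ Reed–Solomon code. 3. For every pair $G,A'$ as in 2, with $A=GA'$, there is an algorithm, namely a straight-line program (with tests and selections, each counted as an operation) over $\mathbb F_q$ and $\mathbb R$ that may depend on $G$ and $A'$ but not on the signal or the noise, which uses at most $$C\,(n+b\log(bs))\,b\,s^2$$ operations in $\mathbb F_q$ and $\mathbb R$ and which, from $\mathbf y=A\mathbf x+\mathbf n$, outputs exactly $\mathbf x$ for every $\mathbf x\in\mathcal S_q$ and every $\mathbf n\in\mathbb F_q^m$ with at most $\delta m$ nonzero entries. -/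

import Mathlib

universe u v

noncomputable section

namespace FiniteFieldCS

/-! ### Linear codes -/

/-- `G` is a generator matrix of the linear code `C`, in column convention: its columns form a
basis of `C`, so that `msg ↦ G *ᵥ msg` encodes messages. -/
def IsGeneratorMatrix {F : Type u} [Field F] {m k : ℕ}
    (G : Matrix (Fin m) (Fin k) F) (C : Submodule F (Fin m → F)) : Prop :=
  LinearIndependent F (fun j : Fin k => fun i : Fin m => G i j) ∧
    Submodule.span F (Set.range (fun j : Fin k => fun i : Fin m => G i j)) = C

/-- `H` is a parity check matrix of the linear code `C`: its rows are linearly independent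
and `C` is its kernel. -/
def IsParityCheckMatrix {F : Type u} [Field F] {r n : ℕ}
    (H : Matrix (Fin r) (Fin n) F) (C : Submodule F (Fin n → F)) : Prop :=
  LinearIndependent F (fun i : Fin r => H i) ∧ ∀ c : Fin n → F, c ∈ C ↔ H.mulVec c = 0

/-- `C` is a Reed–Solomon code of length `n` and dimension `k` (for `k ≤ n`): the words
`(w₁ f(a₁), …, wₙ f(aₙ))`, for polynomials `f` of degree less than `k`, where `a₁, …, aₙ` are
distinct evaluation points and `w₁, …, wₙ` are nonzero column multipliers (all equal to one for
a Reed–Solomon code in the narrow sense). Its minimum distance is `n - k + 1` if `1 ≤ k ≤ n`. -/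
def IsReedSolomon {E : Type u} [Field E] {n : ℕ} (k : ℕ)
    (C : Submodule E (Fin n → E)) : Prop :=
  ∃ a w : Fin n → E, Function.Injective a ∧ (∀ i, w i ≠ 0) ∧
    ∀ c : Fin n → E, c ∈ C ↔
      ∃ f : Polynomial E, f.degree < (k : WithBot ℕ) ∧ ∀ i, c i = w i * f.eval (a i)

/-! ### The `q`-ary entropy function -/

/-- `H_q(x) = -x log_q x - (1 - x) log_q (1 - x) + x log_q (q - 1)`. -/
def Hq (q : ℕ) (x : ℝ) : ℝ :=
  -x * Real.logb q x - (1 - x) * Real.logb q (1 - x) + x * Real.logb q ((q : ℝ) - 1)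

/-- The inverse of `H_q` on the interval `[0, 1 - 1/q]`, on which `H_q` increases from
`0` to `1`. -/
def HqInv (q : ℕ) (y : ℝ) : ℝ :=
  Function.invFunOn (Hq q) (Set.Icc (0 : ℝ) (1 - 1 / (q : ℝ))) y

/-! ### Concatenated codes -/

/-- The dimension `⌊ε t⌋` of the inner code. -/
def innerDim (ε : ℝ) (t : ℕ) : ℕ := ⌊ε * (t : ℝ)⌋₊

/-- The length `q^⌊ε t⌋` of the outer code. -/
def outerLength (q : ℕ) (ε : ℝ) (t : ℕ) : ℕ := q ^ innerDim ε t

/-- The dimension `⌈ρ q^⌊ε t⌋⌉` of the outer code. -/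
def outerDim (q : ℕ) (ε ρ : ℝ) (t : ℕ) : ℕ := ⌈ρ * (outerLength q ε t : ℝ)⌉₊

/-- The length `N = t q^⌊ε t⌋` of the concatenated code. -/
def conLength (q : ℕ) (ε : ℝ) (t : ℕ) : ℕ := outerLength q ε t * t

/-- The dimension `K = ⌊ε t⌋ ⌈ρ q^⌊ε t⌋⌉` of the concatenated code. -/
def conDim (q : ℕ) (ε ρ : ℝ) (t : ℕ) : ℕ := innerDim ε t * outerDim q ε ρ t

/-- `C` is a concatenated code `D_con(t, ε, ρ)` over the finite field `F` with `q` elements.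

* The outer code is a Reed–Solomon code of length `q^⌊ε t⌋` and dimension `⌈ρ q^⌊ε t⌋⌉` over the
  extension field `E` of `F` of degree `⌊ε t⌋`.
* The inner code is the image of an injective `F`-linear encoder `E → F^t`; it has dimension
  `⌊ε t⌋` and minimum distance at least `H_q⁻¹(1 - ε) t`.
* The words of `C` arise from those of the outer code by encoding every symbol.

Hence the minimum distance of `C` is at least `H_q⁻¹(1 - ε) (1 - ρ) t q^⌊ε t⌋`. -/
def IsDcon {F : Type u} [Field F] [Fintype F] [DecidableEq F] (t : ℕ) (ε ρ : ℝ)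
    (C : Submodule F (Fin (conLength (Fintype.card F) ε t) → F)) : Prop :=
  ∃ (E : Type u) (_ : Field E) (_ : Algebra F E)
    (outer : Submodule E (Fin (outerLength (Fintype.card F) ε t) → E))
    (enc : E →ₗ[F] (Fin t → F)),
    Module.finrank F E = innerDim ε t ∧
    IsReedSolomon (outerDim (Fintype.card F) ε ρ t) outer ∧
    Function.Injective enc ∧
    (∀ z : E, z ≠ 0 →
      HqInv (Fintype.card F) (1 - ε) * (t : ℝ) ≤ (hammingNorm (enc z) : ℝ)) ∧
    ∀ c : Fin (conLength (Fintype.card F) ε t) → F, c ∈ C ↔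
      ∃ o ∈ outer, ∀ i j, c (finProdFinEquiv (i, j)) = enc (o i) j

/-! ### Field lifting -/

/-- The map `φ_s`: consecutive blocks of `s` rows of a matrix over `F` are combined, with
coefficients `1, α, …, α^(s-1)`, into one row over the extension field `K`. -/
def liftMatrix {F : Type u} {K : Type v} [Field F] [Field K] [Algebra F K] (α : K)
    {r s n : ℕ} (A : Matrix (Fin (r * s)) (Fin n) F) : Matrix (Fin r) (Fin n) K :=
  fun k l => ∑ t : Fin s, algebraMap F K (A (finProdFinEquiv (k, t)) l) * α ^ (t : ℕ)

/-- `α` is a primitive element: every nonzero element of `K` is a power of `α`, and `α ≠ 0`. -/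
def IsPrimitiveElement {K : Type v} [Field K] (α : K) : Prop :=
  α ≠ 0 ∧ ∀ z : K, z ≠ 0 → ∃ i : ℕ, z = α ^ i

/-- The sensing matrix is `A = G A'`, where `G` is a generator matrix of a concatenated code
`D_con(t, ε, ρ)` and some `2 b s` rows of `A'` form a matrix `A''` such that `φ_s(A'')` is a
parity check matrix of an `[n, n - 2 b, 2 b + 1]` Reed–Solomon code over `K`. -/
def IsDesign {F : Type u} {K : Type v} [Field F] [Fintype F] [DecidableEq F] [Field K]
    [Algebra F K] (α : K) (t : ℕ) (ε ρ : ℝ) (b s : ℕ) {n : ℕ}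
    (G : Matrix (Fin (conLength (Fintype.card F) ε t)) (Fin (conDim (Fintype.card F) ε ρ t)) F)
    (A' : Matrix (Fin (conDim (Fintype.card F) ε ρ t)) (Fin n) F) : Prop :=
  (∃ C : Submodule F (Fin (conLength (Fintype.card F) ε t) → F),
    IsDcon t ε ρ C ∧ IsGeneratorMatrix G C) ∧
  ∃ rows : Fin (2 * b * s) → Fin (conDim (Fintype.card F) ε ρ t), Function.Injective rows ∧
    ∃ R : Submodule K (Fin n → K), IsReedSolomon (n - 2 * b) R ∧
      IsParityCheckMatrix (liftMatrix α (A'.submatrix rows id)) R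

/-! ### Signals and noise -/

/-- The ensemble `S`: vectors with entries in the alphabet and at most `b` nonzero entries. -/
def signals (alphabet : Finset ℝ) (b n : ℕ) : Set (Fin n → alphabet) :=
  {z | hammingNorm (fun i => (z i : ℝ)) ≤ b}

/-- The ensemble `S_q`: images of the signals under the identification `φ` of the alphabet
with the finite field. -/
def fieldSignals {F : Type u} (alphabet : Finset ℝ) (φ : alphabet ≃ F) (b n : ℕ) :
    Set (Fin n → F) :=
  {x | ∃ z ∈ signals alphabet b n, ∀ i, x i = φ (z i)}

/-- The ensemble of noise vectors with at most `δ m` nonzero entries. -/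
def worstCaseNoise (F : Type u) [Field F] [DecidableEq F] (δ : ℝ) (m : ℕ) : Set (Fin m → F) :=
  {e | (hammingNorm e : ℝ) ≤ δ * (m : ℝ)}

/-! ### Arithmetic programs over `F` and `ℝ`

Straight-line programs on two banks of registers, one with entries in `F` and one with entries
in `ℝ`. A program may depend on everything but its input vector. Every instruction counts as one
operation, including constants, tests and selections; as the running time is the length of the
program, no tables are available for free. -/

/-- Instructions; the first argument is the destination register. -/
inductive Instr (F : Type u) : Type u
  | fconst (d : ℕ) (c : F)
  | fadd (d i j : ℕ)
  | fsub (d i j : ℕ)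
  | fmul (d i j : ℕ)
  | fdiv (d i j : ℕ)
  | rone (d : ℕ)
  | radd (d i j : ℕ)
  | rsub (d i j : ℕ)
  | rmul (d i j : ℕ)
  | rdiv (d i j : ℕ)
  /-- comparison of two real registers, with result `1` (true) or `0` (false) in `F` -/
  | rle (d i j : ℕ)
  /-- selection between two `F`-registers `j`, `k`, by a zero test of the `F`-register `i` -/
  | fsel (d i j k : ℕ)
  /-- selection between two real registers `j`, `k`, by a zero test of the `F`-register `i` -/
  | rsel (d i j k : ℕ)

/-- The contents of the registers. -/
structure Regs (F : Type u) : Type u where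
  f : ℕ → F
  r : ℕ → ℝ

/-- The effect of one instruction. Division by zero returns zero. -/
def Instr.run {F : Type u} [Field F] [DecidableEq F] (σ : Regs F) : Instr F → Regs F
  | .fconst d c => ⟨Function.update σ.f d c, σ.r⟩
  | .fadd d i j => ⟨Function.update σ.f d (σ.f i + σ.f j), σ.r⟩
  | .fsub d i j => ⟨Function.update σ.f d (σ.f i - σ.f j), σ.r⟩
  | .fmul d i j => ⟨Function.update σ.f d (σ.f i * σ.f j), σ.r⟩
  | .fdiv d i j => ⟨Function.update σ.f d (σ.f i / σ.f j), σ.r⟩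
  | .rone d => ⟨σ.f, Function.update σ.r d 1⟩
  | .radd d i j => ⟨σ.f, Function.update σ.r d (σ.r i + σ.r j)⟩
  | .rsub d i j => ⟨σ.f, Function.update σ.r d (σ.r i - σ.r j)⟩
  | .rmul d i j => ⟨σ.f, Function.update σ.r d (σ.r i * σ.r j)⟩
  | .rdiv d i j => ⟨σ.f, Function.update σ.r d (σ.r i / σ.r j)⟩
  | .rle d i j => ⟨Function.update σ.f d (if σ.r i ≤ σ.r j then 1 else 0), σ.r⟩
  | .fsel d i j k => ⟨Function.update σ.f d (if σ.f i = 0 then σ.f j else σ.f k), σ.r⟩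
  | .rsel d i j k => ⟨σ.f, Function.update σ.r d (if σ.f i = 0 then σ.r j else σ.r k)⟩

/-- A program with `n` outputs: a list of instructions and the `F`-registers that hold the
outputs at the end. -/
structure Program (F : Type u) (n : ℕ) : Type u where
  instrs : List (Instr F)
  out : Fin n → ℕ

/-- The number of operations of a program. -/
def Program.ops {F : Type u} {n : ℕ} (P : Program F n) : ℕ := P.instrs.length

/-- The initial registers: the input in the first `m` registers over `F`, zeros elsewhere. -/
def initRegs {F : Type u} [Field F] {m : ℕ} (y : Fin m → F) : Regs F :=
  ⟨fun i => if h : i < m then y ⟨i, h⟩ else 0, fun _ => 0⟩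

/-- The output of a program on input `y`. -/
def Program.eval {F : Type u} [Field F] [DecidableEq F] {m n : ℕ} (P : Program F n)
    (y : Fin m → F) : Fin n → F :=
  fun i => (P.instrs.foldl Instr.run (initRegs y)).f (P.out i)

end FiniteFieldCS

end

/-! Since `G` is injective, the measurement has two layers that can be undone in turn: the codeword
`GA'x` is recovered from the noisy word, and then the sparse vector `x` is recovered from the
codeword.

The first layer is generalized minimum distance decoding (`exists_concatenated_decoder`). With `μ =
2δ/(1-√ρ) = H_q⁻¹(1-ε)`, outer length `N` and outer dimension `k`, the noise has weight below half
of the designed distance `μt(N+1-k)` (`two_mul_noise_lt`). Inner blocks are decoded by exhaustive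
search. Averaging over erasure thresholds (`exists_threshold`) shows that for one of them
errors-and-erasures decoding of the outer code finds the codeword, and the output closest to the
received word is the right one. With `D ≤ t` thresholds and `N` symbols this costs `O(N²t³) =
O(m²t)`, where `m ≍ bs` and `t = O(log(bs))`.

The second layer is syndrome decoding (`exists_syndrome_decoder`). A vector over `F` killed by `GA'`
is killed by the lifted parity check matrix, so it lies in a Reed–Solomon code of distance `2b+1`.
Any linear map that vanishes on this kernel factors through `GA'`. Thus a word differing from `x`,
up to column multipliers, by a codeword can be computed linearly. This word can be made zero on
`n-2b` positions, so only `2b` interpolation steps, of cost `O(ns²)` each, remain.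

Both layers use Kötter's rational interpolation: two pairs `(A, B)` generate the solutions of `A(aᵢ)
= yᵢB(aᵢ)`, and the pair of smaller weighted degree has quotient equal to the message polynomial
(`KState.Inv.num_eq`). Only values and derivatives at the evaluation points are stored. Derivatives
are needed at the zeros of the denominator, which are simple.

Operations are counted by the relation `Der`, which makes costs additive; branches become
selections. The design exists by the Gilbert–Varshamov bound (`exists_inner_code`) together with the
parameter estimates of `exists_parameter_bounds`, where the factor `4q` in the equation for `t*`
pays for all roundings. -/

noncomputable section

set_option linter.unusedSectionVars false

namespace FiniteFieldCS

/-! ### Straight-line computability with cost bounds -/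

section Derivations

variable {F : Type u} [Field F] [DecidableEq F] {X : Type v}

/-- Every function in `S` is held by a register with index less than `B`. -/
def Avail (σ : X → Regs F) (B : ℕ) (S : Set ((X → F) ⊕ (X → ℝ))) : Prop :=
  (∀ g, Sum.inl g ∈ S → ∃ i < B, ∀ x, (σ x).f i = g x) ∧
    ∀ g, Sum.inr g ∈ S → ∃ i < B, ∀ x, (σ x).r i = g x

/-- From registers that hold the functions in `S`, at most `c` instructions, which write to fresh
registers only, compute all functions in `T`. -/
def Der (S : Set ((X → F) ⊕ (X → ℝ))) (c : ℕ) (T : Set ((X → F) ⊕ (X → ℝ))) : Prop :=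
  ∀ (σ : X → Regs F) (B : ℕ), Avail σ B S → ∃ (p : List (Instr F)) (B' : ℕ), B ≤ B' ∧
    p.length ≤ c ∧ (∀ x, ∀ i < B, (p.foldl Instr.run (σ x)).f i = (σ x).f i ∧
      (p.foldl Instr.run (σ x)).r i = (σ x).r i) ∧
    Avail (fun x => p.foldl Instr.run (σ x)) B' T

variable {S S' T T' U : Set ((X → F) ⊕ (X → ℝ))} {c c' : ℕ}

lemma Avail.mono {σ : X → Regs F} {B : ℕ} (h : Avail σ B S) (hT : T ⊆ S) : Avail σ B T :=
  ⟨fun g hg => h.1 g (hT hg), fun g hg => h.2 g (hT hg)⟩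

lemma Avail.union {σ : X → Regs F} {B : ℕ} (h : Avail σ B S) (h' : Avail σ B T) :
    Avail σ B (S ∪ T) :=
  ⟨fun g hg => hg.elim (h.1 g) (h'.1 g), fun g hg => hg.elim (h.2 g) (h'.2 g)⟩

lemma Avail.extend {σ σ' : X → Regs F} {B B' : ℕ} (h : Avail σ B S) (hB : B ≤ B')
    (hσ : ∀ x, ∀ i < B, (σ' x).f i = (σ x).f i ∧ (σ' x).r i = (σ x).r i) : Avail σ' B' S := by
  constructor
  · intro g hg
    obtain ⟨i, hi, h⟩ := h.1 g hg
    exact ⟨i, hi.trans_le hB, fun x => by rw [(hσ x i hi).1, h x]⟩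
  · intro g hg
    obtain ⟨i, hi, h⟩ := h.2 g hg
    exact ⟨i, hi.trans_le hB, fun x => by rw [(hσ x i hi).2, h x]⟩

lemma Der.of_subset (h : T ⊆ S) : Der S c T := fun σ B hS =>
  ⟨[], B, le_rfl, by simp, by simp, by simpa using hS.mono h⟩

lemma Der.mono (h : Der S c T) (hS : S ⊆ S') (hc : c ≤ c') (hT : T' ⊆ T) : Der S' c' T' := by
  intro σ B hA
  obtain ⟨p, B', h1, h2, h3, h4⟩ := h σ B (hA.mono hS)
  exact ⟨p, B', h1, h2.trans hc, h3, h4.mono hT⟩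

lemma Der.mono_cost (h : Der S c T) (hc : c ≤ c') : Der S c' T :=
  h.mono subset_rfl hc subset_rfl

lemma Der.mono_left (h : Der S c T) (hS : S ⊆ S') : Der S' c T := h.mono hS le_rfl subset_rfl

lemma Der.mono_right (h : Der S c T) (hT : T' ⊆ T) : Der S c T' := h.mono subset_rfl le_rfl hT

/-- Because programs write to fresh registers only, the results of the first survive the second. -/
lemma Der.trans (h : Der S c T) (h' : Der (S ∪ T) c' U) : Der S (c + c') (T ∪ U) := by
  intro σ B hA
  obtain ⟨p, B', h1, h2, h3, h4⟩ := h σ B hA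
  obtain ⟨p', B'', h1', h2', h3', h4'⟩ := h' _ B' ((hA.extend h1 h3).union h4)
  refine ⟨p ++ p', B'', h1.trans h1', by simp; omega, fun x i hi => ?_, ?_⟩
  · have := h3 x i hi
    have h' := h3' x i (hi.trans_le h1)
    rw [List.foldl_append]
    exact ⟨h'.1.trans this.1, h'.2.trans this.2⟩
  · simp only [List.foldl_append]
    exact (h4.extend h1' h3').union h4'

lemma Der.bind (h : Der S c T) (h' : Der (S ∪ T) c' U) : Der S (c + c') U :=
  (h.trans h').mono_right Set.subset_union_right

lemma Der.union (h : Der S c T) (h' : Der S c' U) : Der S (c + c') (T ∪ U) :=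
  h.trans (h'.mono_left Set.subset_union_left)

lemma Der.biUnion {ι : Type*} (I : Finset ι) {T : ι → Set ((X → F) ⊕ (X → ℝ))}
    (h : ∀ i ∈ I, Der S c (T i)) : Der S (I.card * c) (⋃ i ∈ I, T i) := by
  classical
  induction I using Finset.induction_on with
  | empty => exact Der.of_subset (by simp)
  | insert a I ha ih =>
    rw [Finset.card_insert_of_notMem ha, Finset.set_biUnion_insert]
    exact ((h a (by simp)).union (ih fun i hi => h i (by simp [hi]))).mono_cost
      (by rw [add_mul, one_mul, add_comm])

lemma Der.iUnion {ι : Type*} [Fintype ι] {T : ι → Set ((X → F) ⊕ (X → ℝ))}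
    (h : ∀ i, Der S c (T i)) : Der S (Fintype.card ι * c) (⋃ i, T i) := by
  simpa using Der.biUnion Finset.univ fun i _ => h i

lemma Der.iterate {U : ℕ → Set ((X → F) ⊕ (X → ℝ))} {c₀ : ℕ} (n : ℕ) (h0 : Der S c₀ (U 0))
    (h : ∀ i < n, Der (S ∪ U i) c (U (i + 1))) : Der S (c₀ + n * c) (U n) := by
  induction n with
  | zero => simpa using h0
  | succ n ih =>
    exact ((ih fun i hi => h i (by omega)).bind (h n (by omega))).mono_cost
      (by rw [add_mul, one_mul, add_assoc])

lemma Der.of_mem {v : (X → F) ⊕ (X → ℝ)} (h : v ∈ S) : Der S 0 {v} :=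
  Der.of_subset (by simpa using h)

/-- The instruction is chosen before the input `x`: register addresses come from availability alone.
The target `B` is the first register not in use. -/
lemma Der.of_instr_f {g : X → F} (h : ∀ (σ : X → Regs F) (B : ℕ), Avail σ B S →
    ∃ i : Instr F, ∀ x, i.run (σ x) = ⟨Function.update (σ x).f B (g x), (σ x).r⟩) :
    Der S 1 {Sum.inl g} := by
  intro σ B hA
  obtain ⟨i, hi⟩ := h σ B hA
  refine ⟨[i], B + 1, by omega, by simp, fun x j hj => ?_, ?_, ?_⟩
  · simp [hi, hj.ne]
  · intro g' hg'
    obtain rfl : g' = g := by simpa using hg'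
    exact ⟨B, by omega, fun x => by simp [hi]⟩
  · simp

lemma Der.of_instr_r {g : X → ℝ} (h : ∀ (σ : X → Regs F) (B : ℕ), Avail σ B S →
    ∃ i : Instr F, ∀ x, i.run (σ x) = ⟨(σ x).f, Function.update (σ x).r B (g x)⟩) :
    Der S 1 {Sum.inr g} := by
  intro σ B hA
  obtain ⟨i, hi⟩ := h σ B hA
  refine ⟨[i], B + 1, by omega, by simp, fun x j hj => ?_, ?_, ?_⟩
  · simp [hi, hj.ne]
  · simp
  · intro g' hg'
    obtain rfl : g' = g := by simpa using hg'
    exact ⟨B, by omega, fun x => by simp [hi]⟩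

/-! ### Derivation rules for single instructions -/

section Instructions

variable {g h k : X → F} {r t : X → ℝ} {c₁ c₂ c₃ : ℕ}

lemma Der.fconst (a : F) : Der S 1 {Sum.inl fun _ : X => a} :=
  Der.of_instr_f fun _ B _ => ⟨.fconst B a, fun _ => rfl⟩

lemma Der.fadd (hg : Der S c₁ {Sum.inl g}) (hh : Der S c₂ {Sum.inl h}) :
    Der S (c₁ + c₂ + 1) {Sum.inl fun x => g x + h x} := by
  refine (hg.union hh).bind (Der.of_instr_f fun σ B hA => ?_)
  obtain ⟨i, -, hi⟩ := hA.1 g (by simp)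
  obtain ⟨j, -, hj⟩ := hA.1 h (by simp)
  exact ⟨.fadd B i j, fun x => by rw [← hi, ← hj]; rfl⟩

lemma Der.fsub (hg : Der S c₁ {Sum.inl g}) (hh : Der S c₂ {Sum.inl h}) :
    Der S (c₁ + c₂ + 1) {Sum.inl fun x => g x - h x} := by
  refine (hg.union hh).bind (Der.of_instr_f fun σ B hA => ?_)
  obtain ⟨i, -, hi⟩ := hA.1 g (by simp)
  obtain ⟨j, -, hj⟩ := hA.1 h (by simp)
  exact ⟨.fsub B i j, fun x => by rw [← hi, ← hj]; rfl⟩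

lemma Der.fmul (hg : Der S c₁ {Sum.inl g}) (hh : Der S c₂ {Sum.inl h}) :
    Der S (c₁ + c₂ + 1) {Sum.inl fun x => g x * h x} := by
  refine (hg.union hh).bind (Der.of_instr_f fun σ B hA => ?_)
  obtain ⟨i, -, hi⟩ := hA.1 g (by simp)
  obtain ⟨j, -, hj⟩ := hA.1 h (by simp)
  exact ⟨.fmul B i j, fun x => by rw [← hi, ← hj]; rfl⟩

lemma Der.fdiv (hg : Der S c₁ {Sum.inl g}) (hh : Der S c₂ {Sum.inl h}) :
    Der S (c₁ + c₂ + 1) {Sum.inl fun x => g x / h x} := by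
  refine (hg.union hh).bind (Der.of_instr_f fun σ B hA => ?_)
  obtain ⟨i, -, hi⟩ := hA.1 g (by simp)
  obtain ⟨j, -, hj⟩ := hA.1 h (by simp)
  exact ⟨.fdiv B i j, fun x => by rw [← hi, ← hj]; rfl⟩

lemma Der.fsel (hk : Der S c₁ {Sum.inl k}) (hg : Der S c₂ {Sum.inl g})
    (hh : Der S c₃ {Sum.inl h}) :
    Der S (c₁ + c₂ + c₃ + 1) {Sum.inl fun x => if k x = 0 then g x else h x} := by
  refine ((hk.union hg).union hh).bind (Der.of_instr_f fun σ B hA => ?_)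
  obtain ⟨l, -, hl⟩ := hA.1 k (by simp)
  obtain ⟨i, -, hi⟩ := hA.1 g (by simp)
  obtain ⟨j, -, hj⟩ := hA.1 h (by simp)
  exact ⟨.fsel B l i j, fun x => by rw [← hi, ← hj, ← hl]; rfl⟩

lemma Der.rsel (hk : Der S c₁ {Sum.inl k}) (hr : Der S c₂ {Sum.inr r})
    (ht : Der S c₃ {Sum.inr t}) :
    Der S (c₁ + c₂ + c₃ + 1) {Sum.inr fun x => if k x = 0 then r x else t x} := by
  refine ((hk.union hr).union ht).bind (Der.of_instr_r fun σ B hA => ?_)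
  obtain ⟨l, -, hl⟩ := hA.1 k (by simp)
  obtain ⟨i, -, hi⟩ := hA.2 r (by simp)
  obtain ⟨j, -, hj⟩ := hA.2 t (by simp)
  exact ⟨.rsel B l i j, fun x => by rw [← hi, ← hj, ← hl]; rfl⟩

lemma Der.rle (hr : Der S c₁ {Sum.inr r}) (ht : Der S c₂ {Sum.inr t}) :
    Der S (c₁ + c₂ + 1) {Sum.inl fun x => if r x ≤ t x then (1 : F) else 0} := by
  refine (hr.union ht).bind (Der.of_instr_f fun σ B hA => ?_)
  obtain ⟨i, -, hi⟩ := hA.2 r (by simp)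
  obtain ⟨j, -, hj⟩ := hA.2 t (by simp)
  exact ⟨.rle B i j, fun x => by rw [← hi, ← hj]; rfl⟩

lemma Der.rone : Der S 1 {Sum.inr fun _ : X => (1 : ℝ)} :=
  Der.of_instr_r fun _ B _ => ⟨.rone B, fun _ => rfl⟩

lemma Der.radd (hr : Der S c₁ {Sum.inr r}) (ht : Der S c₂ {Sum.inr t}) :
    Der S (c₁ + c₂ + 1) {Sum.inr fun x => r x + t x} := by
  refine (hr.union ht).bind (Der.of_instr_r fun σ B hA => ?_)
  obtain ⟨i, -, hi⟩ := hA.2 r (by simp)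
  obtain ⟨j, -, hj⟩ := hA.2 t (by simp)
  exact ⟨.radd B i j, fun x => by rw [← hi, ← hj]; rfl⟩

lemma Der.rsub (hr : Der S c₁ {Sum.inr r}) (ht : Der S c₂ {Sum.inr t}) :
    Der S (c₁ + c₂ + 1) {Sum.inr fun x => r x - t x} := by
  refine (hr.union ht).bind (Der.of_instr_r fun σ B hA => ?_)
  obtain ⟨i, -, hi⟩ := hA.2 r (by simp)
  obtain ⟨j, -, hj⟩ := hA.2 t (by simp)
  exact ⟨.rsub B i j, fun x => by rw [← hi, ← hj]; rfl⟩

/-- The only real constant is one, so zero is `1 - 1` and `n` takes `n` further additions. Linear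
cost is harmless for degree bounds and thresholds. -/
lemma Der.rnat (n : ℕ) : Der S (2 * n + 3) {Sum.inr fun _ : X => (n : ℝ)} := by
  induction n with
  | zero => simpa using Der.rsub (S := S) (X := X) Der.rone Der.rone
  | succ n ih => simpa using (ih.radd Der.rone).mono_cost (by omega)

end Instructions

/-- The coordinate functions of a vector-valued function. -/
def coordFns {ι : Type*} (v : X → ι → F) : Set ((X → F) ⊕ (X → ℝ)) :=
  Set.range fun i => Sum.inl fun x => v x i

lemma mem_coordFns {ι : Type*} (v : X → ι → F) (i : ι) : Sum.inl (fun x => v x i) ∈ coordFns v := ⟨i, rfl⟩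

lemma coordFns_eq_iUnion {ι : Type*} (v : X → ι → F) :
    coordFns v = ⋃ i, {Sum.inl fun x => v x i} := by
  rw [coordFns, Set.iUnion_singleton_eq_range]

lemma Der.vec {ι : Type*} [Fintype ι] {v : X → ι → F}
    (h : ∀ i, Der S c {Sum.inl fun x => v x i}) : Der S (Fintype.card ι * c) (coordFns v) := by
  rw [coordFns_eq_iUnion]
  exact Der.iUnion h

lemma Der.vec_const {ι : Type*} [Fintype ι] (a : ι → F) :
    Der S (Fintype.card ι) (coordFns fun _ : X => a) :=
  (Der.vec fun i => Der.fconst (a i)).mono_cost (by simp)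

lemma Der.vec_sel {ι : Type*} [Fintype ι] {k : X → F} {v w : X → ι → F} {c₁ c₂ c₃ : ℕ}
    (hk : Der S c₁ {Sum.inl k}) (hv : Der S c₂ (coordFns v))
    (hw : Der S c₃ (coordFns w)) :
    Der S (c₁ + c₂ + c₃ + Fintype.card ι)
      (coordFns fun x => if k x = 0 then v x else w x) := by
  refine ((hk.union hv).union hw).bind ((Der.vec (c := 1) fun i => ?_).mono_cost (by simp))
  have := Der.fsel (S := S ∪ ({Sum.inl k} ∪ coordFns v ∪ coordFns w))
    (Der.of_mem (v := Sum.inl k) (by simp))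
    (Der.of_mem (.inr (.inl (.inr (mem_coordFns v i))))) (Der.of_mem (.inr (.inr (mem_coordFns w i))))
  convert this using 5
  split_ifs <;> rfl

lemma Der.sum_smul {ι : Type*} (I : Finset ι) (a : ι → F) {g : ι → X → F}
    (hg : ∀ i ∈ I, Sum.inl (g i) ∈ S) :
    Der S (3 * I.card + 1) {Sum.inl fun x => ∑ i ∈ I, a i * g i x} := by
  classical
  induction I using Finset.induction_on with
  | empty => simpa using Der.fconst (S := S) (X := X) 0
  | insert j I hj ih =>
    simp_rw [Finset.sum_insert hj, Finset.card_insert_of_notMem hj]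
    exact (((Der.fconst (a j)).fmul (Der.of_mem (hg j (by simp)))).fadd
      (ih fun i hi => hg i (by simp [hi]))).mono_cost (by omega)

/-- An `F`-linear map applied to a vector of available functions. -/
lemma Der.linearMap {ι κ : Type*} [Fintype ι] [Fintype κ] (f : (ι → F) →ₗ[F] (κ → F))
    {v : X → ι → F} (hv : coordFns v ⊆ S) :
    Der S (Fintype.card κ * (3 * Fintype.card ι + 1)) (coordFns fun x => f (v x)) := by
  classical
  refine Der.vec fun j => ?_
  have := Der.sum_smul (S := S) Finset.univ (fun i => f (Pi.single i 1) j)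
    (g := fun i x => v x i) fun i _ => hv (mem_coordFns v i)
  convert this using 4
  · rfl
  rename_i x
  conv_lhs => rw [LinearMap.pi_apply_eq_sum_univ f (v x)]
  simp only [Finset.sum_apply, Pi.smul_apply, smul_eq_mul]
  refine Finset.sum_congr rfl fun i _ => ?_
  have : (fun k => if i = k then (1 : F) else 0) = Pi.single i 1 := by
    ext k
    simp [Pi.single_apply, eq_comm]
  rw [mul_comm, this]

/-- The count lives in a real register, since a sum of ones in `F` would be reduced modulo the
characteristic. -/
lemma Der.hamming_dist {ι : Type*} [Fintype ι] {v w : X → ι → F} {c₁ c₂ : ℕ}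
    (hv : ∀ i, Der S c₁ {Sum.inl fun x => v x i})
    (hw : ∀ i, Der S c₂ {Sum.inl fun x => w x i}) :
    Der S (Fintype.card ι * (c₁ + c₂ + 7) + 3)
      {Sum.inr fun x => (hammingDist (v x) (w x) : ℝ)} := by
  classical
  have key : ∀ I : Finset ι, Der S (I.card * (c₁ + c₂ + 7) + 3)
      {Sum.inr fun x => (((I.filter fun i => v x i ≠ w x i).card : ℕ) : ℝ)} := by
    intro I
    induction I using Finset.induction_on with
    | empty => simpa using Der.rnat (S := S) (X := X) 0
    | insert j I hj ih =>
      have h0 : Der S 3 {Sum.inr fun _ : X => (0 : ℝ)} := by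
        simpa using Der.rnat (S := S) (X := X) 0
      have h := (((hv j).fsub (hw j)).rsel h0 Der.rone).radd ih
      rw [Finset.card_insert_of_notMem hj]
      convert h.mono_cost (c' := (I.card + 1) * (c₁ + c₂ + 7) + 3) ?_ using 4 with x
      · by_cases hx : v x j = w x j
        · simp [Finset.filter_insert, hx]
        · simp [Finset.filter_insert, hx, hj, sub_eq_zero, add_comm]
      · rw [add_mul]; omega
  simpa [hammingDist] using key Finset.univ

/-- The closest of finitely many candidates. -/
lemma Der.argmin {κ : Type*} [Fintype κ] {l : ℕ} (D : Fin (l + 1) → X → ℝ)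
    (v : Fin (l + 1) → X → κ → F) (h : ∀ i, Der S c ({Sum.inr (D i)} ∪ coordFns (v i))) :
    ∃ (D' : X → ℝ) (v' : X → κ → F),
      Der S ((l + 1) * (c + 2 + Fintype.card κ)) ({Sum.inr D'} ∪ coordFns v') ∧
      ∀ x, (∃ i, D' x = D i x ∧ v' x = v i x) ∧ ∀ i, D' x ≤ D i x := by
  classical
  induction l with
  | zero => exact ⟨D 0, v 0, (h 0).mono_cost (by omega), fun x => ⟨⟨0, rfl, rfl⟩, fun i => by
      rw [Fin.eq_zero i]⟩⟩
  | succ l ih =>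
    obtain ⟨D', v', h', hs⟩ := ih (fun i => D i.castSucc) (fun i => v i.castSucc)
      fun i => h i.castSucc
    set j := Fin.last (l + 1)
    -- The inner conditional is the `F`-valued flag produced by a comparison; flag zero means that
    -- the new candidate is strictly better.
    refine ⟨fun x => if (if D' x ≤ D j x then (1 : F) else 0) = 0 then D j x else D' x,
      fun x => if (if D' x ≤ D j x then (1 : F) else 0) = 0 then v j x else v' x, ?_, ?_⟩
    · refine ((h'.union (h j)).bind (U := _) (c' := 2 + Fintype.card κ) ?_).mono_cost
        (by ring_nf; omega)
      set W := S ∪ ({Sum.inr D'} ∪ coordFns v' ∪ ({Sum.inr (D j)} ∪ coordFns (v j))) with hW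
      have hD' : Sum.inr D' ∈ W := .inr (.inl (.inl rfl))
      have hD : Sum.inr (D j) ∈ W := .inr (.inr (.inl rfl))
      have hv' : coordFns v' ⊆ W := fun y hy => .inr (.inl (.inr hy))
      have hv : coordFns (v j) ⊆ W := fun y hy => .inr (.inr (.inr hy))
      have e := (Der.of_mem hD').rle (Der.of_mem hD)
      refine (e.bind (c' := 1 + Fintype.card κ) ?_).mono_cost (by omega)
      have hW' := Set.subset_union_left (s := W)
        (t := {Sum.inl fun x => if D' x ≤ D j x then (1 : F) else 0})
      have ef := Der.of_mem (S := W ∪ {Sum.inl fun x => if D' x ≤ D j x then (1 : F) else 0})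
        (v := Sum.inl fun x => if D' x ≤ D j x then (1 : F) else 0) (by simp)
      exact ((ef.rsel (Der.of_mem (hW' hD)) (Der.of_mem (hW' hD'))).union
        (ef.vec_sel (Der.of_subset (c := 0) (hv.trans hW'))
          (Der.of_subset (c := 0) (hv'.trans hW')))).mono_cost
        (by omega)
    · intro x
      obtain ⟨⟨i, hi, hi'⟩, hle⟩ := hs x
      by_cases hx : D' x ≤ D j x
      · simp only [hx, if_true, one_ne_zero, if_false]
        exact ⟨⟨i.castSucc, hi, hi'⟩, fun i => Fin.lastCases hx hle i⟩
      · simp only [hx, if_true, if_false]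
        exact ⟨⟨j, rfl, rfl⟩, fun i => Fin.lastCases le_rfl
          (fun i => (not_le.mp hx).le.trans (hle i)) i⟩

/-- A derivation from the input registers gives a program. -/
lemma Der.exists_program {m n : ℕ} {c : ℕ} {g : (Fin m → F) → Fin n → F}
    (h : Der (coordFns fun y : Fin m → F => y) c (coordFns g)) :
    ∃ P : Program F n, P.ops ≤ c ∧ ∀ y : Fin m → F, P.eval y = g y := by
  obtain ⟨p, B', -, hp, -, hA⟩ := h initRegs m ⟨by
    rintro _ ⟨i, hi⟩
    exact ⟨i, i.2, fun x => by simp [initRegs, ← Sum.inl.inj hi]⟩, by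
    rintro _ ⟨i, hi⟩
    simp at hi⟩
  choose out _ hout using fun i => hA.1 _ (mem_coordFns g i)
  exact ⟨⟨p, out⟩, hp, fun y => funext fun i => hout i y⟩

end Derivations

/-! ### Arithmetic in an extension field -/

section Extension

variable {F : Type u} [Field F] [DecidableEq F] {X : Type v} {L : Type*} [Field L] [Algebra F L]
  (pb : PowerBasis F L) {S : Set ((X → F) ⊕ (X → ℝ))} {g h : X → L} {k : X → F}
  {c c₁ c₂ c₃ : ℕ}

/-- The coordinate functions of a function with values in an extension field. -/
def fieldFns (g : X → L) : Set ((X → F) ⊕ (X → ℝ)) :=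
  coordFns fun x => pb.basis.equivFun (g x)

variable {pb}

lemma mem_fieldFns (g : X → L) (i : Fin pb.dim) :
    Sum.inl (fun x => pb.basis.equivFun (g x) i) ∈ fieldFns pb g := ⟨i, rfl⟩

lemma Der.lconst (a : L) : Der S pb.dim (fieldFns pb fun _ : X => a) := by
  have := Der.vec_const (S := S) (X := X) (pb.basis.equivFun a)
  rwa [Fintype.card_fin] at this

lemma Der.of_coords (hg : ∀ i, Der S c {Sum.inl fun x => pb.basis.equivFun (g x) i}) :
    Der S (pb.dim * c) (fieldFns pb g) := by
  have := Der.vec hg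
  rwa [Fintype.card_fin] at this

lemma Der.ladd (hg : Der S c₁ (fieldFns pb g)) (hh : Der S c₂ (fieldFns pb h)) :
    Der S (c₁ + c₂ + pb.dim) (fieldFns pb fun x => g x + h x) := by
  refine (hg.union hh).bind ((Der.of_coords (c := 1) fun i => ?_).mono_cost (by simp))
  simp only [map_add, Pi.add_apply]
  exact Der.fadd (c₁ := 0) (c₂ := 0) (Der.of_mem (.inr (.inl (mem_fieldFns g i))))
    (Der.of_mem (.inr (.inr (mem_fieldFns h i))))

lemma Der.lsub (hg : Der S c₁ (fieldFns pb g)) (hh : Der S c₂ (fieldFns pb h)) :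
    Der S (c₁ + c₂ + pb.dim) (fieldFns pb fun x => g x - h x) := by
  refine (hg.union hh).bind ((Der.of_coords (c := 1) fun i => ?_).mono_cost (by simp))
  simp only [map_sub, Pi.sub_apply]
  exact Der.fsub (c₁ := 0) (c₂ := 0) (Der.of_mem (.inr (.inl (mem_fieldFns g i))))
    (Der.of_mem (.inr (.inr (mem_fieldFns h i))))

lemma Der.lsel (hk : Der S c₁ {Sum.inl k}) (hg : Der S c₂ (fieldFns pb g))
    (hh : Der S c₃ (fieldFns pb h)) :
    Der S (c₁ + c₂ + c₃ + pb.dim) (fieldFns pb fun x => if k x = 0 then g x else h x) := by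
  have := Der.vec_sel hk hg hh
  rw [Fintype.card_fin] at this
  convert this using 1
  unfold fieldFns
  congr 1
  ext x
  by_cases hx : k x = 0 <;> simp [hx]

/-- The zero test in an extension field. -/
lemma Der.lzero (hg : Der S c (fieldFns pb g)) [DecidableEq L] :
    Der S (c + 3 * pb.dim) {Sum.inl fun x => if g x = 0 then (0 : F) else 1} := by
  classical
  refine hg.bind ?_
  have key : ∀ I : Finset (Fin pb.dim), Der (S ∪ fieldFns pb g) (1 + 2 * I.card)
      {Sum.inl fun x => if ∀ i ∈ I, pb.basis.equivFun (g x) i = 0 then (0 : F) else 1} := by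
    intro I
    induction I using Finset.induction_on with
    | empty => simpa using Der.fconst (S := S ∪ fieldFns pb g) (X := X) 0
    | insert j I hj ih =>
      rw [Finset.card_insert_of_notMem hj]
      convert (Der.fsel (Der.of_mem (.inr (mem_fieldFns g j))) ih
        (Der.fconst 1)).mono_cost (c' := 1 + 2 * (I.card + 1)) (by omega) using 4 with x
      simp only [Finset.forall_mem_insert]
      split_ifs <;> first | rfl | tauto
  have hd := pb.dim_pos
  refine (key Finset.univ).mono_cost (c' := 3 * pb.dim) (by simp; omega) |>.mono_right ?_
  simp only [Finset.mem_univ, true_implies, Set.singleton_subset_iff, Set.mem_singleton_iff]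
  congr! 3 with x
  rw [← pb.basis.equivFun.map_eq_zero_iff, funext_iff]
  rfl

/-- Multiplication by the generator. -/
lemma Der.gen_mul (hg : fieldFns pb g ⊆ S) :
    Der S (3 * pb.dim) (fieldFns pb fun x => pb.gen * g x) := by
  rw [mul_comm]
  refine Der.of_coords fun j => ?_
  have hd := pb.dim_pos
  set last : Fin pb.dim := ⟨pb.dim - 1, by omega⟩ with hlast
  -- The companion matrix: coordinates are shifted by one, and the top coordinate is fed back
  -- through the coordinates of `gen ^ dim`. This makes the cost linear in the dimension.
  have key : ∀ z : L, pb.basis.equivFun (pb.gen * z) j =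
      (if h : 0 < (j : ℕ) then pb.basis.equivFun z ⟨j - 1, by omega⟩ else 0) +
        pb.basis.equivFun (pb.gen ^ pb.dim) j * pb.basis.equivFun z last := by
    intro z
    have hz : pb.gen * z = ∑ i, pb.basis.equivFun z i • pb.gen ^ ((i : ℕ) + 1) := by
      conv_lhs => rw [← pb.basis.sum_equivFun z, Finset.mul_sum]
      refine Finset.sum_congr rfl fun i _ => ?_
      rw [pb.coe_basis, mul_smul_comm, pow_succ']
    have hb : ∀ (i : ℕ) (hi : i < pb.dim) (l : Fin pb.dim),
        pb.basis.equivFun (pb.gen ^ i) l = if l = ⟨i, hi⟩ then 1 else 0 := by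
      intro i hi l
      have : pb.gen ^ i = pb.basis ⟨i, hi⟩ := by rw [pb.coe_basis]
      rw [this, Module.Basis.equivFun_self]
      simp [eq_comm]
    rw [hz, map_sum, Finset.sum_apply]
    simp only [map_smul, Pi.smul_apply, smul_eq_mul]
    rw [← Finset.sum_erase_add _ _ (Finset.mem_univ last)]
    congr 1
    · have : ∀ i ∈ Finset.univ.erase last, pb.basis.equivFun z i *
          pb.basis.equivFun (pb.gen ^ ((i : ℕ) + 1)) j =
          if (j : ℕ) = i + 1 then pb.basis.equivFun z i else 0 := by
        intro i hi
        have hi' : (i : ℕ) + 1 < pb.dim := by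
          have := Fin.val_ne_of_ne (Finset.ne_of_mem_erase hi)
          simp only [hlast] at this
          omega
        rw [hb _ hi']
        simp [Fin.ext_iff]
      rw [Finset.sum_congr rfl this]
      split_ifs with hj
      · rw [Finset.sum_eq_single ⟨(j : ℕ) - 1, by omega⟩]
        · rw [if_pos (by simp; omega)]
        · intro i _ hi
          rw [if_neg]
          simp only [ne_eq, Fin.ext_iff] at hi
          omega
        · intro h
          simp only [Finset.mem_erase, Finset.mem_univ, and_true, not_not, hlast,
            Fin.ext_iff] at h
          omega
      · exact Finset.sum_eq_zero fun i _ => if_neg (by omega)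
    · rw [mul_comm, hlast]
      simp [Nat.sub_add_cancel hd]
  simp only [key]
  have hm := (Der.fconst (S := S) (pb.basis.equivFun (pb.gen ^ pb.dim) j)).fmul
    (Der.of_mem (hg (mem_fieldFns g last)))
  by_cases hj : 0 < (j : ℕ)
  · simp only [hj, dif_pos]
    exact (Der.of_mem (hg (mem_fieldFns g ⟨j - 1, by omega⟩))).fadd hm |>.mono_cost (by omega)
  · simp only [hj, dif_neg, not_false_eq_true, zero_add]
    exact hm.mono_cost (by omega)

/-- Multiplication in an extension field, by Horner's rule. -/
lemma Der.lmul (hg : Der S c₁ (fieldFns pb g)) (hh : Der S c₂ (fieldFns pb h)) :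
    Der S (c₁ + c₂ + 6 * pb.dim ^ 2) (fieldFns pb fun x => g x * h x) := by
  classical
  have hd := pb.dim_pos
  refine (hg.union hh).bind ?_
  set W := S ∪ (fieldFns pb g ∪ fieldFns pb h) with hW
  have hgW : fieldFns pb g ⊆ W := fun y hy => .inr (.inl hy)
  have hhW : fieldFns pb h ⊆ W := fun y hy => .inr (.inr hy)
  let a : X → ℕ → F := fun x i => if hi : i < pb.dim then pb.basis.equivFun (h x) ⟨i, hi⟩ else 0
  -- Stage `i` holds the shifted factor `gen ^ i * g` and the part of the product that comes from
  -- the first `i` coordinates of `h`.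
  let U : ℕ → Set ((X → F) ⊕ (X → ℝ)) := fun i =>
    fieldFns pb (fun x => pb.gen ^ i * g x) ∪
      fieldFns pb (fun x => ∑ j ∈ Finset.range i, a x j • (pb.gen ^ j * g x))
  have h0 : Der W pb.dim (U 0) := by
    simp only [U, pow_zero, one_mul, Finset.range_zero, Finset.sum_empty]
    exact ((Der.of_subset (c := 0) hgW).union (Der.lconst 0)).mono_cost (by omega)
  have hU := Der.iterate (c := 5 * pb.dim) (U := U) pb.dim h0 fun i hi => ?_
  · refine (hU.mono_right (T' := fieldFns pb fun x => g x * h x) ?_).mono_cost (by nlinarith)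
    refine Set.Subset.trans (Eq.subset ?_) Set.subset_union_right
    congr 1
    ext x
    conv_lhs => rw [← pb.basis.sum_equivFun (h x), Finset.mul_sum]
    rw [Finset.sum_range]
    refine Finset.sum_congr rfl fun i _ => ?_
    rw [pb.coe_basis, mul_smul_comm, mul_comm]
    simp [a]
  · have e1 : Der (W ∪ U i) (3 * pb.dim) (fieldFns pb fun x => pb.gen ^ (i + 1) * g x) := by
      simp only [pow_succ', mul_assoc]
      exact Der.gen_mul fun y hy => .inr (.inl hy)
    have e2 : Der (W ∪ U i) (pb.dim * 2)
        (fieldFns pb fun x => ∑ j ∈ Finset.range (i + 1), a x j • (pb.gen ^ j * g x)) := by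
      refine Der.of_coords fun l => ?_
      simp only [Finset.sum_range_succ, map_add, Pi.add_apply, map_smul, Pi.smul_apply,
        smul_eq_mul]
      have ha : Sum.inl (fun x => a x i) ∈ W ∪ U i := by
        simp only [a, hi, dif_pos]
        exact .inl (hhW (mem_fieldFns h ⟨i, hi⟩))
      exact ((Der.of_mem (.inr (.inr (mem_fieldFns _ l)))).fadd ((Der.of_mem ha).fmul
        (Der.of_mem (.inr (.inl (mem_fieldFns _ l)))))).mono_cost (by omega)
    exact (e1.union e2).mono_cost (by omega)

/-- Powers of a field element, by repeated multiplication. -/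
lemma Der.lpow (hg : Der S c (fieldFns pb g)) (n : ℕ) :
    Der S (c + pb.dim + n * (6 * pb.dim ^ 2)) (fieldFns pb fun x => g x ^ n) := by
  have h0 : Der (S ∪ fieldFns pb g) pb.dim (fieldFns pb fun x => g x ^ 0) := by
    simpa using Der.lconst (1 : L)
  have := hg.bind (Der.iterate (c := 6 * pb.dim ^ 2) (U := fun i => fieldFns pb fun x => g x ^ i)
    n h0 fun i _ => ?_)
  · exact this.mono_cost (by omega)
  · simp only [pow_succ]
    exact ((Der.of_subset (c := 0) Set.subset_union_right).lmul
      (Der.of_subset (c := 0) fun y hy => .inl (.inr hy))).mono_cost (le_of_eq (by ring))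

/-- Division in an extension field, when the quotient is known to belong to the base field. -/
lemma Der.ldiv_base (hg : Der S c₁ (fieldFns pb g)) (hh : Der S c₂ (fieldFns pb h)) :
    ∃ r : X → F, Der S (c₁ + c₂ + 3 * pb.dim) {Sum.inl r} ∧
      ∀ x (a : F), h x ≠ 0 → g x = algebraMap F L a * h x → r x = a := by
  classical
  -- If `g = a h` with `a` in `F`, then `gᵢ = a hᵢ` in every coordinate, so one nonzero coordinate
  -- of `h` gives `a` by a division in `F`. No inversion in `L` is needed.
  have key : ∀ I : Finset (Fin pb.dim), ∃ r : X → F,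
      Der (S ∪ (fieldFns pb g ∪ fieldFns pb h)) (1 + 2 * I.card) {Sum.inl r} ∧
      ∀ x (a : F), (∃ i ∈ I, pb.basis.equivFun (h x) i ≠ 0) →
        g x = algebraMap F L a * h x → r x = a := by
    intro I
    induction I using Finset.induction_on with
    | empty => exact ⟨fun _ => 0, Der.fconst 0, by simp⟩
    | insert j I hj ih =>
      obtain ⟨r, hr, hs⟩ := ih
      have hgj := Der.of_mem (S := S ∪ (fieldFns pb g ∪ fieldFns pb h))
        (.inr (.inl (mem_fieldFns g j)))
      have hhj := Der.of_mem (S := S ∪ (fieldFns pb g ∪ fieldFns pb h))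
        (.inr (.inr (mem_fieldFns h j)))
      refine ⟨_, (hhj.fsel hr (hgj.fdiv hhj)).mono_cost
        (by rw [Finset.card_insert_of_notMem hj]; omega), fun x a hx hxa => ?_⟩
      split_ifs with h0
      · refine hs x a ?_ hxa
        obtain ⟨i, hi, hi'⟩ := hx
        rcases Finset.mem_insert.mp hi with rfl | hi
        · exact absurd h0 hi'
        · exact ⟨i, hi, hi'⟩
      · rw [hxa, ← Algebra.smul_def, map_smul, Pi.smul_apply, smul_eq_mul,
          mul_div_cancel_right₀ _ h0]
  obtain ⟨r, hr, hs⟩ := key Finset.univ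
  have hd := pb.dim_pos
  refine ⟨r, (hg.union hh).bind (hr.mono_cost (by simp; omega)), fun x a hx => hs x a ?_⟩
  by_contra! h0
  exact hx (pb.basis.equivFun.map_eq_zero_iff.mp (funext fun i => h0 i (Finset.mem_univ i)))

end Extension

/-! ### Rational interpolation -/

section Koetter

open Polynomial

variable {L : Type*} [Field L]

/-- Two solutions `(A₁, B₁)`, `(A₂, B₂)` of the interpolation conditions `A(a) = y B(a)` imposed so
far, with bounds `d₁`, `d₂` for their weighted degrees. -/
structure KState (L : Type*) [Field L] where
  A₁ : L[X]
  B₁ : L[X]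
  A₂ : L[X]
  B₂ : L[X]
  d₁ : ℕ
  d₂ : ℕ

namespace KState

/-- The discrepancy of the first solution. -/
def disc₁ (st : KState L) (a y : L) : L := st.A₁.eval a - y * st.B₁.eval a

/-- The discrepancy of the second solution. -/
def disc₂ (st : KState L) (a y : L) : L := st.A₂.eval a - y * st.B₂.eval a

open Classical in
/-- One step of Kötter's interpolation algorithm: impose the condition `A(a) = y B(a)`. -/
def step (a y : L) (st : KState L) : KState L :=
  -- The pivot is a solution with nonzero discrepancy, of smaller degree bound if both qualify. It
  -- is multiplied by `X - a`; the other solution is corrected by a multiple of it, which does not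
  -- raise its own bound.
  if st.disc₁ a y ≠ 0 ∧ (st.disc₂ a y = 0 ∨ st.d₁ ≤ st.d₂) then
    ⟨(X - C a) * st.A₁, (X - C a) * st.B₁,
      C (st.disc₁ a y) * st.A₂ - C (st.disc₂ a y) * st.A₁,
      C (st.disc₁ a y) * st.B₂ - C (st.disc₂ a y) * st.B₁, st.d₁ + 1, st.d₂⟩
  else
    ⟨C (st.disc₂ a y) * st.A₁ - C (st.disc₁ a y) * st.A₂,
      C (st.disc₂ a y) * st.B₁ - C (st.disc₁ a y) * st.B₂,
      (X - C a) * st.A₂, (X - C a) * st.B₂, st.d₁, st.d₂ + 1⟩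

variable {ι : Type*}

/-- Kötter's interpolation algorithm for the points in a list, except for the erased ones. -/
def interp (a y : ι → L) (er : ι → Prop) [DecidablePred er] : List ι → KState L → KState L
  | [], st => st
  | i :: l, st => interp a y er l (if er i then st else st.step (a i) (y i))

/-- The numerator of the solution with the smaller degree bound. -/
def num (st : KState L) : L[X] := if st.d₁ ≤ st.d₂ then st.A₁ else st.A₂

/-- The denominator of the solution with the smaller degree bound. -/
def den (st : KState L) : L[X] := if st.d₁ ≤ st.d₂ then st.B₁ else st.B₂

/-- The invariant of the algorithm: the conditions at the points in `J` hold, and the two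
solutions form a basis of the module of all solutions. -/
structure Inv (a y : ι → L) (k : ℕ) (J : Finset ι) (st : KState L) : Prop where
  interp₁ : ∀ i ∈ J, st.A₁.eval (a i) = y i * st.B₁.eval (a i)
  interp₂ : ∀ i ∈ J, st.A₂.eval (a i) = y i * st.B₂.eval (a i)
  -- This determinant condition is what expresses the basis property.
  det : ∃ c : L, c ≠ 0 ∧ st.A₁ * st.B₂ - st.A₂ * st.B₁ = C c * Lagrange.nodal J a
  degA₁ : st.A₁ ∈ degreeLT L st.d₁
  -- The denominator carries weight `k`: `deg A < d` and `deg B + k ≤ d`. Multiplying by `X ^ k`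
  -- avoids truncated subtraction and includes `B = 0`.
  degB₁ : X ^ k * st.B₁ ∈ degreeLT L (st.d₁ + 1)
  degA₂ : st.A₂ ∈ degreeLT L st.d₂
  degB₂ : X ^ k * st.B₂ ∈ degreeLT L (st.d₂ + 1)
  sum : st.d₁ + st.d₂ = J.card + k + 1

/-- The initial state for the interpolation with value zero at the points in `J`. -/
def init (a : ι → L) (k : ℕ) (J : Finset ι) : KState L :=
  -- When all `yᵢ` with `i ∈ J` vanish, the pairs `(nodal, 0)` and `(0, 1)` generate the solutions,
  -- so these conditions cost no steps.
  ⟨Lagrange.nodal J a, 0, 0, 1, J.card + 1, k⟩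

lemma inv_init (a y : ι → L) (k : ℕ) (J : Finset ι) (hy : ∀ i ∈ J, y i = 0) :
    Inv a y k J (init a k J) where
  interp₁ i hi := by simp [init, Lagrange.eval_nodal_at_node hi]
  interp₂ i hi := by simp [init, hy i hi]
  det := ⟨1, one_ne_zero, by simp [init]⟩
  degA₁ := by
    rw [mem_degreeLT, init, Lagrange.degree_nodal]
    exact_mod_cast Nat.lt_succ_self _
  degB₁ := by simp [init]
  degA₂ := by simp [init]
  degB₂ := by
    rw [mem_degreeLT, init, mul_one, degree_X_pow]
    exact_mod_cast Nat.lt_succ_self _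
  sum := by simp [init]; omega

lemma X_sub_C_mul_mem_degreeLT {f : L[X]} {n : ℕ} (a : L) (h : f ∈ degreeLT L n) :
    (X - C a) * f ∈ degreeLT L (n + 1) := by
  rcases eq_or_ne f 0 with rfl | hf
  · simp
  rw [mem_degreeLT] at h ⊢
  rw [degree_mul, degree_X_sub_C, degree_eq_natDegree hf] at *
  norm_cast at *
  omega

lemma comb_mem_degreeLT {f g : L[X]} {m n : ℕ} (u v : L) (hmn : m ≤ n) (hf : f ∈ degreeLT L n)
    (hg : g ∈ degreeLT L m) : C u * f - C v * g ∈ degreeLT L n := by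
  rw [← smul_eq_C_mul, ← smul_eq_C_mul]
  exact Submodule.sub_mem _ (Submodule.smul_mem _ _ hf)
    (Submodule.smul_mem _ _ (degreeLT_mono hmn hg))

/-- Both discrepancies cannot vanish: the determinant would then vanish at `a i`, whereas the nodal
polynomial of `J` does not. A step multiplies the determinant by `X - a i` and the pivot's
discrepancy, and raises the sum of the degree bounds by one. -/
lemma Inv.step {a y : ι → L} (ha : Function.Injective a) {k : ℕ} {J : Finset ι} {st : KState L}
    (h : Inv a y k J st) {i : ι} (hi : i ∉ J) [DecidableEq ι] :
    Inv a y k (insert i J) (st.step (a i) (y i)) := by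
  obtain ⟨c, hc, hdet⟩ := h.det
  set e₁ := st.disc₁ (a i) (y i) with he₁
  set e₂ := st.disc₂ (a i) (y i) with he₂
  have hne : e₁ ≠ 0 ∨ e₂ ≠ 0 := by
    by_contra! h0
    have h1 := congrArg (eval (a i)) hdet
    have h2 : eval (a i) st.A₁ = y i * eval (a i) st.B₁ := sub_eq_zero.mp h0.1
    have h3 : eval (a i) st.A₂ = y i * eval (a i) st.B₂ := sub_eq_zero.mp h0.2
    simp only [eval_sub, eval_mul, eval_C, h2, h3] at h1
    have h4 : c * eval (a i) (Lagrange.nodal J a) = 0 := by rw [← h1]; ring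
    refine (mul_ne_zero hc (Lagrange.eval_nodal_not_at_node fun j hj hij => hi ?_)) h4
    rwa [ha hij]
  unfold KState.step
  rw [← he₁, ← he₂]
  split_ifs with hp
  · constructor
    · intro j hj
      rcases Finset.mem_insert.mp hj with rfl | hj
      · simp
      · simp only [eval_mul, h.interp₁ j hj]; ring
    · intro j hj
      rcases Finset.mem_insert.mp hj with rfl | hj
      · simp only [eval_sub, eval_mul, eval_C, he₁, he₂, disc₁, disc₂]; ring
      · simp only [eval_sub, eval_mul, eval_C, h.interp₁ j hj, h.interp₂ j hj]; ring
    · refine ⟨e₁ * c, mul_ne_zero hp.1 hc, ?_⟩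
      rw [Lagrange.nodal_insert_eq_nodal hi, C_mul]
      linear_combination (X - C (a i)) * C e₁ * hdet
    · exact X_sub_C_mul_mem_degreeLT _ h.degA₁
    · rw [mul_left_comm]
      exact X_sub_C_mul_mem_degreeLT _ h.degB₁
    · rcases hp.2 with h2 | h2
      · simpa [h2, ← smul_eq_C_mul] using Submodule.smul_mem _ e₁ h.degA₂
      · exact comb_mem_degreeLT _ _ h2 h.degA₂ h.degA₁
    · rw [mul_sub, mul_left_comm, mul_left_comm _ (C e₂)]
      rcases hp.2 with h2 | h2
      · simpa [h2, ← smul_eq_C_mul] using Submodule.smul_mem _ e₁ h.degB₂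
      · exact comb_mem_degreeLT _ _ (Nat.succ_le_succ h2) h.degB₂ h.degB₁
    · rw [Finset.card_insert_of_notMem hi]
      have := h.sum
      simp only
      omega
  -- The same argument with the two solutions exchanged.
  · have hp' : e₂ ≠ 0 ∧ (e₁ = 0 ∨ st.d₂ ≤ st.d₁) := by
      by_cases h1 : e₁ = 0
      · exact ⟨hne.resolve_left (by simpa using h1), .inl h1⟩
      · push Not at hp
        obtain ⟨h2, h3⟩ := hp h1
        exact ⟨h2, .inr h3.le⟩
    constructor
    · intro j hj
      rcases Finset.mem_insert.mp hj with rfl | hj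
      · simp only [eval_sub, eval_mul, eval_C, he₁, he₂, disc₁, disc₂]; ring
      · simp only [eval_sub, eval_mul, eval_C, h.interp₁ j hj, h.interp₂ j hj]; ring
    · intro j hj
      rcases Finset.mem_insert.mp hj with rfl | hj
      · simp
      · simp only [eval_mul, h.interp₂ j hj]; ring
    · refine ⟨e₂ * c, mul_ne_zero hp'.1 hc, ?_⟩
      rw [Lagrange.nodal_insert_eq_nodal hi, C_mul]
      linear_combination (X - C (a i)) * C e₂ * hdet
    · rcases hp'.2 with h2 | h2
      · simpa [h2, ← smul_eq_C_mul] using Submodule.smul_mem _ e₂ h.degA₁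
      · exact comb_mem_degreeLT _ _ h2 h.degA₁ h.degA₂
    · rw [mul_sub, mul_left_comm, mul_left_comm _ (C e₁)]
      rcases hp'.2 with h2 | h2
      · simpa [h2, ← smul_eq_C_mul] using Submodule.smul_mem _ e₂ h.degB₁
      · exact comb_mem_degreeLT _ _ (Nat.succ_le_succ h2) h.degB₁ h.degB₂
    · exact X_sub_C_mul_mem_degreeLT _ h.degA₂
    · rw [mul_left_comm]
      exact X_sub_C_mul_mem_degreeLT _ h.degB₂
    · rw [Finset.card_insert_of_notMem hi]
      have := h.sum
      simp only
      omega

open Classical in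
lemma Inv.interp {a y : ι → L} (ha : Function.Injective a) {k : ℕ} {er : ι → Prop} [DecidablePred er]
    {l : List ι}
    (hl : l.Nodup) {J : Finset ι} {st : KState L} (h : Inv a y k J st) (hJ : ∀ i ∈ l, i ∉ J) :
    Inv a y k (J ∪ l.toFinset.filter fun i => ¬ er i) (st.interp a y er l) := by
  induction l generalizing J st with
  | nil => simpa [KState.interp] using h
  | cons i l ih =>
    rw [List.nodup_cons] at hl
    rw [KState.interp]
    by_cases hi : er i
    · rw [if_pos hi]
      convert ih hl.2 h fun j hj => hJ j (by simp [hj]) using 2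
      ext j
      simp only [List.toFinset_cons, Finset.mem_filter, Finset.mem_insert]
      constructor
      · rintro ⟨rfl | hj, hj'⟩
        · exact absurd hi hj'
        · exact ⟨hj, hj'⟩
      · exact fun hj => ⟨.inr hj.1, hj.2⟩
    · rw [if_neg hi]
      convert ih hl.2 (h.step ha (hJ i (by simp))) fun j hj => ?_ using 1
      · ext j
        simp only [List.toFinset_cons, Finset.mem_filter, Finset.mem_insert, Finset.mem_union]
        constructor
        · rintro (hj | ⟨rfl | hj, hj'⟩)
          · exact .inl (.inr hj)
          · exact .inl (.inl rfl)
          · exact .inr ⟨hj, hj'⟩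
        · rintro ((rfl | hj) | hj)
          · exact .inr ⟨.inl rfl, hi⟩
          · exact .inl hj
          · exact .inr ⟨.inr hj.1, hj.2⟩
      · simp only [Finset.mem_insert, not_or]
        exact ⟨fun hij => hl.1 (hij ▸ hj), hJ j (by simp [hj])⟩

/-- Two solutions of small degree are proportional. -/
lemma cross_eq_zero {a y : ι → L} (ha : Function.Injective a) {k : ℕ} {J : Finset ι}
    {A B A' B' : L[X]} {d d' : ℕ} (h : ∀ i ∈ J, A.eval (a i) = y i * B.eval (a i))
    (h' : ∀ i ∈ J, A'.eval (a i) = y i * B'.eval (a i))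
    (hA : A ∈ degreeLT L d) (hB : X ^ k * B ∈ degreeLT L (d + 1))
    (hA' : A' ∈ degreeLT L d') (hB' : X ^ k * B' ∈ degreeLT L (d' + 1))
    (hd : d + d' ≤ J.card + k) : A * B' = A' * B := by
  have hmul : ∀ {f g : L[X]} {m n : ℕ}, f ∈ degreeLT L m → g ∈ degreeLT L (n + 1) →
      f * g ∈ degreeLT L (m + n) := by
    intro f g m n hf hg
    rcases eq_or_ne f 0 with rfl | hf0
    · simp
    rcases eq_or_ne g 0 with rfl | hg0
    · simp
    rw [mem_degreeLT, degree_eq_natDegree ‹_›] at hf hg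
    rw [mem_degreeLT, degree_mul, degree_eq_natDegree hf0, degree_eq_natDegree hg0]
    norm_cast at *
    omega
  -- The factor `X ^ k` makes the weighted bounds applicable. After it is cancelled, the cross
  -- difference has degree below `J.card` and vanishes at all points of `J`.
  have h1 : X ^ k * (A * B' - A' * B) ∈ degreeLT L (d + d') := by
    have e : X ^ k * (A * B' - A' * B) = A * (X ^ k * B') - A' * (X ^ k * B) := by ring
    rw [e]
    exact Submodule.sub_mem _ (hmul hA hB') (add_comm d' d ▸ hmul hA' hB)
  refine sub_eq_zero.mp ?_
  by_contra h0
  refine h0 (Polynomial.eq_zero_of_degree_lt_of_eval_index_eq_zero (s := J) (v := a) ha.injOn ?_ ?_)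
  · rw [mem_degreeLT, degree_mul, degree_X_pow, degree_eq_natDegree h0] at h1
    rw [degree_eq_natDegree h0]
    norm_cast at *
    omega
  · intro i hi
    rw [eval_sub, eval_mul, eval_mul, h i hi, h' i hi]
    ring

/-- If few of the interpolation conditions differ from those of a polynomial `f` of small degree,
then the quotient of the minimal solution is `f`, and its denominator is squarefree. -/
lemma Inv.num_eq {a y : ι → L} (ha : Function.Injective a) {k : ℕ} {J : Finset ι} {st : KState L}
    (h : Inv a y k J st) {f : L[X]} (hf : f ∈ degreeLT L k) [DecidableEq L]
    (hJ : 2 * (J.filter fun i => y i ≠ f.eval (a i)).card + k ≤ J.card) :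
    st.num = f * st.den ∧
      ∀ i, st.den.eval (a i) = 0 → (derivative st.den).eval (a i) ≠ 0 := by
  classical
  set I := J.filter fun i => y i ≠ f.eval (a i) with hI
  set Λ := Lagrange.nodal I a with hΛ
  have hΛ0 : Λ ≠ 0 := Lagrange.nodal_ne_zero
  obtain ⟨c, hc, hdet⟩ := h.det
  have hdet0 : st.A₁ * st.B₂ - st.A₂ * st.B₁ ≠ 0 := by
    rw [hdet]
    exact mul_ne_zero (C_ne_zero.mpr hc) Lagrange.nodal_ne_zero
  -- With the error locator `Λ`, the pair `(fΛ, Λ)` is itself a solution, of weighted bound `I.card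
  -- + k`.
  have hsol : ∀ i ∈ J, (f * Λ).eval (a i) = y i * Λ.eval (a i) := by
    intro i hi
    rw [eval_mul]
    by_cases hy : y i = f.eval (a i)
    · rw [hy]
    · rw [Lagrange.eval_nodal_at_node (Finset.mem_filter.mpr ⟨hi, hy⟩), mul_zero, mul_zero]
  have hΛA : f * Λ ∈ degreeLT L (I.card + k) := by
    rcases eq_or_ne f 0 with rfl | hf0
    · simp
    rw [mem_degreeLT, degree_eq_natDegree hf0] at hf
    rw [mem_degreeLT, degree_mul, hΛ, Lagrange.degree_nodal, degree_eq_natDegree hf0]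
    norm_cast at *
    omega
  have hΛB : X ^ k * Λ ∈ degreeLT L (I.card + k + 1) := by
    rw [mem_degreeLT, degree_mul, hΛ, Lagrange.degree_nodal, degree_X_pow]
    norm_cast
    omega
  have hsum := h.sum
  obtain ⟨d, hd₁, hd₂, hA, hB, hs⟩ : ∃ d, d ≤ st.d₁ ∧ d ≤ st.d₂ ∧ st.num ∈ degreeLT L d ∧
      X ^ k * st.den ∈ degreeLT L (d + 1) ∧
      ∀ i ∈ J, st.num.eval (a i) = y i * st.den.eval (a i) := by
    unfold num den
    split_ifs with hle
    · exact ⟨st.d₁, le_rfl, hle, h.degA₁, h.degB₁, h.interp₁⟩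
    · exact ⟨st.d₂, (not_le.mp hle).le, le_rfl, h.degA₂, h.degB₂, h.interp₂⟩
  -- The smaller bound satisfies `2d ≤ J.card + k + 1`. With `2 I.card + k ≤ J.card` this gives `d +
  -- I.card ≤ J.card`, as these are integers; hence the minimal solution is proportional to `(fΛ,
  -- Λ)`.
  have hnum : st.num = f * st.den := by
    have := cross_eq_zero ha hs hsol hA hB hΛA hΛB (by omega)
    exact mul_right_cancel₀ hΛ0 (by rw [this]; ring)
  refine ⟨hnum, ?_⟩
  have hden0 : st.den ≠ 0 := by
    intro h0
    rw [h0, mul_zero] at hnum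
    apply hdet0
    unfold num at hnum
    unfold den at h0
    split_ifs at h0 hnum <;> simp [h0, hnum]
  -- At an error position `f` and `y` differ, so `num = f * den` forces the denominator to vanish
  -- there.
  obtain ⟨g, hg⟩ : Λ ∣ st.den := by
    rw [hΛ, Lagrange.nodal]
    refine Finset.prod_dvd_of_coprime ?_ fun i hi => ?_
    · exact fun i _ j _ hij => pairwise_coprime_X_sub_C ha hij
    · rw [dvd_iff_isRoot, IsRoot]
      have h1 := hs i (Finset.mem_filter.mp hi).1
      rw [hnum, eval_mul] at h1
      have h2 : (f.eval (a i) - y i) * st.den.eval (a i) = 0 := by rw [sub_mul, h1, sub_self]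
      exact (mul_eq_zero.mp h2).resolve_left
        (sub_ne_zero.mpr (Ne.symm (Finset.mem_filter.mp hi).2))
  have hg0 : g ≠ 0 := by
    rintro rfl
    exact hden0 (by rw [hg, mul_zero])
  -- A nonconstant cofactor would give `I.card + k < d`. Then `(fΛ, Λ)` would be proportional to
  -- both basis solutions, and their determinant would be zero.
  have hgdeg : g.natDegree = 0 := by
    by_contra hgd
    have hdeg : I.card + k + g.natDegree ≤ d := by
      rw [mem_degreeLT, hg, degree_mul, degree_mul, degree_X_pow, hΛ, Lagrange.degree_nodal,
        degree_eq_natDegree hg0] at hB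
      norm_cast at hB
      omega
    have e₁ := cross_eq_zero ha hsol h.interp₁ hΛA hΛB h.degA₁ h.degB₁ (by omega)
    have e₂ := cross_eq_zero ha hsol h.interp₂ hΛA hΛB h.degA₂ h.degB₂ (by omega)
    have e₁' : st.A₁ = f * st.B₁ := mul_right_cancel₀ hΛ0 (by rw [← e₁]; ring)
    have e₂' : st.A₂ = f * st.B₂ := mul_right_cancel₀ hΛ0 (by rw [← e₂]; ring)
    exact hdet0 (by rw [e₁', e₂']; ring)
  obtain ⟨u, rfl⟩ : ∃ u, g = C u := ⟨g.coeff 0, eq_C_of_natDegree_eq_zero hgdeg⟩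
  have hu : u ≠ 0 := by simpa using hg0
  intro i hi
  rw [hg, eval_mul, eval_C, mul_eq_zero, or_iff_left hu] at hi
  obtain ⟨j, hj, hij⟩ : ∃ j ∈ I, a i = a j := by
    by_contra! hall
    exact Lagrange.eval_nodal_not_at_node hall hi
  rw [hg, mul_comm, derivative_C_mul, eval_mul, eval_C, ha hij,
    Lagrange.eval_nodal_derivative_eval_node_eq hj]
  exact mul_ne_zero hu (Lagrange.eval_nodal_not_at_node fun l hl hl' =>
    (Finset.mem_erase.mp hl).1 (ha hl'.symm))

open Classical in
/-- The numerator of the quotient of the minimal solution at a point. -/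
def valNum (st : KState L) (a : L) : L :=
  if st.den.eval a = 0 then (derivative st.num).eval a else st.num.eval a

open Classical in
/-- The denominator of the quotient of the minimal solution at a point. -/
def valDen (st : KState L) (a : L) : L :=
  if st.den.eval a = 0 then (derivative st.den).eval a else st.den.eval a

/-- L'Hôpital's rule: where `den` vanishes, differentiating `num = f * den` leaves `num' = f *
den'`, and `den'` is nonzero because the root is simple. -/
lemma Inv.valNum_eq {a y : ι → L} (ha : Function.Injective a) {k : ℕ} {J : Finset ι}
    {st : KState L} (h : Inv a y k J st) {f : L[X]} (hf : f ∈ degreeLT L k) [DecidableEq L]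
    (hJ : 2 * (J.filter fun i => y i ≠ f.eval (a i)).card + k ≤ J.card) (i : ι) :
    st.valDen (a i) ≠ 0 ∧ st.valNum (a i) = f.eval (a i) * st.valDen (a i) := by
  obtain ⟨h1, h2⟩ := h.num_eq ha hf hJ
  unfold valDen valNum
  split_ifs with h0
  · refine ⟨h2 i h0, ?_⟩
    rw [h1, derivative_mul, eval_add, eval_mul, eval_mul, h0, mul_zero, zero_add]
  · exact ⟨h0, by rw [h1, eval_mul]⟩

end KState

end Koetter

/-! ### The cost of rational interpolation -/

section KoetterCost

open Polynomial

variable {F : Type u} [Field F] [DecidableEq F] {X' : Type v} {L : Type*} [Field L] [Algebra F L]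
  (pb : PowerBasis F L) {S : Set ((X' → F) ⊕ (X' → ℝ))} {c c₁ c₂ c₃ c₄ : ℕ}

/-- The value and the derivative of a polynomial at a point. -/
def polyFns (b : L) (P : X' → L[X]) : Set ((X' → F) ⊕ (X' → ℝ)) :=
  fieldFns pb (fun x => (P x).eval b) ∪ fieldFns pb (fun x => (derivative (P x)).eval b)

variable {pb} {P Q : X' → L[X]} {b : L}

/-- By the product rule, the new value and derivative at `b` depend only on the old ones, so
coefficients are never needed. -/
lemma Der.poly_X_sub_C_mul (a : L) (h : polyFns pb b P ⊆ S) :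
    Der S (16 * pb.dim ^ 2) (polyFns pb b fun x => (X - C a) * P x) := by
  have hd := pb.dim_pos
  have h₁ : Der S 0 (fieldFns pb fun x => (P x).eval b) :=
    Der.of_subset (Set.subset_union_left.trans h)
  have h₂ : Der S 0 (fieldFns pb fun x => (derivative (P x)).eval b) :=
    Der.of_subset (Set.subset_union_right.trans h)
  have hc : Der S pb.dim (fieldFns pb fun _ : X' => b - a) := Der.lconst _
  have e := (hc.lmul h₁).union (h₁.ladd (hc.lmul h₂))
  refine (e.mono_right (le_of_eq ?_)).mono_cost (by nlinarith)
  simp [polyFns]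

lemma Der.poly_comb {u w : X' → L} (hP : polyFns pb b P ⊆ S) (hQ : polyFns pb b Q ⊆ S)
    (hu : fieldFns pb u ⊆ S) (hw : fieldFns pb w ⊆ S) :
    Der S (26 * pb.dim ^ 2) (polyFns pb b fun x => C (u x) * P x - C (w x) * Q x) := by
  have hd := pb.dim_pos
  have hu' : Der S 0 (fieldFns pb u) := Der.of_subset hu
  have hw' : Der S 0 (fieldFns pb w) := Der.of_subset hw
  have e := ((hu'.lmul (Der.of_subset (c := 0) (Set.subset_union_left.trans hP))).lsub
    (hw'.lmul (Der.of_subset (c := 0) (Set.subset_union_left.trans hQ)))).union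
    ((hu'.lmul (Der.of_subset (c := 0) (Set.subset_union_right.trans hP))).lsub
    (hw'.lmul (Der.of_subset (c := 0) (Set.subset_union_right.trans hQ))))
  refine (e.mono_right (le_of_eq ?_)).mono_cost (by nlinarith)
  simp [polyFns]

lemma Der.poly_sel {k : X' → F} (hk : Sum.inl k ∈ S) (hP : Der S c₁ (polyFns pb b P))
    (hQ : Der S c₂ (polyFns pb b Q)) :
    Der S (c₁ + c₂ + 2 * pb.dim) (polyFns pb b fun x => if k x = 0 then P x else Q x) := by
  refine (hP.union hQ).bind (U := _) (c' := 2 * pb.dim) ?_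
  have hk' := Der.of_mem (S := S ∪ (polyFns pb b P ∪ polyFns pb b Q)) (.inl hk)
  have e := (hk'.lsel (pb := pb) (g := fun x => (P x).eval b) (h := fun x => (Q x).eval b)
    (Der.of_subset (c := 0) fun y hy => .inr (.inl (.inl hy)))
    (Der.of_subset (c := 0) fun y hy => .inr (.inr (.inl hy)))).union
    (hk'.lsel (pb := pb) (g := fun x => (derivative (P x)).eval b)
    (h := fun x => (derivative (Q x)).eval b)
    (Der.of_subset (c := 0) fun y hy => .inr (.inl (.inr hy)))
    (Der.of_subset (c := 0) fun y hy => .inr (.inr (.inr hy))))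
  refine (e.mono_right (le_of_eq ?_)).mono_cost (by omega)
  simp only [polyFns]
  congr 2 <;> ext x <;> split_ifs <;> rfl

/-- The values and derivatives of the four polynomials of a state at a point. -/
def stateFns (pb : PowerBasis F L) (b : L) (st : X' → KState L) :
    Set ((X' → F) ⊕ (X' → ℝ)) :=
  (polyFns pb b (fun x => (st x).A₁) ∪ polyFns pb b (fun x => (st x).B₁)) ∪
    (polyFns pb b (fun x => (st x).A₂) ∪ polyFns pb b (fun x => (st x).B₂))

/-- What a program keeps of a state: values and derivatives at all points, and degree bounds. -/
def tracked {n : ℕ} (pb : PowerBasis F L) (a : Fin n → L) (st : X' → KState L) :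
    Set ((X' → F) ⊕ (X' → ℝ)) :=
  (⋃ i, stateFns pb (a i) st) ∪
    {Sum.inr fun x => ((st x).d₁ : ℝ), Sum.inr fun x => ((st x).d₂ : ℝ)}

variable {n : ℕ} {a : Fin n → L} {st : X' → KState L}

lemma stateFns_subset_tracked (i : Fin n) : stateFns pb (a i) st ⊆ tracked pb a st :=
  (Set.subset_iUnion (fun i => stateFns pb (a i) st) i).trans Set.subset_union_left

-- Discrepancies are read off from the values tracked at `a i`, and the update acts at each of the
-- `n` points separately. All branches are computed, and selections keep the right one.
open Classical in
lemma Der.koetter_step (i : Fin n) {y : X' → L} {ε : X' → F} (hy : fieldFns pb y ⊆ S)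
    (hε : Sum.inl ε ∈ S) (hst : tracked pb a st ⊆ S) :
    Der S (250 * n * pb.dim ^ 2)
      (tracked pb a fun x => if ε x ≠ 0 then st x else (st x).step (a i) (y x)) := by
  have hd := pb.dim_pos
  have hn : 0 < n := i.pos
  have hsub := (stateFns_subset_tracked (pb := pb) (a := a) (st := st) i).trans hst
  set e₁ : X' → L := fun x => (st x).disc₁ (a i) (y x) with he₁
  set e₂ : X' → L := fun x => (st x).disc₂ (a i) (y x) with he₂
  have hy' : Der S 0 (fieldFns pb y) := Der.of_subset hy
  have D₁ : Der S (7 * pb.dim ^ 2) (fieldFns pb e₁) :=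
    ((Der.of_subset (c := 0) fun z hz => hsub (.inl (.inl (.inl hz)))).lsub
    (hy'.lmul (Der.of_subset (c := 0) fun z hz => hsub (.inl (.inr (.inl hz)))))).mono_cost
      (by nlinarith)
  have D₂ : Der S (7 * pb.dim ^ 2) (fieldFns pb e₂) :=
    ((Der.of_subset (c := 0) fun z hz => hsub (.inr (.inl (.inl hz)))).lsub
    (hy'.lmul (Der.of_subset (c := 0) fun z hz => hsub (.inr (.inr (.inl hz)))))).mono_cost
      (by nlinarith)
  have hd₁ : Sum.inr (fun x => ((st x).d₁ : ℝ)) ∈ S := hst (.inr (.inl rfl))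
  have hd₂ : Sum.inr (fun x => ((st x).d₂ : ℝ)) ∈ S := hst (.inr (.inr rfl))
  -- The flag of the pivot test: nonzero exactly when the first solution is the pivot.
  set p : X' → F := fun x => if (if e₁ x = 0 then (0 : F) else 1) = 0 then 0 else
    if (if e₂ x = 0 then (0 : F) else 1) = 0 then 1 else
      if ((st x).d₁ : ℝ) ≤ ((st x).d₂ : ℝ) then (1 : F) else 0 with hp
  have Dp : Der S (14 * pb.dim ^ 2 + 6 * pb.dim + 5) {Sum.inl p} :=
    (D₁.lzero.fsel (Der.fconst 0) (D₂.lzero.fsel (Der.fconst 1)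
      ((Der.of_mem hd₁).rle (Der.of_mem hd₂)))).mono_cost (by omega)
  have hpx : ∀ x, p x = 0 ↔ ¬ ((st x).disc₁ (a i) (y x) ≠ 0 ∧
      ((st x).disc₂ (a i) (y x) = 0 ∨ (st x).d₁ ≤ (st x).d₂)) := by
    intro x
    simp only [hp, he₁, he₂, Nat.cast_le]
    split_ifs <;> simp_all
  refine ((((D₁.union D₂).union Dp).bind (U := _)
    (c' := n * (184 * pb.dim ^ 2) + 12) ?_)).mono_cost (by nlinarith)
  set W := S ∪ (fieldFns pb e₁ ∪ fieldFns pb e₂ ∪ {Sum.inl p}) with hW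
  have hSW : S ⊆ W := Set.subset_union_left
  have hpW : Sum.inl p ∈ W := .inr (.inr rfl)
  have he₁W : fieldFns pb e₁ ⊆ W := fun z hz => .inr (.inl (.inl hz))
  have he₂W : fieldFns pb e₂ ⊆ W := fun z hz => .inr (.inl (.inr hz))
  have hεW : Sum.inl ε ∈ W := hSW hε
  refine Der.mono_cost (c := n * (184 * pb.dim ^ 2) + (6 + 6)) ?_ (by omega)
  refine Der.union ?_ ?_
  · have hpt : ∀ j, Der W (184 * pb.dim ^ 2) (stateFns pb (a j)
        fun x => if ε x ≠ 0 then st x else (st x).step (a i) (y x)) := by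
      intro j
      have hj := ((stateFns_subset_tracked (pb := pb) (a := a) (st := st) j).trans hst).trans hSW
      have hA₁ : polyFns pb (a j) (fun x => (st x).A₁) ⊆ W := fun z hz => hj (.inl (.inl hz))
      have hB₁ : polyFns pb (a j) (fun x => (st x).B₁) ⊆ W := fun z hz => hj (.inl (.inr hz))
      have hA₂ : polyFns pb (a j) (fun x => (st x).A₂) ⊆ W := fun z hz => hj (.inr (.inl hz))
      have hB₂ : polyFns pb (a j) (fun x => (st x).B₂) ⊆ W := fun z hz => hj (.inr (.inr hz))
      -- Unchanged if erased, otherwise combined or multiplied by `X - a i`. For the first solution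
      -- the multiplication belongs to `p ≠ 0`; for the second one, `D'` exchanges the branches.
      have D : ∀ {P Q R T : X' → L[X]}, polyFns pb (a j) P ⊆ W →
          Der W (26 * pb.dim ^ 2) (polyFns pb (a j) Q) →
          Der W (16 * pb.dim ^ 2) (polyFns pb (a j) R) →
          (∀ x, T x = if ε x = 0 then (if p x = 0 then Q x else R x) else P x) →
          Der W (45 * pb.dim ^ 2 + pb.dim) (polyFns pb (a j) T) := by
        intro P Q R T hP hQ hR hT
        obtain rfl : T = fun x => if ε x = 0 then (if p x = 0 then Q x else R x) else P x :=
          funext hT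
        exact (Der.poly_sel hεW (Der.poly_sel hpW hQ hR) (Der.of_subset (c := 0) hP)).mono_cost
          (by nlinarith)
      have D' : ∀ {P Q R T : X' → L[X]}, polyFns pb (a j) P ⊆ W →
          Der W (26 * pb.dim ^ 2) (polyFns pb (a j) Q) →
          Der W (16 * pb.dim ^ 2) (polyFns pb (a j) R) →
          (∀ x, T x = if ε x = 0 then (if p x = 0 then R x else Q x) else P x) →
          Der W (45 * pb.dim ^ 2 + pb.dim) (polyFns pb (a j) T) := by
        intro P Q R T hP hQ hR hT
        obtain rfl : T = fun x => if ε x = 0 then (if p x = 0 then R x else Q x) else P x :=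
          funext hT
        exact (Der.poly_sel hεW (Der.poly_sel hpW hR hQ) (Der.of_subset (c := 0) hP)).mono_cost
          (by nlinarith)
      refine Der.mono_cost (c := 45 * pb.dim ^ 2 + pb.dim + (45 * pb.dim ^ 2 + pb.dim) +
        (45 * pb.dim ^ 2 + pb.dim + (45 * pb.dim ^ 2 + pb.dim))) ?_ (by nlinarith)
      refine ((D hA₁ (Der.poly_comb hA₁ hA₂ he₂W he₁W) (Der.poly_X_sub_C_mul (a i) hA₁) ?_).union
        (D hB₁ (Der.poly_comb hB₁ hB₂ he₂W he₁W) (Der.poly_X_sub_C_mul (a i) hB₁) ?_)).union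
        ((D' hA₂ (Der.poly_comb hA₂ hA₁ he₁W he₂W) (Der.poly_X_sub_C_mul (a i) hA₂) ?_).union
        (D' hB₂ (Der.poly_comb hB₂ hB₁ he₁W he₂W) (Der.poly_X_sub_C_mul (a i) hB₂) ?_))
      all_goals
        intro x
        simp only [ne_eq, ite_not]
        by_cases hx : ε x = 0
        · rw [if_pos hx, if_pos hx, KState.step]
          simp only [hpx x]
          split_ifs <;> rfl
        · rw [if_neg hx, if_neg hx]
    have := Der.iUnion hpt
    rwa [Fintype.card_fin] at this
  · have D₁ := (Der.of_mem hεW).rsel ((Der.of_mem hpW).rsel (Der.of_mem (hSW hd₁))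
      ((Der.of_mem (hSW hd₁)).radd Der.rone)) (Der.of_mem (hSW hd₁))
    have D₂ := (Der.of_mem hεW).rsel ((Der.of_mem hpW).rsel
      ((Der.of_mem (hSW hd₂)).radd Der.rone) (Der.of_mem (hSW hd₂))) (Der.of_mem (hSW hd₂))
    refine ((D₁.union D₂).mono_cost (c' := 6 + 6) (by omega)).mono_right ?_
    rw [Set.singleton_union]
    refine le_of_eq ?_
    congr 3
    all_goals
      ext x
      simp only [ne_eq, ite_not]
      by_cases hx : ε x = 0
      · rw [if_pos hx, if_pos hx, KState.step]
        simp only [hpx x]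
        split_ifs <;> simp
      · rw [if_neg hx, if_neg hx]

lemma Der.koetter_interp {y : X' → Fin n → L} {ε : X' → Fin n → F} (l : List (Fin n))
    (hy : ∀ i ∈ l, fieldFns pb (fun x => y x i) ⊆ S) (hε : ∀ i ∈ l, Sum.inl (fun x => ε x i) ∈ S)
    (st : X' → KState L) :
    Der (S ∪ tracked pb a st) (l.length * (250 * n * pb.dim ^ 2))
      (tracked pb a fun x => (st x).interp a (y x) (fun i => ε x i ≠ 0) l) := by
  induction l generalizing st with
  | nil => exact Der.of_subset Set.subset_union_right
  | cons i l ih =>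
    simp only [KState.interp]
    refine ((Der.koetter_step i (y := fun x => y x i) (ε := fun x => ε x i)
      (fun z hz => .inl (hy i (by simp) hz)) (.inl (hε i (by simp)))
      Set.subset_union_right).bind (U := _) (c' := l.length * (250 * n * pb.dim ^ 2)) ?_).mono_cost
      (by rw [List.length_cons, add_mul, one_mul, add_comm])
    exact (ih (fun j hj => hy j (by simp [hj])) (fun j hj => hε j (by simp [hj])) _).mono_left
      fun z hz => hz.elim (fun h => .inl (.inl h)) fun h => .inr h

/-- The initial state does not depend on the input, so its values are loaded as constants. -/
lemma Der.tracked_init (k : ℕ) (hk : k ≤ n) (J : Finset (Fin n)) (hn : 0 < n) :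
    Der S (25 * n * pb.dim ^ 2) (tracked pb a fun _ : X' => KState.init a k J) := by
  have hd := pb.dim_pos
  have hJ : J.card ≤ n := by simpa using J.card_le_univ
  have e : ∀ (b : L) (P : L[X]), Der S (2 * pb.dim) (polyFns pb b fun _ : X' => P) :=
    fun b P => ((Der.lconst _).union (Der.lconst _)).mono_cost (by omega)
  have e' : ∀ i, Der S (8 * pb.dim) (stateFns pb (a i) fun _ : X' => KState.init a k J) :=
    fun i => (((e _ _).union (e _ _)).union ((e _ _).union (e _ _))).mono_cost (by omega)
  refine ((Der.iUnion e').union ((Der.rnat (J.card + 1)).union (Der.rnat k))).mono_cost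
    (c' := 25 * n * pb.dim ^ 2) ?_ |>.mono_right ?_
  · rw [Fintype.card_fin]
    have : n * pb.dim ≤ n * pb.dim ^ 2 := Nat.mul_le_mul_left _ (Nat.le_self_pow two_ne_zero _)
    have : n ≤ n * pb.dim ^ 2 := Nat.le_mul_of_pos_right _ (by positivity)
    nlinarith
  · rw [Set.singleton_union]
    rfl

open Classical in
lemma Der.koetter_value (hst : tracked pb a st ⊆ S) (i : Fin n) :
    Der S (20 * pb.dim ^ 2) (fieldFns pb (fun x => (st x).valNum (a i)) ∪
      fieldFns pb (fun x => (st x).valDen (a i))) := by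
  have hd := pb.dim_pos
  have hi := (stateFns_subset_tracked (pb := pb) (a := a) (st := st) i).trans hst
  have hd₁ : Sum.inr (fun x => ((st x).d₁ : ℝ)) ∈ S := hst (.inr (.inl rfl))
  have hd₂ : Sum.inr (fun x => ((st x).d₂ : ℝ)) ∈ S := hst (.inr (.inr rfl))
  refine (((Der.of_mem hd₁).rle (Der.of_mem hd₂)).bind (U := _) (c' := 19 * pb.dim ^ 2)
    ?_).mono_cost (by nlinarith)
  set k : X' → F := fun x => if ((st x).d₁ : ℝ) ≤ ((st x).d₂ : ℝ) then (1 : F) else 0 with hk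
  have hkS : Sum.inl k ∈ S ∪ {Sum.inl k} := .inr rfl
  have eA : Der (S ∪ {Sum.inl k}) (2 * pb.dim) (polyFns pb (a i) fun x => (st x).num) := by
    have := Der.poly_sel (pb := pb) (b := a i) (P := fun x => (st x).A₂)
      (Q := fun x => (st x).A₁) hkS
      (Der.of_subset (c := 0) fun z hz => .inl (hi (.inr (.inl hz))))
      (Der.of_subset (c := 0) fun z hz => .inl (hi (.inl (.inl hz))))
    convert this.mono_cost (c' := 2 * pb.dim) (by omega) using 3 with x
    simp only [hk, KState.num, Nat.cast_le]
    split_ifs <;> simp_all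
  have eB : Der (S ∪ {Sum.inl k}) (2 * pb.dim) (polyFns pb (a i) fun x => (st x).den) := by
    have := Der.poly_sel (pb := pb) (b := a i) (P := fun x => (st x).B₂)
      (Q := fun x => (st x).B₁) hkS
      (Der.of_subset (c := 0) fun z hz => .inl (hi (.inr (.inr hz))))
      (Der.of_subset (c := 0) fun z hz => .inl (hi (.inl (.inr hz))))
    convert this.mono_cost (c' := 2 * pb.dim) (by omega) using 3 with x
    simp only [hk, KState.den, Nat.cast_le]
    split_ifs <;> simp_all
  refine ((eA.union eB).bind (U := _) (c' := 8 * pb.dim) ?_).mono_cost (by nlinarith)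
  set W := S ∪ {Sum.inl k} ∪ (polyFns pb (a i) (fun x => (st x).num) ∪
    polyFns pb (a i) (fun x => (st x).den)) with hW
  have h₁ : Der W 0 (fieldFns pb fun x => (st x).num.eval (a i)) :=
    Der.of_subset fun z hz => .inr (.inl (.inl hz))
  have h₂ : Der W 0 (fieldFns pb fun x => (derivative (st x).num).eval (a i)) :=
    Der.of_subset fun z hz => .inr (.inl (.inr hz))
  have h₃ : Der W 0 (fieldFns pb fun x => (st x).den.eval (a i)) :=
    Der.of_subset fun z hz => .inr (.inr (.inl hz))
  have h₄ : Der W 0 (fieldFns pb fun x => (derivative (st x).den).eval (a i)) :=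
    Der.of_subset fun z hz => .inr (.inr (.inr hz))
  refine (((h₃.lzero.lsel h₂ h₁).union (h₃.lzero.lsel h₄ h₃)).mono_cost
    (by omega)).mono_right (le_of_eq ?_)
  congr 2 <;> ext x <;> simp only [KState.valNum, KState.valDen] <;> split_ifs <;> simp_all

/-- The cost of rational interpolation, up to a final division. -/
lemma Der.rational_interpolation {y : X' → Fin n → L} {ε : X' → Fin n → F} (a : Fin n → L)
    (l : List (Fin n))
    (hy : ∀ i ∈ l, fieldFns pb (fun x => y x i) ⊆ S) (hε : ∀ i ∈ l, Sum.inl (fun x => ε x i) ∈ S)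
    (k : ℕ) (hk : k ≤ n) (J : Finset (Fin n)) (hn : 0 < n) :
    Der S ((l.length + 1) * (250 * n * pb.dim ^ 2)) (⋃ i,
      (fieldFns pb (fun x => ((KState.init a k J).interp a (y x) (fun i => ε x i ≠ 0) l).valNum
        (a i)) ∪
      fieldFns pb (fun x => ((KState.init a k J).interp a (y x) (fun i => ε x i ≠ 0) l).valDen
        (a i)))) := by
  have e := ((Der.tracked_init (S := S) (pb := pb) (a := a) k hk J hn).bind
    (Der.koetter_interp l hy hε _)).bind
    (Der.iUnion fun i => Der.koetter_value Set.subset_union_right i)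
  rw [Fintype.card_fin] at e
  exact e.mono_cost (by nlinarith)

end KoetterCost

/-! ### Generalized minimum distance decoding -/

section GMD

open Polynomial

/-- Some erasure threshold leaves few errors among the positions that are not erased. -/
lemma exists_threshold {N D k : ℕ} (e d : Fin N → ℕ) (bad : Finset (Fin N))
    (h₁ : ∀ i, d i ≤ e i) (h₂ : ∀ i ∈ bad, D ≤ e i + d i) (hk : k ≤ N)
    (h : 2 * ∑ i, e i < D * (N + 1 - k)) :
    ∃ θ ∈ Finset.Icc 1 D, 2 * (bad.filter fun i => ¬ θ ≤ 2 * d i).card + k ≤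
      (Finset.univ.filter fun i => ¬ θ ≤ 2 * d i).card := by
  classical
  by_contra! hcon
  -- If every threshold failed, errors counted twice plus erasures would number at least `N + 1 - k`
  -- each time. This is summed over `θ` and the order of summation is exchanged.
  have h3 : ∀ θ ∈ Finset.Icc 1 D, N + 1 - k ≤
      ∑ i, ((if i ∈ bad ∧ ¬ θ ≤ 2 * d i then 2 else 0) + if θ ≤ 2 * d i then 1 else 0) := by
    intro θ hθ
    have h4 := hcon θ hθ
    simp only [← not_le] at h4
    have h5 := Finset.card_filter_add_card_filter_not (s := (Finset.univ : Finset (Fin N)))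
      (fun i => θ ≤ 2 * d i)
    rw [Finset.card_univ, Fintype.card_fin] at h5
    have h6 : ∑ i : Fin N, (if i ∈ bad ∧ ¬ θ ≤ 2 * d i then 2 else 0) =
        2 * (bad.filter fun i => ¬ θ ≤ 2 * d i).card := by
      rw [← Finset.sum_filter, Finset.sum_const, smul_eq_mul, mul_comm]
      congr 2
      ext i
      simp
    rw [Finset.sum_add_distrib, h6, ← Finset.card_filter]
    omega
  have h7 := Finset.sum_le_sum h3
  rw [Finset.sum_const, Nat.card_Icc, Nat.add_sub_cancel, smul_eq_mul, Finset.sum_comm] at h7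
  -- Position `i` contributes `min D (2 dᵢ)` if good and `2D - min D (2 dᵢ)` if bad. Both are at
  -- most `2 eᵢ`, the latter because `D ≤ eᵢ + dᵢ` and `dᵢ ≤ eᵢ`.
  refine (h7.trans (Finset.sum_le_sum (g := fun i => 2 * e i) fun i _ => ?_)).not_gt
    (by rwa [← Finset.mul_sum])
  have h8 : ((Finset.Icc 1 D).filter fun θ => θ ≤ 2 * d i).card = min D (2 * d i) := by
    have : (Finset.Icc 1 D).filter (fun θ => θ ≤ 2 * d i) = Finset.Icc 1 (min D (2 * d i)) := by
      ext θ
      simp only [Finset.mem_filter, Finset.mem_Icc, le_min_iff]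
      tauto
    rw [this, Nat.card_Icc, Nat.add_sub_cancel]
  have h9 := Finset.card_filter_add_card_filter_not (s := Finset.Icc 1 D)
    (fun θ => θ ≤ 2 * d i)
  rw [Nat.card_Icc, Nat.add_sub_cancel, h8] at h9
  rw [Finset.sum_add_distrib, ← Finset.card_filter, h8]
  have h10 := h₁ i
  by_cases hi : i ∈ bad
  · have h11 := h₂ i hi
    simp only [hi, true_and]
    rw [← Finset.sum_filter, Finset.sum_const, smul_eq_mul]
    omega
  · simp only [hi, false_and, if_false, Finset.sum_const_zero]
    omega

variable {F : Type u} [Field F] [DecidableEq F] {E : Type*} [Field E] [Algebra F E] {N t : ℕ}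

/-- A block of a vector of length `N t`. -/
def block (y : Fin (N * t) → F) (i : Fin N) : Fin t → F := fun j => y (finProdFinEquiv (i, j))

lemma hammingDist_eq_sum_block (y z : Fin (N * t) → F) :
    hammingDist y z = ∑ i, hammingDist (block y i) (block z i) := by
  simp only [hammingDist, Finset.card_filter]
  rw [← finProdFinEquiv.sum_comp, Fintype.sum_prod_type]
  rfl

/-- The encoding of every symbol of a word over the extension field by the inner encoders. -/
def blockEncode (enc : Fin N → E →ₗ[F] (Fin t → F)) : (Fin N → E) →ₗ[F] (Fin (N * t) → F) where
  toFun o := fun l => enc (finProdFinEquiv.symm l).1 (o (finProdFinEquiv.symm l).1)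
    (finProdFinEquiv.symm l).2
  map_add' o o' := by ext; simp
  map_smul' r o := by ext; simp

lemma block_blockEncode (enc : Fin N → E →ₗ[F] (Fin t → F)) (o : Fin N → E) (i : Fin N) :
    block (blockEncode enc o) i = enc i (o i) := by
  ext j
  simp only [block, blockEncode, LinearMap.coe_mk, AddHom.coe_mk, Equiv.symm_apply_apply]

/-- The codeword of a concatenated code that belongs to a message polynomial. -/
def conEncode (enc : Fin N → E →ₗ[F] (Fin t → F)) (a : Fin N → E) (f : E[X]) :
    Fin (N * t) → F :=
  blockEncode enc fun i => f.eval (a i)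

/-- The minimum distance of a concatenated code. -/
lemma conEncode_dist {enc : Fin N → E →ₗ[F] (Fin t → F)} {a : Fin N → E}
    (ha : Function.Injective a) {D k : ℕ} (hk : k ≤ N)
    (hD : ∀ i z, z ≠ 0 → D ≤ hammingNorm (enc i z)) {f g : E[X]} (hf : f ∈ degreeLT E k)
    (hg : g ∈ degreeLT E k) (hfg : conEncode enc a f ≠ conEncode enc a g) :
    D * (N + 1 - k) ≤ hammingDist (conEncode enc a f) (conEncode enc a g) := by
  classical
  have h0 : f - g ≠ 0 := fun h => hfg (by rw [sub_eq_zero.mp h])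
  have hdeg : f - g ∈ degreeLT E k := Submodule.sub_mem _ hf hg
  -- A nonzero polynomial of degree below `k` has fewer than `k` zeros, so at least `N + 1 - k`
  -- blocks differ, each in at least `D` places.
  set Z := Finset.univ.filter fun i => (f - g).eval (a i) = 0 with hZ
  have hZk : Z.card < k := by
    by_contra! hle
    refine h0 (Polynomial.eq_zero_of_degree_lt_of_eval_index_eq_zero (s := Z) (v := a) ha.injOn
      ((mem_degreeLT.mp hdeg).trans_le (by exact_mod_cast hle)) fun i hi => ?_)
    exact (Finset.mem_filter.mp hi).2
  have hcard := Finset.card_filter_add_card_filter_not (s := (Finset.univ : Finset (Fin N)))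
    (fun i => (f - g).eval (a i) = 0)
  rw [Finset.card_univ, Fintype.card_fin, ← hZ] at hcard
  rw [hammingDist_eq_sum_block]
  calc D * (N + 1 - k) ≤ D * (Finset.univ.filter fun i => ¬ (f - g).eval (a i) = 0).card :=
        Nat.mul_le_mul_left _ (by omega)
    _ = ∑ i ∈ Finset.univ.filter fun i => ¬ (f - g).eval (a i) = 0, D := by
        rw [Finset.sum_const, smul_eq_mul, mul_comm]
    _ ≤ ∑ i ∈ Finset.univ.filter fun i => ¬ (f - g).eval (a i) = 0,
          hammingDist (block (conEncode enc a f) i) (block (conEncode enc a g) i) := by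
        refine Finset.sum_le_sum fun i hi => ?_
        rw [conEncode, conEncode, block_blockEncode, block_blockEncode, hammingDist_eq_hammingNorm,
          neg_add_eq_sub, ← map_sub]
        refine hD i _ fun h => (Finset.mem_filter.mp hi).2 ?_
        rw [eval_sub, ← neg_sub, h, neg_zero]
    _ ≤ _ := Finset.sum_le_sum_of_subset (Finset.filter_subset _ _)

/-- Nearest neighbour decoding of all inner blocks. -/
lemma Der.inner_decoding [Fintype E] (pb : PowerBasis F E) (enc : Fin N → E →ₗ[F] (Fin t → F))
    (ht : pb.dim ≤ t) :
    ∃ (d : Fin N → (Fin (N * t) → F) → ℕ) (z : Fin N → (Fin (N * t) → F) → E),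
      Der (coordFns fun y : Fin (N * t) → F => y) (N * (15 * t * Fintype.card E))
        (⋃ i, ({Sum.inr fun y => (d i y : ℝ)} ∪ fieldFns pb (z i))) ∧
      ∀ i y, d i y = hammingDist (block y i) (enc i (z i y)) ∧
        ∀ w, d i y ≤ hammingDist (block y i) (enc i w) := by
  have hd := pb.dim_pos
  have key : ∀ i : Fin N, ∃ (d : (Fin (N * t) → F) → ℕ) (z : (Fin (N * t) → F) → E),
      Der (coordFns fun y : Fin (N * t) → F => y) (15 * t * Fintype.card E)
        ({Sum.inr fun y => (d y : ℝ)} ∪ fieldFns pb z) ∧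
      ∀ y, d y = hammingDist (block y i) (enc i (z y)) ∧
        ∀ w, d y ≤ hammingDist (block y i) (enc i w) := by
    intro i
    obtain ⟨l, hl⟩ : ∃ l, Fintype.card E = l + 1 :=
      ⟨_, (Nat.succ_pred_eq_of_pos Fintype.card_pos).symm⟩
    let φ : Fin (l + 1) ≃ E := (Fintype.equivFinOfCardEq hl).symm
    -- Exhaustive search over all symbols; the inner codewords are constants of the program.
    obtain ⟨d', v', h', hs⟩ := Der.argmin (S := coordFns fun y : Fin (N * t) → F => y)
      (fun w y => (hammingDist (block y i) (enc i (φ w)) : ℝ))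
      (fun w _ => pb.basis.equivFun (φ w)) (c := 8 * t + 3 + pb.dim) fun w => by
        have e₁ := Der.hamming_dist (S := coordFns fun y : Fin (N * t) → F => y)
          (v := fun y => block y i) (w := fun _ => enc i (φ w))
          (fun j => Der.of_mem (mem_coordFns _ _)) (fun j => Der.fconst _)
        refine ((e₁.union (Der.vec_const _)).mono_cost ?_)
        simp only [Fintype.card_fin]
        omega
    have hz : ∀ y, ∃ w, d' y = (hammingDist (block y i) (enc i w) : ℕ) ∧
        v' y = pb.basis.equivFun w := fun y => by
      obtain ⟨⟨w, h1, h2⟩, -⟩ := hs y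
      exact ⟨φ w, h1, h2⟩
    choose z hz₁ hz₂ using hz
    refine ⟨fun y => hammingDist (block y i) (enc i (z y)), z, ?_, fun y => ⟨rfl, fun w => ?_⟩⟩
    · rw [fieldFns, ← funext hz₂]
      simp only [← hz₁]
      refine h'.mono_cost ?_
      rw [hl, Fintype.card_fin, mul_comm]
      exact Nat.mul_le_mul_right _ (by omega)
    · have := (hs y).2 (φ.symm w)
      rw [hz₁, φ.apply_symm_apply] at this
      exact_mod_cast this
  choose d z hdz hs using key
  refine ⟨d, z, ?_, hs⟩
  have := Der.iUnion hdz
  rwa [Fintype.card_fin] at this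

/-- The codewords of a concatenated code. -/
def conCode (enc : Fin N → E →ₗ[F] (Fin t → F)) (a : Fin N → E) (k : ℕ) :
    Submodule F (Fin (N * t) → F) where
  carrier := {c | ∃ f ∈ degreeLT E k, c = conEncode enc a f}
  add_mem' := by
    rintro _ _ ⟨f, hf, rfl⟩ ⟨g, hg, rfl⟩
    refine ⟨f + g, Submodule.add_mem _ hf hg, ?_⟩
    simp only [conEncode, eval_add, ← map_add]
    rfl
  zero_mem' := ⟨0, Submodule.zero_mem _, by
    simp only [conEncode, eval_zero]
    exact (map_zero (blockEncode enc)).symm⟩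
  smul_mem' := by
    rintro r _ ⟨f, hf, rfl⟩
    refine ⟨C (algebraMap F E r) * f, ?_, ?_⟩
    · rw [← smul_eq_C_mul]
      exact Submodule.smul_mem _ _ hf
    · simp only [conEncode, eval_mul, eval_C, ← map_smul]
      congr 1
      ext i
      simp [Algebra.smul_def]

/-- Errors-and-erasures decoding of the outer code with a given erasure threshold. -/
lemma Der.threshold_decoding [Fintype E] [DecidableEq E] (pb : PowerBasis F E)
    (enc : Fin N → E →ₗ[F] (Fin t → F)) (ht : pb.dim ≤ t) {a : Fin N → E}
    (ha : Function.Injective a) {k : ℕ} (hk : k ≤ N) (hN : 0 < N)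
    {S : Set (((Fin (N * t) → F) → F) ⊕ ((Fin (N * t) → F) → ℝ))}
    {d : Fin N → (Fin (N * t) → F) → ℕ} {z : Fin N → (Fin (N * t) → F) → E}
    (hS : (coordFns fun y : Fin (N * t) → F => y) ⊆ S)
    (hd : ∀ i, Sum.inr (fun y => (d i y : ℝ)) ∈ S) (hz : ∀ i, fieldFns pb (z i) ⊆ S) (θ : ℕ)
    (hθ : θ ≤ t) :
    ∃ dec : (Fin (N * t) → F) → Fin (N * t) → F,
      Der S ((N + Fintype.card E) * (540 * N * t ^ 2))
        ({Sum.inr fun y => (hammingDist y (dec y) : ℝ)} ∪ coordFns dec) ∧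
      ∀ y, (∃ f ∈ degreeLT E k, dec y = conEncode enc a f) ∧ ∀ f ∈ degreeLT E k,
        2 * (Finset.univ.filter fun i => z i y ≠ f.eval (a i) ∧ ¬ θ ≤ 2 * d i y).card + k ≤
          (Finset.univ.filter fun i => ¬ θ ≤ 2 * d i y).card →
        dec y = conEncode enc a f := by
  have hdim := pb.dim_pos
  have hdim2 : pb.dim ≤ pb.dim ^ 2 := Nat.le_self_pow two_ne_zero _
  have hdimt : pb.dim ^ 2 ≤ t ^ 2 := Nat.pow_le_pow_left ht 2
  have htt : t ≤ t ^ 2 := Nat.le_self_pow two_ne_zero _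
  have hE : 0 < Fintype.card E := Fintype.card_pos
  have hE2 : 2 ≤ Fintype.card E := Fintype.one_lt_card
  -- A linear projection onto the code makes every output a codeword, even if interpolation fails.
  -- The comparison of the thresholds relies on this.
  obtain ⟨P, hP⟩ := (conCode enc a k).subtype.exists_leftInverse_of_injective
    (Submodule.ker_subtype _)
  let ε : (Fin (N * t) → F) → Fin N → F :=
    fun y i => if (θ : ℝ) ≤ (d i y : ℝ) + (d i y : ℝ) then 1 else 0
  let st : (Fin (N * t) → F) → KState E := fun y =>
    (KState.init a k ∅).interp a (fun i => z i y) (fun i => ε y i ≠ 0) (List.finRange N)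
  -- Division by Fermat's theorem: the power `card E - 2` inverts nonzero elements. The factor `card
  -- E` is affordable here, as it will equal `N`.
  let v : (Fin (N * t) → F) → Fin N → E := fun y i =>
    (st y).valNum (a i) * (st y).valDen (a i) ^ (Fintype.card E - 2)
  let M : (Fin N → E) →ₗ[F] (Fin (N * t) → F) :=
    (conCode enc a k).subtype ∘ₗ P ∘ₗ blockEncode enc
  let toE : (Fin N × Fin pb.dim → F) →ₗ[F] (Fin N → E) :=
    LinearMap.pi fun i => pb.basis.equivFun.symm.toLinearMap ∘ₗ
      LinearMap.pi fun l => LinearMap.proj (i, l)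
  have hMmem : ∀ o, ∃ f ∈ degreeLT E k, M o = conEncode enc a f := fun o =>
    (P (blockEncode enc o)).2
  have hMid : ∀ f ∈ degreeLT E k, M (fun i => f.eval (a i)) = conEncode enc a f := by
    intro f hf
    have := LinearMap.congr_fun hP ⟨conEncode enc a f, f, hf, rfl⟩
    exact congrArg Subtype.val this
  refine ⟨fun y => M (v y), ?_, fun y => ⟨hMmem _, fun f hf hcard => ?_⟩⟩
  · have h₁ : Der S (N * (2 * t + 5)) (coordFns ε) := by
      have := Der.vec (S := S) (v := ε) (c := 2 * t + 5) fun i =>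
        ((Der.rnat θ).rle ((Der.of_mem (hd i)).radd (Der.of_mem (hd i)))).mono_cost (by omega)
      rwa [Fintype.card_fin] at this
    have h₂ := Der.rational_interpolation (S := S ∪ coordFns ε) (pb := pb)
      (y := fun y i => z i y) (ε := ε) a (List.finRange N)
      (fun i _ x hx => .inl (hz i hx)) (fun i _ => .inr (mem_coordFns ε i)) k hk ∅ hN
    rw [List.length_finRange] at h₂
    have h₃ : ∀ W, (⋃ i, (fieldFns pb (fun y => (st y).valNum (a i)) ∪
        fieldFns pb (fun y => (st y).valDen (a i)))) ⊆ W →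
        Der W (N * (8 * Fintype.card E * pb.dim ^ 2))
          (coordFns fun y (p : Fin N × Fin pb.dim) => pb.basis.equivFun (v y p.1) p.2) := by
      intro W hW
      have := Der.iUnion (S := W) (T := fun i : Fin N => fieldFns pb fun y => v y i)
        (c := 8 * Fintype.card E * pb.dim ^ 2) fun i => by
          refine ((Der.of_subset (c := 0) fun x hx =>
            hW (Set.mem_iUnion.mpr ⟨i, .inl hx⟩)).lmul ((Der.of_subset (c := 0) fun x hx =>
            hW (Set.mem_iUnion.mpr ⟨i, .inr hx⟩)).lpow _)).mono_cost ?_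
          obtain ⟨l, hl⟩ := Nat.exists_eq_add_of_le hE2
          rw [hl, Nat.add_sub_cancel_left]
          nlinarith
      rw [Fintype.card_fin] at this
      refine this.mono_right ?_
      rintro _ ⟨⟨i, l⟩, rfl⟩
      exact Set.mem_iUnion.mpr ⟨i, l, rfl⟩
    have h₄ := (h₁.bind h₂).bind (h₃ _ Set.subset_union_right)
    have h₅ := h₄.bind (Der.linearMap (M ∘ₗ toE) Set.subset_union_right)
    have hMv : ∀ y, (M ∘ₗ toE) (fun p : Fin N × Fin pb.dim => pb.basis.equivFun (v y p.1) p.2) =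
        M (v y) := by
      intro y
      rw [LinearMap.comp_apply]
      congr 1
      ext i
      exact pb.basis.equivFun.symm_apply_apply (v y i)
    simp only [hMv] at h₅
    have h₆ := h₅.trans (Der.hamming_dist (v := fun y : Fin (N * t) → F => y)
      (w := fun y => M (v y)) (fun j => Der.of_mem (.inl (hS (mem_coordFns _ j))))
      (fun j => Der.of_mem (.inr (mem_coordFns _ j))))
    rw [Set.union_comm] at h₆
    refine h₆.mono_cost ?_
    simp only [Fintype.card_fin, Fintype.card_prod]
    have ht1 : 1 ≤ t ^ 2 := hdim.trans_le (ht.trans htt)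
    have b₁ : (N + 1) * (250 * N * pb.dim ^ 2) ≤ (N + 1) * (250 * N * t ^ 2) := by gcongr
    have b₂ : N * (8 * Fintype.card E * pb.dim ^ 2) ≤ N * (8 * Fintype.card E * t ^ 2) := by
      gcongr
    have b₃ : N * t * (3 * (N * pb.dim) + 1) ≤ N * t * (3 * (N * t) + 1) := by gcongr
    have b₄ : N * t ≤ N * t ^ 2 := by gcongr
    have b₅ : 1 * (N * t ^ 2) ≤ N * (N * t ^ 2) := Nat.mul_le_mul_right _ hN
    have b₆ : 1 * 1 ≤ N * t ^ 2 := Nat.mul_le_mul hN ht1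
    have b₇ : N * 1 ≤ N * t ^ 2 := Nat.mul_le_mul_left _ ht1
    have b₈ : 0 ≤ N * Fintype.card E * t ^ 2 := Nat.zero_le _
    linarith
  · have hε : ∀ i, ε y i ≠ 0 ↔ θ ≤ 2 * d i y := by
      intro i
      have : (θ : ℝ) ≤ (d i y : ℝ) + (d i y : ℝ) ↔ θ ≤ 2 * d i y := by
        rw [two_mul]
        exact_mod_cast Iff.rfl
      simp only [ε, this]
      split_ifs with h <;> simp [h]
    have hinv := (KState.inv_init a (fun i => z i y) k ∅ (by simp)).interp ha
      (er := fun i => ε y i ≠ 0) (List.nodup_finRange N) (by simp)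
    rw [← hMid f hf]
    refine congrArg M (funext fun i => ?_)
    obtain ⟨h₁, h₂⟩ := hinv.valNum_eq ha hf (by
      have hu : ∀ [DecidableEq (Fin N)], (List.finRange N).toFinset = Finset.univ := by
        intro _
        ext
        simp
      simp only [hε, Finset.empty_union, Finset.filter_filter, hu]
      simpa only [and_comm] using hcard) i
    simp only [v, st]
    rw [h₂, mul_assoc, ← pow_succ', show Fintype.card E - 2 + 1 = Fintype.card E - 1 by omega,
      FiniteField.pow_card_sub_one_eq_one _ h₁, mul_one]

/-- Generalized minimum distance decoding of a concatenated code. -/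
theorem exists_concatenated_decoder [Fintype E] (pb : PowerBasis F E)
    (enc : Fin N → E →ₗ[F] (Fin t → F)) (ht : pb.dim ≤ t) (hE : Fintype.card E = N)
    {a : Fin N → E} (ha : Function.Injective a) {D k : ℕ} (hk : k ≤ N) (hD₀ : 0 < D) (hDt : D ≤ t)
    (hD : ∀ i z, z ≠ 0 → D ≤ hammingNorm (enc i z)) :
    ∃ dec : (Fin (N * t) → F) → Fin (N * t) → F,
      Der (coordFns fun y : Fin (N * t) → F => y) (1100 * N ^ 2 * t ^ 3) (coordFns dec) ∧
      ∀ f ∈ degreeLT E k, ∀ y, 2 * hammingDist y (conEncode enc a f) < D * (N + 1 - k) →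
        dec y = conEncode enc a f := by
  classical
  have hN : 0 < N := hE ▸ Fintype.card_pos
  obtain ⟨d, z, hdz, hs⟩ := Der.inner_decoding pb enc ht
  obtain ⟨l, rfl⟩ : ∃ l, D = l + 1 := ⟨D - 1, by omega⟩
  set S := (coordFns fun y : Fin (N * t) → F => y) ∪
    ⋃ i, ({Sum.inr fun y => (d i y : ℝ)} ∪ fieldFns pb (z i)) with hS
  -- The thresholds are `1, …, D`, hence the shift by one.
  have hdec := fun θ : Fin (l + 1) => Der.threshold_decoding pb enc ht ha hk hN (S := S) (d := d)
    (z := z) Set.subset_union_left (fun i => .inr (Set.mem_iUnion.mpr ⟨i, .inl rfl⟩))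
    (fun i x hx => .inr (Set.mem_iUnion.mpr ⟨i, .inr hx⟩)) (θ + 1) (by omega)
  choose dec hdec hspec using hdec
  obtain ⟨D', v', h', hmin⟩ := Der.argmin _ _ hdec
  refine ⟨v', (hdz.bind (h'.mono_right Set.subset_union_right)).mono_cost ?_, fun f hf y hy => ?_⟩
  · simp only [Fintype.card_fin, hE]
    have b₁ : (l + 1) * ((N + N) * (540 * N * t ^ 2) + 2 + N * t) ≤
      t * ((N + N) * (540 * N * t ^ 2) + 2 + N * t) := by gcongr
    have ht0 : 1 ≤ t := by omega
    have b₂ : t * N ^ 2 ≤ t ^ 3 * N ^ 2 := by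
      gcongr
      exact Nat.le_self_pow (by norm_num) _
    have b₃ : t ^ 2 * N ≤ t ^ 3 * N ^ 2 :=
      Nat.mul_le_mul (Nat.pow_le_pow_right ht0 (by norm_num)) (Nat.le_self_pow two_ne_zero _)
    have b₄ : t * 1 ≤ t ^ 3 * N ^ 2 :=
      Nat.mul_le_mul (Nat.le_self_pow (by norm_num) _) (Nat.one_le_pow _ _ hN)
    linarith
  · obtain ⟨⟨j, hj₁, hj₂⟩, hle⟩ := hmin y
    have hsum : hammingDist y (conEncode enc a f) =
        ∑ i, hammingDist (block y i) (enc i (f.eval (a i))) := by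
      rw [hammingDist_eq_sum_block]
      simp only [conEncode, block_blockEncode]
    obtain ⟨θ, hθ, hcard⟩ := exists_threshold (D := l + 1) (k := k)
      (fun i => hammingDist (block y i) (enc i (f.eval (a i)))) (fun i => d i y)
      (Finset.univ.filter fun i => z i y ≠ f.eval (a i)) (fun i => (hs i y).2 _)
      -- A wrongly decoded block is far from one of two distinct inner codewords: the triangle
      -- inequality gives `D ≤ eᵢ + dᵢ`.
      (fun i hi => by
        have h1 := hD i (z i y - f.eval (a i)) (sub_ne_zero.mpr (Finset.mem_filter.mp hi).2)
        have h2 := hammingDist_triangle_left (enc i (f.eval (a i))) (enc i (z i y)) (block y i)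
        have h3 := hammingDist_eq_hammingNorm (enc i (f.eval (a i))) (enc i (z i y))
        rw [neg_add_eq_sub, ← map_sub] at h3
        rw [(hs i y).1]
        omega) hk (by rwa [← hsum])
    rw [Finset.mem_Icc] at hθ
    have hθ' := (hspec ⟨θ - 1, by omega⟩ y).2 f hf (by
      simp only [Nat.sub_add_cancel hθ.1]
      rwa [Finset.filter_filter] at hcard)
    obtain ⟨g, hg, hgj⟩ := (hspec j y).1
    have hclose : hammingDist y (conEncode enc a g) ≤ hammingDist y (conEncode enc a f) := by
      have := hle ⟨θ - 1, by omega⟩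
      rw [hj₁, hθ', hgj] at this
      exact_mod_cast this
    rw [hj₂, hgj]
    -- The chosen codeword is at least as close to `y` as the true one, and both lie within half the
    -- minimum distance.
    by_contra hne
    have h1 := conEncode_dist ha hk hD hg hf hne
    have h2 := hammingDist_triangle_left (conEncode enc a g) (conEncode enc a f) y
    omega

end GMD

/-! ### Syndrome decoding of Reed–Solomon codes -/

section Syndrome

open Polynomial

/-- A linear map that vanishes on the kernel of another one factors through it. -/
lemma exists_linearMap_comp_eq {k V W U : Type*} [Field k] [AddCommGroup V] [Module k V]
    [AddCommGroup W] [Module k W] [AddCommGroup U] [Module k U] (M : V →ₗ[k] W) (Ψ : V →ₗ[k] U)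
    (h : ∀ x, M x = 0 → Ψ x = 0) : ∃ Φ : W →ₗ[k] U, ∀ x, Φ (M x) = Ψ x := by
  obtain ⟨g, hg⟩ := M.rangeRestrict.exists_rightInverse_of_surjective M.range_rangeRestrict
  obtain ⟨Φ, hΦ⟩ := (Ψ ∘ₗ g).exists_extend
  refine ⟨Φ, fun x => ?_⟩
  have h1 : Φ (M x) = Ψ (g (M.rangeRestrict x)) := LinearMap.congr_fun hΦ (M.rangeRestrict x)
  have h2 : M (g (M.rangeRestrict x)) = M x :=
    congrArg Subtype.val (LinearMap.congr_fun hg (M.rangeRestrict x))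
  rw [h1, ← sub_eq_zero, ← map_sub]
  exact h _ (by rw [map_sub, h2, sub_self])

variable {F : Type u} [Field F] [DecidableEq F] {X' : Type v} {K : Type*} [Field K] [Algebra F K]

/-- Syndrome decoding of a Reed–Solomon code, for errors with entries in the base field: if `M` is
an `F`-linear map whose kernel consists of codewords, then a vector `u` with at most `b` nonzero
entries can be computed from `M u`. -/
theorem exists_syndrome_decoder (pb : PowerBasis F K) {n m b : ℕ} (hb : 0 < b) (hn : 2 * b ≤ n)
    {a w : Fin n → K} (ha : Function.Injective a) (hw : ∀ i, w i ≠ 0)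
    (M : (Fin n → F) →ₗ[F] (Fin m → F))
    (hM : ∀ u, M u = 0 → ∃ f ∈ degreeLT K (n - 2 * b),
      ∀ i, algebraMap F K (u i) = w i * f.eval (a i)) (v : X' → Fin m → F) :
    ∃ out : X' → Fin n → F,
      Der (coordFns v) (6 * b * pb.dim * m + 800 * b * n * pb.dim ^ 2) (coordFns out) ∧
      ∀ x u, hammingNorm u ≤ b → v x = M u → out x = u := by
  classical
  have hd := pb.dim_pos
  -- The last `n - 2b` positions form an information set of the Reed–Solomon code.
  set V : Finset (Fin n) := Finset.univ.filter fun i => 2 * b ≤ (i : ℕ) with hV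
  have hVcard : V.card = n - 2 * b := by
    have h1 := Finset.card_filter_add_card_filter_not (s := (Finset.univ : Finset (Fin n)))
      (fun i => (i : ℕ) < 2 * b)
    have h2 : (Finset.univ.filter fun i : Fin n => (i : ℕ) < 2 * b).card = 2 * b := by
      rw [Fin.card_filter_val_lt]
      omega
    simp only [not_lt] at h1
    rw [Finset.card_univ, Fintype.card_fin, ← hV, h2] at h1
    omega
  let sc : (Fin n → F) →ₗ[F] (Fin n → K) := LinearMap.pi fun i =>
    (LinearMap.toSpanSingleton F K (w i)⁻¹) ∘ₗ LinearMap.proj i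
  have hsc : ∀ u i, sc u i = (w i)⁻¹ * algebraMap F K (u i) := fun u i => by
    simp [sc, Algebra.smul_def, mul_comm]
  let I : (Fin n → K) →ₗ[K] K[X] := Lagrange.interpolate V a
  -- After division by the multipliers, the codeword agreeing with `u` on `V` is subtracted. The
  -- result vanishes on `V`, is zero when `u` is a codeword, and otherwise is a received word with
  -- the error pattern of `u`.
  let Ψ : (Fin n → F) →ₗ[F] (Fin n → K) := LinearMap.pi fun i =>
    LinearMap.proj i ∘ₗ sc - ((Polynomial.leval (a i) ∘ₗ I).restrictScalars F) ∘ₗ sc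
  have hΨ : ∀ u i, Ψ u i = (w i)⁻¹ * algebraMap F K (u i) - (I (sc u)).eval (a i) := fun u i => by
    simp [Ψ, hsc, leval]
  obtain ⟨Φ, hΦ⟩ := exists_linearMap_comp_eq M Ψ fun u hu => by
    obtain ⟨f, hf, hfu⟩ := hM u hu
    have h1 : sc u = fun i => f.eval (a i) := by
      ext i
      rw [hsc, hfu, inv_mul_cancel_left₀ (hw i)]
    have h2 : I (sc u) = f := by
      rw [h1]
      refine (Lagrange.eq_interpolate (s := V) ha.injOn ?_).symm
      rw [hVcard]
      exact mem_degreeLT.mp hf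
    ext i
    rw [hΨ, h2, hfu, inv_mul_cancel_left₀ (hw i), sub_self, Pi.zero_apply]
  let ι : Fin (2 * b) → Fin n := Fin.castLE hn
  let l : List (Fin n) := (List.finRange (2 * b)).map ι
  have hl : ∀ i, i ∈ l ↔ i ∉ V := by
    intro i
    simp only [l, ι, hV, List.mem_map, List.mem_finRange, true_and, Finset.mem_filter,
      Finset.mem_univ, not_le]
    constructor
    · rintro ⟨j, rfl⟩
      exact j.2
    · exact fun hi => ⟨⟨i, hi⟩, rfl⟩
  let y : X' → Fin n → K := fun x i => if i ∈ V then 0 else Φ (v x) i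
  let st : X' → KState K := fun x =>
    (KState.init a (n - 2 * b) V).interp a (y x) (fun _ => (0 : F) ≠ 0) l
  -- Only the `2b` positions outside `V` have to be computed.
  let Φ' : (Fin m → F) →ₗ[F] (Fin (2 * b) × Fin pb.dim → F) :=
    LinearMap.pi fun p => LinearMap.proj p.2 ∘ₗ pb.basis.equivFun.toLinearMap ∘ₗ
      LinearMap.proj (ι p.1) ∘ₗ Φ
  have h₁ : Der (coordFns v) (2 * b * pb.dim * (3 * m + 1)) (coordFns fun x => Φ' (v x)) := by
    have := Der.linearMap Φ' (S := coordFns v) (v := v) subset_rfl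
    simpa only [Fintype.card_prod, Fintype.card_fin] using this
  have hy : ∀ i ∈ l, fieldFns pb (fun x => y x i) ⊆ coordFns fun x => Φ' (v x) := by
    intro i hi
    have hiV := (hl i).mp hi
    obtain ⟨j, -, rfl⟩ := List.mem_map.mp hi
    rintro _ ⟨p, rfl⟩
    refine ⟨(j, p), ?_⟩
    simp only [y, hiV, if_false]
    rfl
  -- Nothing is erased here, so one zero register serves as every erasure flag.
  have h₂ := h₁.trans (Der.fconst (0 : F))
  have h₃ := Der.rational_interpolation (pb := pb)
    (S := coordFns v ∪ ((coordFns fun x => Φ' (v x)) ∪ {Sum.inl fun _ => (0 : F)}))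
    (y := y) (ε := fun _ _ => 0) a l (fun i hi z hz => .inr (.inl (hy i hi hz)))
    (fun i _ => .inr (.inr rfl)) (n - 2 * b) (Nat.sub_le _ _) V (by omega)
  -- The error value `w (y - num / den)` lies in `F`. Cleared of its denominator, it is found by
  -- `Der.ldiv_base` without inverting in `K`.
  have hfin : ∀ i, ∃ r : X' → F, Der ((coordFns v ∪ ((coordFns fun x => Φ' (v x)) ∪
      {Sum.inl fun _ => (0 : F)})) ∪ (⋃ i, (fieldFns pb (fun x => (st x).valNum (a i)) ∪
        fieldFns pb (fun x => (st x).valDen (a i))))) (18 * pb.dim ^ 2) {Sum.inl r} ∧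
      ∀ x (c : F), (st x).valDen (a i) ≠ 0 → w i * (y x i * (st x).valDen (a i) -
        (st x).valNum (a i)) = algebraMap F K c * (st x).valDen (a i) → r x = c := by
    intro i
    set W := (coordFns v ∪ ((coordFns fun x => Φ' (v x)) ∪ {Sum.inl fun _ => (0 : F)})) ∪
      (⋃ i, (fieldFns pb (fun x => (st x).valNum (a i)) ∪
        fieldFns pb (fun x => (st x).valDen (a i)))) with hW
    have hyi : Der W pb.dim (fieldFns pb fun x => y x i) := by
      by_cases hi : i ∈ V
      · simp only [y, hi, if_true]
        exact Der.lconst 0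
      · exact Der.of_subset fun z hz => .inl (.inr (.inl (hy i ((hl i).mpr hi) hz)))
    have hnum : Der W 0 (fieldFns pb fun x => (st x).valNum (a i)) :=
      Der.of_subset fun z hz => .inr (Set.mem_iUnion.mpr ⟨i, .inl hz⟩)
    have hden : Der W 0 (fieldFns pb fun x => (st x).valDen (a i)) :=
      Der.of_subset fun z hz => .inr (Set.mem_iUnion.mpr ⟨i, .inr hz⟩)
    obtain ⟨r, hr, hr'⟩ := ((Der.lconst (w i)).lmul ((hyi.lmul hden).lsub hnum)).ldiv_base hden
    exact ⟨r, hr.mono_cost (by nlinarith), hr'⟩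
  choose r hr hspec using hfin
  refine ⟨fun x i => r i x, ?_, fun x u hu hxu => ?_⟩
  · have h₄ := h₂.bind (h₃.bind (Der.vec (v := fun x i => r i x) hr))
    refine h₄.mono_cost ?_
    simp only [l, List.length_map, List.length_finRange, Fintype.card_fin]
    have b₁ : 1 * (n * pb.dim ^ 2) ≤ b * (n * pb.dim ^ 2) := Nat.mul_le_mul_right _ hb
    have b₂ : b * pb.dim * 1 ≤ b * pb.dim * (n * pb.dim) :=
      Nat.mul_le_mul_left _ (Nat.mul_pos (by omega) hd)
    have b₃ : 1 * 1 ≤ b * pb.dim := Nat.mul_le_mul hb hd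
    linarith
  · have hyx : y x = Ψ u := by
      ext i
      by_cases hi : i ∈ V
      · simp only [y, hi, if_true]
        rw [hΨ, Lagrange.eval_interpolate_at_node _ ha.injOn hi, hsc, sub_self]
      · simp only [y, hi, if_false]
        rw [hxu, hΦ]
    have hinv : KState.Inv a (y x) (n - 2 * b) Finset.univ (st x) := by
      convert (KState.inv_init a (y x) (n - 2 * b) V fun i hi => if_pos hi).interp ha
        (er := fun _ => (0 : F) ≠ 0) (l := l)
        ((List.nodup_finRange _).map (Fin.castLE_injective hn)) fun i hi => (hl i).mp hi using 1
      ext i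
      simp only [Finset.mem_union, Finset.mem_filter, List.mem_toFinset, hl]
      simp
      tauto
    -- The transmitted polynomial is minus the interpolant. It disagrees with `y` exactly on the
    -- support of `u`, and `2b + (n - 2b) ≤ n`.
    have hg : -I (sc u) ∈ degreeLT K (n - 2 * b) := by
      rw [mem_degreeLT, degree_neg, ← hVcard]
      exact Lagrange.degree_interpolate_lt _ ha.injOn
    have hyg : ∀ i, y x i = (w i)⁻¹ * algebraMap F K (u i) + (-I (sc u)).eval (a i) := by
      intro i
      rw [hyx, hΨ, eval_neg, sub_eq_add_neg]
    ext i
    obtain ⟨h1, h2⟩ := hinv.valNum_eq ha hg (by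
      rw [Finset.card_univ, Fintype.card_fin]
      have : (Finset.univ.filter fun i => y x i ≠ (-I (sc u)).eval (a i)).card ≤ b := by
        refine le_trans (le_of_eq ?_) hu
        rw [hammingNorm]
        congr 1
        ext i
        simp [hyg, hw]
      omega) i
    refine hspec i x (u i) h1 ?_
    rw [show (st x).valNum (a i) = _ from h2, hyg, ← sub_mul, add_sub_cancel_right, ← mul_assoc,
      mul_inv_cancel_left₀ (hw i)]

end Syndrome

/-! ### The Gilbert–Varshamov bound -/

section GilbertVarshamov

variable {F : Type u} [Field F] [Fintype F] [DecidableEq F]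

/-- The volume of a Hamming ball is bounded by the entropy function. -/
lemma card_ball_le (t : ℕ) {μ : ℝ} (hμ₀ : 0 < μ) (hμ : μ < 1 - 1 / (Fintype.card F : ℝ)) :
    ((Finset.univ.filter fun v : Fin t → F => (hammingNorm v : ℝ) ≤ μ * t).card : ℝ) ≤
      (Fintype.card F : ℝ) ^ (Hq (Fintype.card F) μ * t) := by
  have hq : (1 : ℝ) < Fintype.card F := by exact_mod_cast Fintype.one_lt_card
  set q : ℝ := (Fintype.card F : ℝ) with hqdef
  have hq0 : 0 < q := by linarith
  have hq1 : 0 < q - 1 := by linarith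
  have hμ1 : 0 < 1 - μ := by
    have : 0 < 1 / q := by positivity
    linarith
  have hlogq : Real.log q ≠ 0 := (Real.log_pos hq).ne'
  -- A probability measure with nonzero mass `μ` spread evenly. Under its product measure each
  -- vector of the ball has weight at least `q ^ (-Hq μ t)`.
  let p : F → ℝ := fun x => if x = 0 then 1 - μ else μ / (q - 1)
  have hp : ∑ x, p x = 1 := by
    rw [← Finset.sum_erase_add _ _ (Finset.mem_univ (0 : F))]
    have : ∀ x ∈ Finset.univ.erase (0 : F), p x = μ / (q - 1) := fun x hx => by
      simp [p, Finset.ne_of_mem_erase hx]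
    rw [Finset.sum_congr rfl this, Finset.sum_const, Finset.card_erase_of_mem (Finset.mem_univ _),
      Finset.card_univ, nsmul_eq_mul, Nat.cast_sub Fintype.card_pos, ← hqdef]
    simp only [p, if_true, Nat.cast_one]
    field_simp
    ring
  have hsum : ∑ v : Fin t → F, ∏ j, p (v j) = 1 := by rw [← Fintype.sum_pow, hp, one_pow]
  -- Equivalent to `μ ≤ 1 - 1/q`: the weight decreases with the Hamming norm, so it is least on the
  -- boundary of the ball.
  have hL : Real.log (μ / (q - 1)) ≤ Real.log (1 - μ) := by
    refine Real.log_le_log (by positivity) ?_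
    rw [div_le_iff₀ hq1]
    have : 1 / q * q = 1 := by field_simp
    nlinarith
  have hle : ∀ v : Fin t → F, (hammingNorm v : ℝ) ≤ μ * t →
      q ^ (-(Hq (Fintype.card F) μ * t)) ≤ ∏ j, p (v j) := by
    intro v hv
    have hpos : ∀ x, 0 < p x := fun x => by
      simp only [p]
      split_ifs <;> positivity
    have hprod : ∏ j, p (v j) = Real.exp ((t - hammingNorm v) * Real.log (1 - μ) +
        hammingNorm v * Real.log (μ / (q - 1))) := by
      rw [← Real.exp_log (Finset.prod_pos fun j _ => hpos (v j)),
        Real.log_prod fun j _ => (hpos (v j)).ne']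
      congr 1
      have h1 : ∀ j, Real.log (p (v j)) = Real.log (1 - μ) +
          (if v j ≠ 0 then 1 else 0) * (Real.log (μ / (q - 1)) - Real.log (1 - μ)) := by
        intro j
        simp only [p]
        split_ifs <;> simp_all
      simp only [h1]
      rw [Finset.sum_add_distrib, ← Finset.sum_mul, Finset.sum_boole, Finset.sum_const,
        Finset.card_univ, Fintype.card_fin, nsmul_eq_mul]
      simp only [hammingNorm]
      ring
    rw [hprod, Real.rpow_def_of_pos hq0, Real.exp_le_exp]
    have h2 : Real.log q * -(Hq (Fintype.card F) μ * t) =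
        t * ((1 - μ) * Real.log (1 - μ) + μ * Real.log (μ / (q - 1))) := by
      rw [Hq, Real.log_div hμ₀.ne' hq1.ne', ← hqdef]
      simp only [Real.logb]
      field_simp
      ring
    rw [h2]
    nlinarith
  set B := Finset.univ.filter fun v : Fin t → F => (hammingNorm v : ℝ) ≤ μ * t with hB
  have h3 : (B.card : ℝ) * q ^ (-(Hq (Fintype.card F) μ * t)) ≤ 1 := by
    rw [← hsum, ← nsmul_eq_mul, ← Finset.sum_const]
    refine (Finset.sum_le_sum fun v hv => hle v (Finset.mem_filter.mp hv).2).trans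
      (Finset.sum_le_sum_of_subset_of_nonneg (Finset.filter_subset _ _) fun v _ _ => ?_)
    refine Finset.prod_nonneg fun j _ => ?_
    simp only [p]
    split_ifs <;> positivity
  rw [Real.rpow_neg hq0.le] at h3
  rwa [← div_eq_mul_inv, div_le_one (by positivity)] at h3

/-- The Gilbert–Varshamov bound for linear codes. -/
lemma exists_inner_code {E : Type*} [Field E] [Algebra F E] [Finite E] {t : ℕ} (ht : 0 < t)
    {μ : ℝ} (hμ₀ : 0 < μ) (hμ : μ < 1 - 1 / (Fintype.card F : ℝ))
    (hE : (Module.finrank F E : ℝ) ≤ (1 - Hq (Fintype.card F) μ) * t) :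
    ∃ enc : E →ₗ[F] (Fin t → F), ∀ z, z ≠ 0 → μ * t < hammingNorm (enc z) := by
  classical
  have := Fintype.ofFinite E
  have hfin : Module.Finite F E := Module.Finite.of_finite
  have : Finite (E →ₗ[F] (Fin t → F)) := DFunLike.finite _
  have := Fintype.ofFinite (E →ₗ[F] (Fin t → F))
  by_contra! hcon
  have hq : (1 : ℝ) < Fintype.card F := by exact_mod_cast Fintype.one_lt_card
  set B := Finset.univ.filter fun v : Fin t → F => (hammingNorm v : ℝ) ≤ μ * t with hB
  -- For fixed `z ≠ 0` and a uniformly random linear map, the image of `z` is uniformly distributed: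
  -- adding `g.smulRight v` with `g z = 1` translates it by `v`.
  have hfib : ∀ z : E, z ≠ 0 → Fintype.card F ^ t *
      (Finset.univ.filter fun φ : E →ₗ[F] (Fin t → F) => φ z ∈ B).card =
      B.card * Fintype.card (E →ₗ[F] (Fin t → F)) := by
    intro z hz
    obtain ⟨g, hg⟩ := (LinearMap.toSpanSingleton F E z).exists_leftInverse_of_injective
      (LinearMap.ker_toSpanSingleton F hz)
    have hg1 : g z = 1 := by simpa using LinearMap.congr_fun hg 1
    have hcard : ∀ v : Fin t → F, (Finset.univ.filter fun φ : E →ₗ[F] (Fin t → F) =>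
        φ z = v).card = (Finset.univ.filter fun φ : E →ₗ[F] (Fin t → F) => φ z = 0).card := by
      intro v
      refine Finset.card_bij' (fun φ _ => φ - g.smulRight v) (fun φ _ => φ + g.smulRight v)
        ?_ ?_ ?_ ?_
      · intro φ hφ
        simp_all
      · intro φ hφ
        simp_all
      · simp
      · simp
    have hmem : ∀ B' : Finset (Fin t → F), (Finset.univ.filter fun φ : E →ₗ[F] (Fin t → F) =>
        φ z ∈ B').card = B'.card * (Finset.univ.filter fun φ : E →ₗ[F] (Fin t → F) =>
          φ z = 0).card := by
      intro B'
      rw [Finset.card_eq_sum_card_fiberwise (f := fun φ : E →ₗ[F] (Fin t → F) => φ z) (t := B')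
        (s := Finset.univ.filter fun φ : E →ₗ[F] (Fin t → F) => φ z ∈ B')
        fun φ hφ => Finset.mem_coe.mpr (Finset.mem_filter.mp (Finset.mem_coe.mp hφ)).2,
        ← smul_eq_mul, ← Finset.sum_const]
      refine Finset.sum_congr rfl fun v hv => ?_
      rw [Finset.filter_filter, ← hcard v]
      congr 1
      ext φ
      simp only [Finset.mem_filter, Finset.mem_univ, true_and]
      exact ⟨fun h => h.2, fun h => ⟨h ▸ hv, h⟩⟩
    have huniv := hmem Finset.univ
    simp only [Finset.mem_univ, Finset.filter_true, Finset.card_univ, Fintype.card_fun,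
      Fintype.card_fin] at huniv
    rw [hmem B, huniv]
    ring
  -- Union bound. Omitting `z = 0` gives the strict inequality in `h3`.
  have hcover : Fintype.card (E →ₗ[F] (Fin t → F)) ≤ ∑ z ∈ Finset.univ.erase (0 : E),
      (Finset.univ.filter fun φ : E →ₗ[F] (Fin t → F) => φ z ∈ B).card := by
    refine le_trans ?_ Finset.card_biUnion_le
    rw [← Finset.card_univ]
    refine Finset.card_le_card fun φ _ => ?_
    obtain ⟨z, hz, hφ⟩ := hcon φ
    simp only [Finset.mem_biUnion, Finset.mem_erase, Finset.mem_univ, and_true, Finset.mem_filter,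
      true_and]
    exact ⟨z, hz, by simpa [hB] using hφ⟩
  have h1 := Nat.mul_le_mul_left (Fintype.card F ^ t) hcover
  rw [Finset.mul_sum, Finset.sum_congr rfl fun z hz => hfib z (Finset.ne_of_mem_erase hz),
    Finset.sum_const, smul_eq_mul, ← mul_assoc,
    Finset.card_erase_of_mem (Finset.mem_univ _), Finset.card_univ] at h1
  have h2 := Nat.le_of_mul_le_mul_right h1 Fintype.card_pos
  have hBpos : 0 < B.card := Finset.card_pos.mpr ⟨0, by simp [hB]; positivity⟩
  have h3 : (Fintype.card F : ℝ) ^ t < Fintype.card E * B.card := by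
    have : Fintype.card F ^ t < Fintype.card E * B.card :=
      h2.trans_lt (Nat.mul_lt_mul_of_pos_right (Nat.sub_lt Fintype.card_pos one_pos) hBpos)
    exact_mod_cast this
  have h4 : (Fintype.card E : ℝ) * B.card ≤ (Fintype.card F : ℝ) ^ t := by
    rw [Module.card_eq_pow_finrank (K := F) (V := E), Nat.cast_pow, ← Real.rpow_natCast,
      ← Real.rpow_natCast]
    refine (mul_le_mul_of_nonneg_left (card_ball_le t hμ₀ hμ) (by positivity)).trans ?_
    rw [← Real.rpow_add (by linarith)]
    exact Real.rpow_le_rpow_of_exponent_le hq.le (by linarith)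
  exact h3.not_ge h4

end GilbertVarshamov

/-! ### Existence of the design -/

section Design

open Polynomial

/-- A finite field has extensions of every degree. -/
lemma exists_extension (F : Type u) [Field F] [Finite F] (κ : ℕ) (hκ : κ ≠ 0) :
    ∃ (E : Type u) (_ : Field E) (_ : Algebra F E), Module.finrank F E = κ := by
  obtain ⟨p, hp⟩ := CharP.exists F
  have : Fact p.Prime := ⟨CharP.char_is_prime F p⟩
  have : NeZero κ := ⟨hκ⟩
  exact ⟨ULift.{u} (FiniteField.Extension F p κ), inferInstance, inferInstance,
    (LinearEquiv.finrank_eq ULift.moduleEquiv).trans (FiniteField.finrank_extension F p κ)⟩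

/-- A primitive element of a finite extension generates a power basis. -/
lemma exists_powerBasis_of_isPrimitiveElement {F : Type u} {K : Type v} [Field F] [Field K]
    [Algebra F K] [FiniteDimensional F K] {α : K} (hα : IsPrimitiveElement α) :
    ∃ pb : PowerBasis F K, pb.gen = α := by
  refine ⟨PowerBasis.ofAdjoinEqTop (x := α) (Algebra.IsIntegral.isIntegral α) ?_,
    PowerBasis.ofAdjoinEqTop_gen _ _⟩
  rw [eq_top_iff]
  intro z _
  by_cases hz : z = 0
  · rw [hz]
    exact zero_mem _
  · obtain ⟨i, rfl⟩ := hα.2 z hz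
    exact pow_mem (Algebra.self_mem_adjoin_singleton F α) i

/-- Every linear code has a parity check matrix. -/
lemma exists_parityCheckMatrix {K : Type v} [Field K] {n r : ℕ} (C : Submodule K (Fin n → K))
    (hC : Module.finrank K C + r = n) :
    ∃ H : Matrix (Fin r) (Fin n) K, IsParityCheckMatrix H C := by
  have h1 : Module.finrank K ((Fin n → K) ⧸ C) = Module.finrank K (Fin r → K) := by
    have := C.finrank_quotient_add_finrank
    rw [Module.finrank_fin_fun] at this ⊢
    omega
  let e := LinearEquiv.ofFinrankEq _ _ h1
  let T : (Fin n → K) →ₗ[K] (Fin r → K) := e.toLinearMap ∘ₗ C.mkQ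
  refine ⟨LinearMap.toMatrix' T, ?_, fun c => ?_⟩
  · have hsurj : Function.Surjective (LinearMap.toMatrix' T).mulVec := by
      intro z
      obtain ⟨x, hx⟩ := (e.surjective.comp C.mkQ_surjective) z
      exact ⟨x, by rw [LinearMap.toMatrix'_mulVec]; exact hx⟩
    have : LinearIndependent K (LinearMap.toMatrix' T).row := by
      rw [← Matrix.vecMul_injective_iff]
      intro u w huw
      refine dotProduct_eq _ _ fun z => ?_
      obtain ⟨x, rfl⟩ := hsurj z
      simp only at huw
      rw [Matrix.dotProduct_mulVec, Matrix.dotProduct_mulVec, huw]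
    exact this
  · rw [LinearMap.toMatrix'_mulVec]
    simp only [T, LinearMap.comp_apply, LinearEquiv.coe_coe, LinearEquiv.map_eq_zero_iff,
      Submodule.mkQ_apply, Submodule.Quotient.mk_eq_zero]

/-- The evaluation of polynomials of degree less than `k`. -/
def evalMap {K : Type v} [Field K] {n : ℕ} (a : Fin n → K) (k : ℕ) :
    degreeLT K k →ₗ[K] (Fin n → K) :=
  LinearMap.pi fun i => Polynomial.leval (a i) ∘ₗ (degreeLT K k).subtype

lemma evalMap_injective {K : Type v} [Field K] {n : ℕ} {a : Fin n → K}
    (ha : Function.Injective a) {k : ℕ} (hk : k ≤ n) : Function.Injective (evalMap a k) := by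
  rw [injective_iff_map_eq_zero]
  rintro ⟨f, hf⟩ h
  refine Subtype.ext (Polynomial.eq_zero_of_degree_lt_of_eval_index_eq_zero (s := Finset.univ)
    (v := a) ha.injOn ?_ fun i _ => congrFun h i)
  rw [Finset.card_univ, Fintype.card_fin]
  exact (mem_degreeLT.mp hf).trans_le (by exact_mod_cast hk)

lemma finrank_degreeLT (K : Type v) [Field K] (k : ℕ) : Module.finrank K (degreeLT K k) = k := by
  rw [(degreeLTEquiv K k).finrank_eq, Module.finrank_fin_fun]

/-- The code of evaluations of polynomials of degree less than `k`. -/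
lemma isReedSolomon_range {K : Type v} [Field K] {n : ℕ} {a : Fin n → K}
    (ha : Function.Injective a) (k : ℕ) : IsReedSolomon k (LinearMap.range (evalMap a k)) := by
  refine ⟨a, fun _ => 1, ha, fun _ => one_ne_zero, fun c => ?_⟩
  constructor
  · rintro ⟨f, rfl⟩
    exact ⟨f, mem_degreeLT.mp f.2, fun i => (one_mul _).symm⟩
  · rintro ⟨f, hf, hc⟩
    exact ⟨⟨f, mem_degreeLT.mpr hf⟩, funext fun i => by rw [hc, one_mul]; rfl⟩

lemma blockEncode_injective {F : Type u} [Field F] [DecidableEq F] {E : Type*} [Field E]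
    [Algebra F E] {N t : ℕ} {enc : E →ₗ[F] (Fin t → F)} (henc : Function.Injective enc) :
    Function.Injective (blockEncode fun _ : Fin N => enc) := by
  intro o o' h
  ext i
  have := congrArg (fun y => block y i) h
  simp only [block_blockEncode] at this
  exact henc this

lemma isGeneratorMatrix_of_basis {F : Type u} [Field F] {V : Type*} [AddCommGroup V] [Module F V]
    {m k : ℕ} (Θ : V →ₗ[F] (Fin m → F)) (hΘ : Function.Injective Θ) (bas : Module.Basis (Fin k) F V) :
    IsGeneratorMatrix (fun i j => Θ (bas j) i) (LinearMap.range Θ) := by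
  refine ⟨bas.linearIndependent.map' Θ (LinearMap.ker_eq_bot.mpr hΘ), ?_⟩
  have : Set.range (fun j : Fin k => Θ (bas j)) = Θ '' Set.range bas := by
    rw [← Set.range_comp]
    rfl
  change Submodule.span F (Set.range fun j : Fin k => Θ (bas j)) = _
  rw [this, Submodule.span_image, bas.span_eq, Submodule.map_top]

/-- The design exists. -/
theorem exists_design {F : Type u} {K : Type v} [Field F] [Fintype F] [DecidableEq F] [Field K]
    [Algebra F K] {α : K} (hα : IsPrimitiveElement α) {s : ℕ} (hs : Module.finrank F K = s)
    (hs₀ : s ≠ 0) {t b n : ℕ} {ε ρ μ : ℝ} (ht : 0 < t) (hμ₀ : 0 < μ)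
    (hμ : μ < 1 - 1 / (Fintype.card F : ℝ)) (hε : ε = 1 - Hq (Fintype.card F) μ)
    (hinv : HqInv (Fintype.card F) (1 - ε) = μ) (hκ : innerDim ε t ≠ 0)
    (hk : outerDim (Fintype.card F) ε ρ t ≤ outerLength (Fintype.card F) ε t)
    (hb : 2 * b * s ≤ conDim (Fintype.card F) ε ρ t) (hbn : 2 * b ≤ n)
    (hn : n ≤ Fintype.card F ^ s) :
    ∃ (G : Matrix (Fin (conLength (Fintype.card F) ε t)) (Fin (conDim (Fintype.card F) ε ρ t)) F)
      (A' : Matrix (Fin (conDim (Fintype.card F) ε ρ t)) (Fin n) F),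
      IsDesign α t ε ρ b s G A' := by
  obtain ⟨E, _, _, hE⟩ := exists_extension F (innerDim ε t) hκ
  have : FiniteDimensional F E := Module.finite_of_finrank_pos (hE ▸ Nat.pos_of_ne_zero hκ)
  have : FiniteDimensional F K := Module.finite_of_finrank_pos (hs ▸ Nat.pos_of_ne_zero hs₀)
  have : Finite E := Module.finite_of_finite F
  have : Finite K := Module.finite_of_finite F
  have := Fintype.ofFinite E
  have := Fintype.ofFinite K
  have hE' : Fintype.card E = outerLength (Fintype.card F) ε t := by
    rw [Module.card_eq_pow_finrank (K := F) (V := E), hE, outerLength]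
  have hκ' : (innerDim ε t : ℝ) ≤ ε * t :=
    Nat.floor_le (Nat.floor_pos.mp (Nat.pos_of_ne_zero hκ) |>.trans' zero_le_one)
  obtain ⟨enc, henc⟩ := exists_inner_code (E := E) ht hμ₀ hμ (by
    rw [hE]
    refine hκ'.trans (le_of_eq ?_)
    rw [hε])
  have hinj : Function.Injective enc := by
    rw [injective_iff_map_eq_zero]
    intro z hz
    by_contra h0
    have := henc z h0
    rw [hz, hammingNorm_zero, Nat.cast_zero] at this
    exact this.not_ge (by positivity)
  let a : Fin (outerLength (Fintype.card F) ε t) → E := (Fintype.equivFinOfCardEq hE').symm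
  have ha : Function.Injective a := Equiv.injective _
  set k := outerDim (Fintype.card F) ε ρ t with hkdef
  -- Message polynomials form an `F`-space of dimension `innerDim * k`; the columns of `G` are the
  -- images of a basis.
  let Θ : degreeLT E k →ₗ[F] (Fin (outerLength (Fintype.card F) ε t * t) → F) :=
    blockEncode (fun _ => enc) ∘ₗ (evalMap a k).restrictScalars F
  have hΘ : Function.Injective Θ := (blockEncode_injective hinj).comp (evalMap_injective ha hk)
  have hrank : Module.finrank F (degreeLT E k) = innerDim ε t * k := by
    rw [← Module.finrank_mul_finrank F E, hE, finrank_degreeLT]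
  have : FiniteDimensional F (degreeLT E k) := FiniteDimensional.of_injective Θ hΘ
  let bas : Module.Basis (Fin (innerDim ε t * k)) F (degreeLT E k) :=
    Module.finBasisOfFinrankEq F _ hrank
  obtain ⟨pb, rfl⟩ := exists_powerBasis_of_isPrimitiveElement (F := F) hα
  obtain rfl : pb.dim = s := pb.finrank.symm.trans hs
  have hK : n ≤ Fintype.card K := by
    rwa [Module.card_eq_pow_finrank (K := F) (V := K), hs]
  let a' : Fin n → K := fun i => (Fintype.equivFin K).symm (Fin.castLE hK i)
  have ha' : Function.Injective a' := fun i j hij => Fin.castLE_injective hK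
    ((Fintype.equivFin K).symm.injective hij)
  obtain ⟨H, hH⟩ := exists_parityCheckMatrix (r := 2 * b)
    (LinearMap.range (evalMap a' (n - 2 * b))) (by
      rw [LinearMap.finrank_range_of_inj (evalMap_injective ha' (Nat.sub_le _ _)),
        finrank_degreeLT]
      omega)
  -- The first `2bs` rows of `A'` are the coordinates of a parity check matrix in the basis `1, α,
  -- …, α^(s-1)`, so that lifting restores it. The other rows are zero.
  refine ⟨fun i j => Θ (bas j) i, fun i l => if h : (i : ℕ) < 2 * b * pb.dim then
    pb.basis.equivFun (H (finProdFinEquiv.symm ⟨i, h⟩).1 l) (finProdFinEquiv.symm ⟨i, h⟩).2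
    else 0, ⟨LinearMap.range Θ, ⟨E, inferInstance, inferInstance, LinearMap.range (evalMap a k),
      enc, hE, isReedSolomon_range ha k, hinj, fun z hz => ?_, fun c => ?_⟩, ?_⟩,
    Fin.castLE hb, Fin.castLE_injective hb, _, isReedSolomon_range ha' _, ?_⟩
  · rw [hinv]
    exact (henc z hz).le
  · constructor
    · rintro ⟨f, rfl⟩
      exact ⟨_, ⟨f, rfl⟩, fun i j => congrFun (block_blockEncode (fun _ => enc) _ i) j⟩
    · rintro ⟨_, ⟨f, rfl⟩, hc⟩
      refine ⟨f, funext fun l => ?_⟩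
      obtain ⟨⟨i, j⟩, rfl⟩ := finProdFinEquiv.surjective l
      rw [hc]
      exact congrFun (block_blockEncode (fun _ => enc) _ i) j
  · exact isGeneratorMatrix_of_basis Θ hΘ bas
  · convert hH using 1
    ext k l
    conv_rhs => rw [← pb.basis.sum_equivFun (H k l)]
    refine Finset.sum_congr rfl fun i _ => ?_
    rw [pb.coe_basis, Algebra.smul_def]
    congr 2
    have h : ((Fin.castLE hb (finProdFinEquiv (k, i)) : Fin _) : ℕ) < 2 * b * pb.dim :=
      (finProdFinEquiv (k, i)).2
    change (if h : _ then _ else _) = _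
    rw [dif_pos h]
    have e : (⟨_, h⟩ : Fin (2 * b * pb.dim)) = finProdFinEquiv (k, i) := rfl
    rw [e, Equiv.symm_apply_apply]
    rfl

end Design

/-! ### Recovery -/

section Recovery

open Polynomial

lemma IsGeneratorMatrix.mulVec_mem {F : Type u} [Field F] {m k : ℕ} {G : Matrix (Fin m) (Fin k) F}
    {C : Submodule F (Fin m → F)} (hG : IsGeneratorMatrix G C) (u : Fin k → F) :
    G.mulVec u ∈ C := by
  have : G.mulVec u = ∑ j, u j • fun i => G i j := by
    ext i
    simp [Matrix.mulVec, dotProduct, mul_comm]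
  rw [this, ← hG.2]
  exact Submodule.sum_mem _ fun j _ => Submodule.smul_mem _ _ (Submodule.subset_span ⟨j, rfl⟩)

lemma IsGeneratorMatrix.eq_zero {F : Type u} [Field F] {m k : ℕ} {G : Matrix (Fin m) (Fin k) F}
    {C : Submodule F (Fin m → F)} (hG : IsGeneratorMatrix G C) {u : Fin k → F}
    (hu : G.mulVec u = 0) : u = 0 := by
  refine funext (Fintype.linearIndependent_iff.mp hG.1 u ?_)
  rw [← hu]
  ext i
  simp [Matrix.mulVec, dotProduct, mul_comm]

/-- The codewords of a concatenated code are encodings of polynomials. -/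
lemma IsDcon.exists_conEncode {F : Type u} [Field F] [Fintype F] [DecidableEq F] {t : ℕ} {ε ρ : ℝ}
    {C : Submodule F (Fin (conLength (Fintype.card F) ε t) → F)} (hC : IsDcon t ε ρ C) :
    ∃ (E : Type u) (_ : Field E) (_ : Algebra F E)
      (a : Fin (outerLength (Fintype.card F) ε t) → E)
      (enc : Fin (outerLength (Fintype.card F) ε t) → E →ₗ[F] (Fin t → F)),
      Module.finrank F E = innerDim ε t ∧ Function.Injective a ∧
      (∀ i z, z ≠ 0 → ⌈HqInv (Fintype.card F) (1 - ε) * (t : ℝ)⌉₊ ≤ hammingNorm (enc i z)) ∧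
      ∀ c ∈ C, ∃ f ∈ degreeLT E (outerDim (Fintype.card F) ε ρ t), c = conEncode enc a f := by
  obtain ⟨E, _, _, outer, enc, hE, ⟨a, w, ha, hw, hout⟩, -, hdist, hmem⟩ := hC
  -- Column multipliers are absorbed into inner encoders that vary with the block; the images, and
  -- hence the distances, are unchanged.
  refine ⟨E, inferInstance, inferInstance, a, fun i => enc ∘ₗ LinearMap.mulLeft F (w i), hE, ha,
    fun i z hz => Nat.ceil_le.mpr (hdist _ (mul_ne_zero (hw i) hz)), fun c hc => ?_⟩
  obtain ⟨o, ho, hco⟩ := (hmem c).mp hc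
  obtain ⟨f, hf, hof⟩ := (hout o).mp ho
  refine ⟨f, mem_degreeLT.mpr hf, funext fun l => ?_⟩
  obtain ⟨⟨i, j⟩, rfl⟩ := finProdFinEquiv.surjective l
  refine (hco i j).trans ?_
  rw [hof]
  exact (congrFun (block_blockEncode (fun i => enc ∘ₗ LinearMap.mulLeft F (w i))
    (fun i => f.eval (a i)) i) j).symm

lemma hammingDist_add_left_self {F : Type u} [Field F] [DecidableEq F] {m : ℕ} (v e : Fin m → F) :
    hammingDist (v + e) v = hammingNorm e := by
  rw [hammingDist_comm, hammingDist_eq_hammingNorm, neg_add_cancel_left]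

/-- Every design admits exact recovery. -/
theorem IsDesign.exists_program {F : Type u} {K : Type v} [Field F] [Fintype F] [DecidableEq F]
    [Field K] [Algebra F K] {α : K} (hα : IsPrimitiveElement α) {s : ℕ}
    (hs : Module.finrank F K = s) (hs₀ : s ≠ 0) {t b n : ℕ} {ε ρ δ : ℝ} (hb : 0 < b)
    (hbn : 2 * b ≤ n) (ht : 0 < t) (hκ : innerDim ε t ≠ 0) (hκt : innerDim ε t ≤ t)
    (hk : outerDim (Fintype.card F) ε ρ t ≤ outerLength (Fintype.card F) ε t)
    (hμ₀ : 0 < HqInv (Fintype.card F) (1 - ε)) (hμ₁ : HqInv (Fintype.card F) (1 - ε) ≤ 1)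
    (hδ : 2 * (δ * conLength (Fintype.card F) ε t) < HqInv (Fintype.card F) (1 - ε) * t *
      (outerLength (Fintype.card F) ε t + 1 - outerDim (Fintype.card F) ε ρ t))
    {G : Matrix (Fin (conLength (Fintype.card F) ε t)) (Fin (conDim (Fintype.card F) ε ρ t)) F}
    {A' : Matrix (Fin (conDim (Fintype.card F) ε ρ t)) (Fin n) F}
    (h : IsDesign α t ε ρ b s G A') :
    ∃ P : Program F n, P.ops ≤ 1100 * conLength (Fintype.card F) ε t ^ 2 * t +
        6 * b * s * conLength (Fintype.card F) ε t + 800 * b * n * s ^ 2 ∧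
      ∀ x : Fin n → F, hammingNorm x ≤ b →
        ∀ e ∈ worstCaseNoise F δ (conLength (Fintype.card F) ε t),
          P.eval ((G * A').mulVec x + e) = x := by
  obtain ⟨⟨C, hC, hG⟩, rows, -, R, ⟨a', w', ha', hw', hR⟩, hH⟩ := h
  obtain ⟨E, _, _, a, enc, hE, ha, hD, henc⟩ := hC.exists_conEncode
  have : FiniteDimensional F E := Module.finite_of_finrank_pos (hE ▸ Nat.pos_of_ne_zero hκ)
  have : FiniteDimensional F K := Module.finite_of_finrank_pos (hs ▸ Nat.pos_of_ne_zero hs₀)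
  have : Finite E := Module.finite_of_finite F
  have := Fintype.ofFinite E
  have hE' : Fintype.card E = outerLength (Fintype.card F) ε t := by
    rw [Module.card_eq_pow_finrank (K := F) (V := E), hE, outerLength]
  let pbE : PowerBasis F E := Field.powerBasisOfFiniteOfSeparable F E
  have hpbE : pbE.dim = innerDim ε t := pbE.finrank.symm.trans hE
  obtain ⟨pb, rfl⟩ := exists_powerBasis_of_isPrimitiveElement (F := F) hα
  obtain rfl : pb.dim = s := pb.finrank.symm.trans hs
  set D := ⌈HqInv (Fintype.card F) (1 - ε) * (t : ℝ)⌉₊ with hDdef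
  have hD₀ : 0 < D := Nat.ceil_pos.mpr (by positivity)
  have hDt : D ≤ t := Nat.ceil_le.mpr (mul_le_of_le_one_left (by positivity) hμ₁)
  obtain ⟨dec, hdec, hdec'⟩ := exists_concatenated_decoder pbE enc (hpbE ▸ hκt) hE' ha hk hD₀ hDt hD
  let M : (Fin n → F) →ₗ[F]
      (Fin (outerLength (Fintype.card F) ε t * t) → F) := (G * A').mulVecLin
  have hMx : ∀ x, M x = G.mulVec (A'.mulVec x) := fun x => (Matrix.mulVec_mulVec x G A').symm
  -- If `GA'u = 0`, then `A'u = 0` by injectivity of `G`. Since `u` has entries in `F`, the lifted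
  -- matrix kills it too, and `u` is a Reed–Solomon codeword.
  obtain ⟨out, hout, hout'⟩ := exists_syndrome_decoder pb hb hbn ha' hw' M (fun u hu => by
    have h1 : A'.mulVec u = 0 := hG.eq_zero ((hMx u).symm.trans hu)
    have h2 : (liftMatrix pb.gen (A'.submatrix rows id)).mulVec
        (fun l => algebraMap F K (u l)) = 0 := by
      ext k
      simp only [Matrix.mulVec, dotProduct, liftMatrix, Matrix.submatrix_apply, id, Pi.zero_apply]
      simp only [Finset.sum_mul]
      rw [Finset.sum_comm]
      refine Finset.sum_eq_zero fun τ _ => ?_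
      have h3 := congrArg (algebraMap F K) (congrFun h1 (rows (finProdFinEquiv (k, τ))))
      simp only [Matrix.mulVec, dotProduct, map_sum, map_mul, Pi.zero_apply, map_zero] at h3
      calc _ = (∑ l, algebraMap F K (A' (rows (finProdFinEquiv (k, τ))) l) *
            algebraMap F K (u l)) * pb.gen ^ (τ : ℕ) := by
            rw [Finset.sum_mul]
            exact Finset.sum_congr rfl fun l _ => by ring
        _ = 0 := by rw [h3, zero_mul]
    obtain ⟨f, hf, hfu⟩ := (hR _).mp ((hH.2 _).mpr h2)
    exact ⟨f, mem_degreeLT.mpr hf, hfu⟩) dec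
  obtain ⟨P, hP, hP'⟩ := (hdec.bind (hout.mono_left Set.subset_union_right)).exists_program
  refine ⟨P, hP.trans (le_of_eq ?_), fun x hx e he => ?_⟩
  · simp only [conLength]
    ring
  · refine (hP' _).trans ?_
    refine hout' _ x hx ?_
    obtain ⟨f, hf, hfx⟩ := henc (M x) (by
      rw [hMx]
      exact hG.mulVec_mem _)
    rw [hfx]
    refine hdec' f hf _ ?_
    rw [← hfx]
    have h1 : hammingDist ((G * A').mulVec x + e) (M x) = hammingNorm e :=
      hammingDist_add_left_self _ e
    have h2 : (2 : ℝ) * hammingNorm e < D * (outerLength (Fintype.card F) ε t + 1 -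
        outerDim (Fintype.card F) ε ρ t) := by
      have hk' : (outerDim (Fintype.card F) ε ρ t : ℝ) ≤ outerLength (Fintype.card F) ε t := by
        exact_mod_cast hk
      have he' : (hammingNorm e : ℝ) ≤ δ * conLength (Fintype.card F) ε t := he
      have hDle := Nat.le_ceil (HqInv (Fintype.card F) (1 - ε) * (t : ℝ))
      calc (2 : ℝ) * hammingNorm e ≤ 2 * (δ * conLength (Fintype.card F) ε t) := by linarith
        _ < _ := hδ
        _ ≤ _ := mul_le_mul_of_nonneg_right hDle (by linarith)
    refine lt_of_eq_of_lt (congrArg (2 * ·) h1) ?_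
    have h3 : ((outerLength (Fintype.card F) ε t + 1 - outerDim (Fintype.card F) ε ρ t : ℕ) : ℝ) =
        outerLength (Fintype.card F) ε t + 1 - outerDim (Fintype.card F) ε ρ t := by
      rw [Nat.cast_sub (by omega)]
      push_cast
      ring
    rw [← h3] at h2
    exact_mod_cast h2

end Recovery

/-! ### The entropy function -/

section Entropy

lemma Hq_eq (q : ℕ) (x : ℝ) : Hq q x = Real.qaryEntropy q x / Real.log q := by
  simp only [Hq, Real.qaryEntropy, Real.binEntropy, Real.logb, Real.log_inv]
  push_cast
  ring

lemma Hq_strictMonoOn {q : ℕ} (hq : 2 ≤ q) :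
    StrictMonoOn (Hq q) (Set.Icc (0 : ℝ) (1 - 1 / (q : ℝ))) := by
  intro x hx y hy hxy
  rw [Hq_eq, Hq_eq]
  have : 0 < Real.log q := Real.log_pos (by exact_mod_cast hq)
  gcongr
  exact Real.qaryEntropy_strictMonoOn hq hx hy hxy

lemma Hq_mem_Ioo {q : ℕ} (hq : 2 ≤ q) {x : ℝ} (hx₀ : 0 < x) (hx : x < 1 - 1 / (q : ℝ)) :
    Hq q x ∈ Set.Ioo (0 : ℝ) 1 := by
  have hq' : (2 : ℝ) ≤ q := by exact_mod_cast hq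
  have hq1 : (0 : ℝ) < q - 1 := by linarith
  have hlog : Real.log q ≠ 0 := (Real.log_pos (by linarith)).ne'
  have hnn : (0 : ℝ) ≤ 1 - 1 / (q : ℝ) := by linarith
  have h0 : Hq q 0 = 0 := by simp [Hq]
  have h1 : Hq q (1 - 1 / (q : ℝ)) = 1 := by
    have e : (1 : ℝ) - 1 / q = (q - 1) / q := by field_simp
    rw [Hq, sub_sub_cancel, e]
    simp only [Real.logb, Real.log_div hq1.ne' (by linarith : (q : ℝ) ≠ 0), one_div, Real.log_inv]
    field_simp
    ring
  have hm := Hq_strictMonoOn hq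
  constructor
  · rw [← h0]
    exact hm ⟨le_rfl, hnn⟩ ⟨hx₀.le, hx.le⟩ hx₀
  · rw [← h1]
    exact hm ⟨hx₀.le, hx.le⟩ ⟨hnn, le_rfl⟩ hx

lemma HqInv_Hq {q : ℕ} (hq : 2 ≤ q) {x : ℝ} (hx₀ : 0 ≤ x) (hx : x ≤ 1 - 1 / (q : ℝ)) :
    HqInv q (Hq q x) = x :=
  (Hq_strictMonoOn hq).injOn.leftInvOn_invFunOn ⟨hx₀, hx⟩

end Entropy

/-! ### The parameters of the concatenated code -/

section Parameters

variable {q : ℕ} {ε ρ : ℝ}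

lemma strictMonoOn_mul_rpow (hq : 2 ≤ q) (hε : 0 < ε) (hρ : 0 < ρ) :
    StrictMonoOn (fun x : ℝ => ε * ρ * x * (q : ℝ) ^ (ε * x)) (Set.Ici 0) := by
  intro x hx y _ hxy
  have hq1 : (1 : ℝ) < q := by exact_mod_cast hq
  have hx0 : (0 : ℝ) ≤ x := hx
  have h1 : (q : ℝ) ^ (ε * x) ≤ (q : ℝ) ^ (ε * y) :=
    Real.rpow_le_rpow_of_exponent_le hq1.le (by nlinarith)
  have h2 : 0 < (q : ℝ) ^ (ε * y) := by positivity
  have h3 : ε * ρ * x < ε * ρ * y := by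
    have := mul_pos hε hρ
    nlinarith
  exact (mul_le_mul_of_nonneg_left h1 (by positivity)).trans_lt (mul_lt_mul_of_pos_right h3 h2)

/-- The function is not monotone on the negative axis but has the wrong sign there, so uniqueness on
the whole line reduces to the half-line. -/
lemma pos_of_mul_rpow_eq (hq : 2 ≤ q) (hε : 0 < ε) (hρ : 0 < ρ) {x c : ℝ} (hc : 0 < c)
    (h : ε * ρ * x * (q : ℝ) ^ (ε * x) = c) : 0 < x := by
  by_contra! hx
  have h1 : 0 < (q : ℝ) ^ (ε * x) := by positivity
  have h2 := mul_nonneg (mul_pos hε hρ).le (neg_nonneg.mpr hx)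
  nlinarith

/-- The equation that defines `t*` has exactly one solution. -/
lemma existsUnique_mul_rpow_eq (hq : 2 ≤ q) (hε : 0 < ε) (hρ : 0 < ρ) {c : ℝ} (hc : 0 < c) :
    ∃! x : ℝ, ε * ρ * x * (q : ℝ) ^ (ε * x) = c := by
  have hq1 : (1 : ℝ) < q := by exact_mod_cast hq
  have hερ := mul_pos hε hρ
  have hcont : Continuous fun x : ℝ => ε * ρ * x * (q : ℝ) ^ (ε * x) := by
    refine (continuous_const.mul continuous_id).mul ?_
    exact Continuous.rpow continuous_const (by fun_prop) fun x => .inl (by linarith)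
  have hX : 0 ≤ c / (ε * ρ) := by positivity
  obtain ⟨x, -, hx⟩ := intermediate_value_Icc hX hcont.continuousOn (show c ∈ Set.Icc _ _ from
    ⟨by simpa using hc.le, by
      have h1 : 1 ≤ (q : ℝ) ^ (ε * (c / (ε * ρ))) :=
        Real.one_le_rpow hq1.le (by positivity)
      have h2 : ε * ρ * (c / (ε * ρ)) = c := by field_simp
      simp only [h2]
      nlinarith⟩)
  refine ⟨x, hx, fun y hy => ?_⟩
  exact (strictMonoOn_mul_rpow hq hε hρ).injOn (pos_of_mul_rpow_eq hq hε hρ hc hy).le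
    (pos_of_mul_rpow_eq hq hε hρ hc hx).le (hy.trans hx.symm)

/-- The size of the parameters of the concatenated code. -/
lemma exists_parameter_bounds (hq : 2 ≤ q) (hε₀ : 0 < ε) (hε₁ : ε < 1) (hρ : 0 < ρ) :
    ∃ (c₁ c₂ c₃ : ℝ) (b₀ : ℕ), 0 < c₁ ∧ 0 < c₂ ∧ 0 < c₃ ∧ 1 ≤ b₀ ∧ ∀ b s : ℕ, b₀ ≤ b → 1 ≤ s →
      ∀ x : ℝ, ε * ρ * x * (q : ℝ) ^ (ε * x) = 4 * (q : ℝ) * b * s →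
        0 < ⌈x⌉₊ ∧ innerDim ε ⌈x⌉₊ ≠ 0 ∧ innerDim ε ⌈x⌉₊ ≤ ⌈x⌉₊ ∧
        c₁ * (b * s) ≤ conLength q ε ⌈x⌉₊ ∧ (conLength q ε ⌈x⌉₊ : ℝ) ≤ c₂ * (b * s) ∧
        2 * b * s ≤ conDim q ε ρ ⌈x⌉₊ ∧ (⌈x⌉₊ : ℝ) ≤ c₃ * Real.log (b * s) := by
  have hq1 : (1 : ℝ) < q := by exact_mod_cast hq
  have hq0 : (0 : ℝ) < q := by linarith
  have hlogq := Real.log_pos hq1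
  have hερ := mul_pos hε₀ hρ
  -- From `x ≥ T` follow `⌈x⌉ ≤ 2x` and `εx - 1 ≥ εx/2`, which absorb the roundings of `t` and of
  -- the inner dimension.
  set T : ℝ := max 1 (2 / ε) with hT
  set g : ℝ → ℝ := fun x => ε * ρ * x * (q : ℝ) ^ (ε * x) with hg
  set c : ℝ := 4 * q / (ε * ρ) with hc
  have hc0 : 0 < c := by positivity
  -- The summand `g T` in the threshold forces `x ≥ T`; the summand `c` gives `xQ = cB ≤ B²`, and so
  -- the logarithmic bound on `t`.
  refine ⟨4 / (ε * ρ), 8 * q ^ 2 / (ε * ρ), 4 / (ε * Real.log q), 1 + ⌈g T⌉₊ + ⌈c⌉₊,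
    by positivity, by positivity, by positivity, by omega, fun b s hb hs x hx => ?_⟩
  have hs1 : (1 : ℝ) ≤ s := by exact_mod_cast hs
  have hb' : 1 + g T + c ≤ b := by
    have h1 : ((1 + ⌈g T⌉₊ + ⌈c⌉₊ : ℕ) : ℝ) ≤ b := by exact_mod_cast hb
    push_cast at h1
    linarith [Nat.le_ceil (g T), Nat.le_ceil c]
  have hT0 : 0 < T := lt_of_lt_of_le one_pos (le_max_left _ _)
  have hgT : 0 ≤ g T := by positivity
  set B : ℝ := b * s with hB
  have hbB : (b : ℝ) ≤ B := le_mul_of_one_le_right (by positivity) hs1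
  have hB1 : 1 ≤ B := by linarith
  have hx' : g x = 4 * q * B := by
    rw [hB, ← mul_assoc]
    exact hx
  have hx0 : 0 < x := pos_of_mul_rpow_eq hq hε₀ hρ (c := 4 * q * B) (by positivity) hx'
  have hxT : T ≤ x := by
    by_contra! hlt
    have := strictMonoOn_mul_rpow hq hε₀ hρ hx0.le hT0.le hlt
    change g x < g T at this
    nlinarith
  have hx1 : 1 ≤ x := (le_max_left _ _).trans hxT
  have hx2 : 2 ≤ ε * x := by
    have := (le_max_right _ _).trans hxT
    rwa [div_le_iff₀ hε₀, mul_comm] at this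
  set t := ⌈x⌉₊ with ht
  have hxt : x ≤ t := Nat.le_ceil x
  have htx : (t : ℝ) < x + 1 := Nat.ceil_lt_add_one hx0.le
  have ht0 : 0 < t := Nat.ceil_pos.mpr hx0
  set κ := innerDim ε t with hκ
  have hκle : (κ : ℝ) ≤ ε * t := Nat.floor_le (by positivity)
  have hκlt : ε * t < κ + 1 := Nat.lt_floor_add_one _
  have hεt : ε * x ≤ ε * t := by gcongr
  have hεt' : ε * t ≤ ε * x + 1 := by nlinarith
  set Q : ℝ := (q : ℝ) ^ (ε * x) with hQ
  have hQ0 : 0 < Q := by positivity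
  have hxQ : x * Q = c * B := by
    have : ε * ρ * x * Q = 4 * q * B := hx'
    rw [hc]
    field_simp
    linarith
  have hN : (outerLength q ε t : ℝ) = (q : ℝ) ^ (κ : ℝ) := by
    rw [outerLength, Nat.cast_pow, Real.rpow_natCast]
  -- The integer `κ` differs from `εx` by at most one, so the outer length agrees with `Q` up to a
  -- factor `q`.
  have hN1 : Q / q ≤ outerLength q ε t := by
    rw [hN, hQ, ← Real.rpow_sub_one hq0.ne']
    exact Real.rpow_le_rpow_of_exponent_le hq1.le (by linarith)
  have hN2 : (outerLength q ε t : ℝ) ≤ Q * q := by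
    rw [hN, hQ, ← Real.rpow_add_one hq0.ne']
    exact Real.rpow_le_rpow_of_exponent_le hq1.le (by linarith)
  have hN0 : (0 : ℝ) ≤ outerLength q ε t := by positivity
  refine ⟨ht0, ?_, ?_, ?_, ?_, ?_, ?_⟩
  · intro h0
    rw [h0, Nat.cast_zero] at hκlt
    linarith
  · have : (κ : ℝ) ≤ t := hκle.trans (mul_le_of_le_one_left (by positivity) hε₁.le)
    exact_mod_cast this
  · rw [conLength, Nat.cast_mul]
    calc 4 / (ε * ρ) * B = Q / q * x := by
          have : Q / q * x = x * Q / q := by ring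
          rw [this, hxQ, hc]
          field_simp
      _ ≤ _ := mul_le_mul hN1 hxt hx0.le hN0
  · rw [conLength, Nat.cast_mul]
    calc (outerLength q ε t : ℝ) * t ≤ Q * q * (2 * x) :=
          mul_le_mul hN2 (by linarith) (by positivity) (by positivity)
      _ = 8 * q ^ 2 / (ε * ρ) * B := by
          have : Q * q * (2 * x) = x * Q * (2 * q) := by ring
          rw [this, hxQ, hc]
          field_simp
          ring
  -- Here `4q` is used up: `2` for `κ ≥ εx/2`, `q` for `N ≥ Q/q`, and `2` for the `2bs` rows
  -- required.
  · have h1 : ρ * outerLength q ε t ≤ outerDim q ε ρ t := Nat.le_ceil _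
    have h2 : ε * x / 2 ≤ κ := by linarith
    have h3 : 2 * B ≤ conDim q ε ρ t := by
      rw [conDim, Nat.cast_mul]
      calc 2 * B = ε * x / 2 * (ρ * (Q / q)) := by
            have : ε * x / 2 * (ρ * (Q / q)) = x * Q * (ε * ρ / (2 * q)) := by
              field_simp
            rw [this, hxQ, hc]
            field_simp
            ring
        _ ≤ κ * (ρ * outerLength q ε t) := by gcongr
        _ ≤ _ := by gcongr
    rw [hB, ← mul_assoc] at h3
    exact_mod_cast h3
  · have h1 : Q ≤ B ^ 2 := by
      have : Q ≤ x * Q := le_mul_of_one_le_left hQ0.le hx1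
      nlinarith
    have h2 : ε * x * Real.log q ≤ 2 * Real.log B := by
      have := Real.log_le_log hQ0 h1
      rwa [hQ, Real.log_rpow hq0, Real.log_pow, Nat.cast_ofNat] at this
    calc (t : ℝ) ≤ 2 * x := by linarith
      _ = 2 * (ε * x * Real.log q) / (ε * Real.log q) := by field_simp
      _ ≤ 2 * (2 * Real.log B) / (ε * Real.log q) := by gcongr
      _ = _ := by ring

end Parameters

/-! ### Numerical conditions on the design -/

lemma outerDim_le_outerLength {q t : ℕ} {ε ρ : ℝ} (hρ : ρ ≤ 1) :
    outerDim q ε ρ t ≤ outerLength q ε t :=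
  Nat.ceil_le.mpr (mul_le_of_le_one_left (Nat.cast_nonneg _) hρ)

/-- The left side is `μt(1-√ρ)N` with `μ = 2δ/(1-√ρ)`, and `(1-√ρ)N < N + 1 - k` because `k < ρN +
1` and `ρ ≤ √ρ`. -/
lemma two_mul_noise_lt {q t : ℕ} {ε ρ δ : ℝ} (hq : 0 < q) (hρ : ρ ∈ Set.Ioo (0 : ℝ) 1)
    (hδ : 0 < δ) (ht : 0 < t) :
    2 * (δ * conLength q ε t) < 2 * δ / (1 - √ρ) * t *
      (outerLength q ε t + 1 - outerDim q ε ρ t) := by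
  obtain ⟨hρ₀, hρ₁⟩ := hρ
  have hr : √ρ < 1 := by rwa [Real.sqrt_lt' one_pos, one_pow]
  have hr' : 0 < 1 - √ρ := by linarith
  have hsq : √ρ * √ρ = ρ := Real.mul_self_sqrt hρ₀.le
  have hN : (0 : ℝ) < outerLength q ε t := by
    exact_mod_cast (pow_pos hq _ : 0 < outerLength q ε t)
  have hk : (outerDim q ε ρ t : ℝ) < ρ * outerLength q ε t + 1 :=
    Nat.ceil_lt_add_one (by positivity)
  have ht' : (0 : ℝ) < t := by exact_mod_cast ht
  have key : (1 - √ρ) * outerLength q ε t < outerLength q ε t + 1 - outerDim q ε ρ t := by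
    have : √ρ * √ρ * outerLength q ε t ≤ 1 * √ρ * outerLength q ε t := by gcongr
    rw [hsq] at this
    linarith
  calc 2 * (δ * (conLength q ε t : ℝ))
      = 2 * δ / (1 - √ρ) * t * ((1 - √ρ) * outerLength q ε t) := by
        simp only [conLength]
        push_cast
        field_simp
    _ < _ := by gcongr

/-- The term `m²t` produces `b log(bs)`; the other two are absorbed by the `n` term, using `b ≤ n`.
-/
lemma operations_le {m t b n s : ℕ} {c₂ c₃ : ℝ} (hc₂ : 0 ≤ c₂) (hc₃ : 0 ≤ c₃) (hbn : b ≤ n)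
    (hb : 1 ≤ b) (hs : 1 ≤ s) (hm : (m : ℝ) ≤ c₂ * (b * s))
    (ht : (t : ℝ) ≤ c₃ * Real.log (b * s)) :
    ((1100 * m ^ 2 * t + 6 * b * s * m + 800 * b * n * s ^ 2 : ℕ) : ℝ) ≤
      (1100 * c₂ ^ 2 * c₃ + 6 * c₂ + 800) * ((n + b * Real.log (b * s)) * b * (s : ℝ) ^ 2) := by
  have hbn' : (b : ℝ) ≤ n := by exact_mod_cast hbn
  have hb' : (1 : ℝ) ≤ b := by exact_mod_cast hb
  have hs' : (1 : ℝ) ≤ s := by exact_mod_cast hs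
  have hlog : 0 ≤ Real.log ((b : ℝ) * s) := Real.log_nonneg (one_le_mul_of_one_le_of_one_le hb' hs')
  have h₁ : 1100 * (m : ℝ) ^ 2 * t ≤ 1100 * (c₂ * (b * s)) ^ 2 * (c₃ * Real.log (b * s)) := by
    gcongr
  have h₂ : 6 * (b : ℝ) * s * m ≤ 6 * c₂ * (n * b * s ^ 2) := by
    calc 6 * (b : ℝ) * s * m ≤ 6 * b * s * (c₂ * (b * s)) := by gcongr
      _ = 6 * c₂ * (b * b * s ^ 2) := by ring
      _ ≤ _ := by gcongr
  have h₃ : 0 ≤ 1100 * c₂ ^ 2 * c₃ * (n * b * (s : ℝ) ^ 2) := by positivity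
  have h₄ : 0 ≤ (6 * c₂ + 800) * (b * Real.log (b * s) * b * (s : ℝ) ^ 2) := by positivity
  push_cast
  linarith

lemma hammingNorm_le_of_mem_fieldSignals {F : Type u} [Field F] [DecidableEq F]
    {alphabet : Finset ℝ} {h0 : (0 : ℝ) ∈ alphabet} {φ : alphabet ≃ F} (hφ : φ ⟨0, h0⟩ = 0)
    {b n : ℕ} {x : Fin n → F} (hx : x ∈ fieldSignals alphabet φ b n) : hammingNorm x ≤ b := by
  obtain ⟨z, hz, hxz⟩ := hx
  refine le_trans (Finset.card_le_card fun i => ?_) hz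
  simp only [Finset.mem_filter_univ, ne_eq]
  intro hi h
  refine hi ?_
  rw [hxz, ← hφ]
  exact congrArg φ (Subtype.ext h)

end FiniteFieldCS

end

/-! ### The main theorem -/

theorem corollary3 {F : Type u} [Field F] [Fintype F] [DecidableEq F] (ρ δ ε : ℝ)
    (hρ : ρ ∈ Set.Ioo (0 : ℝ) 1)
    (hδ : δ ∈ Set.Ioo (0 : ℝ) ((1 - 1 / (Fintype.card F : ℝ)) * (1 - √ρ) / 2))
    (hε : ε = 1 - FiniteFieldCS.Hq (Fintype.card F) (2 * δ / (1 - √ρ))) :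
    ∃ (C c₁ c₂ : ℝ) (b₀ n₀ : ℕ), 0 < C ∧ 0 < c₁ ∧ 0 < c₂ ∧
      ∀ b n s : ℕ, b₀ ≤ b → n₀ ≤ n → 2 * b < n → ⌈Real.logb (Fintype.card F) n⌉₊ ≤ s →
        -- the equation that defines `t*` has exactly one real solution
        (∃! x : ℝ, ε * ρ * x * (Fintype.card F : ℝ) ^ (ε * x) =
          4 * (Fintype.card F : ℝ) * b * s) ∧
        ∀ tstar : ℝ, ε * ρ * tstar * (Fintype.card F : ℝ) ^ (ε * tstar) =
            4 * (Fintype.card F : ℝ) * b * s →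
          -- the number of measurements
          (c₁ * (b * s) ≤ (FiniteFieldCS.conLength (Fintype.card F) ε ⌈tstar⌉₊ : ℝ) ∧
            (FiniteFieldCS.conLength (Fintype.card F) ε ⌈tstar⌉₊ : ℝ) ≤ c₂ * (b * s)) ∧
          (s = ⌈Real.logb (Fintype.card F) n⌉₊ →
            c₁ * (b * Real.logb (Fintype.card F) n) ≤
                (FiniteFieldCS.conLength (Fintype.card F) ε ⌈tstar⌉₊ : ℝ) ∧
              (FiniteFieldCS.conLength (Fintype.card F) ε ⌈tstar⌉₊ : ℝ) ≤
                c₂ * (b * Real.logb (Fintype.card F) n)) ∧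
          ∀ (K : Type v) [Field K] [Algebra F K] (α : K), Module.finrank F K = s →
            FiniteFieldCS.IsPrimitiveElement α →
            -- the design exists
            (∃ (G : Matrix (Fin (FiniteFieldCS.conLength (Fintype.card F) ε ⌈tstar⌉₊))
                  (Fin (FiniteFieldCS.conDim (Fintype.card F) ε ρ ⌈tstar⌉₊)) F)
                (A' : Matrix (Fin (FiniteFieldCS.conDim (Fintype.card F) ε ρ ⌈tstar⌉₊))
                  (Fin n) F),
              FiniteFieldCS.IsDesign α ⌈tstar⌉₊ ε ρ b s G A') ∧
            -- every such design admits exact recovery with few operations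
            ∀ (G : Matrix (Fin (FiniteFieldCS.conLength (Fintype.card F) ε ⌈tstar⌉₊))
                  (Fin (FiniteFieldCS.conDim (Fintype.card F) ε ρ ⌈tstar⌉₊)) F)
                (A' : Matrix (Fin (FiniteFieldCS.conDim (Fintype.card F) ε ρ ⌈tstar⌉₊))
                  (Fin n) F),
              FiniteFieldCS.IsDesign α ⌈tstar⌉₊ ε ρ b s G A' →
              ∃ P : FiniteFieldCS.Program F n,
                (P.ops : ℝ) ≤ C * ((n + b * Real.log (b * s)) * b * (s : ℝ) ^ 2) ∧
                ∀ (alphabet : Finset ℝ) (h0 : (0 : ℝ) ∈ alphabet) (φ : alphabet ≃ F),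
                  φ ⟨0, h0⟩ = 0 →
                  ∀ x ∈ FiniteFieldCS.fieldSignals alphabet φ b n,
                  ∀ e ∈ FiniteFieldCS.worstCaseNoise F δ
                      (FiniteFieldCS.conLength (Fintype.card F) ε ⌈tstar⌉₊),
                    P.eval ((G * A').mulVec x + e) = x := by
  have hq : 2 ≤ Fintype.card F := Fintype.one_lt_card
  have hq' : (2 : ℝ) ≤ Fintype.card F := by exact_mod_cast hq
  have hr : 0 < 1 - √ρ := by
    rw [sub_pos, Real.sqrt_lt' one_pos, one_pow]
    exact hρ.2
  have hμ₀ : 0 < 2 * δ / (1 - √ρ) := div_pos (by linarith [hδ.1]) hr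
  have hμ₁ : 2 * δ / (1 - √ρ) < 1 - 1 / (Fintype.card F : ℝ) := by
    rw [div_lt_iff₀ hr]
    linarith [hδ.2]
  have hH := FiniteFieldCS.Hq_mem_Ioo hq hμ₀ hμ₁
  have hinv : FiniteFieldCS.HqInv (Fintype.card F) (1 - ε) = 2 * δ / (1 - √ρ) := by
    rw [hε, sub_sub_cancel]
    exact FiniteFieldCS.HqInv_Hq hq hμ₀.le hμ₁.le
  have hε₀ : 0 < ε := by linarith [hH.2]
  have hε₁ : ε < 1 := by linarith [hH.1]
  have hμ_le : 2 * δ / (1 - √ρ) ≤ 1 :=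
    hμ₁.le.trans (sub_le_self _ (by positivity))
  obtain ⟨c₁, c₂, c₃, b₀, hc₁, hc₂, hc₃, hb₀, H⟩ :=
    FiniteFieldCS.exists_parameter_bounds hq hε₀ hε₁ hρ.1
  -- Taking `n₀ = q` ensures `log_q n ≥ 1`, so rounding up at most doubles it; hence `2 * c₂`.
  refine ⟨1100 * c₂ ^ 2 * c₃ + 6 * c₂ + 800, c₁, 2 * c₂, b₀, Fintype.card F, by positivity, hc₁,
    by positivity, fun b n s hb hn hbn hs => ?_⟩
  have hb₁ : 1 ≤ b := hb₀.trans hb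
  have hn' : (Fintype.card F : ℝ) ≤ n := by exact_mod_cast hn
  have hlog : 1 ≤ Real.logb (Fintype.card F) n := by
    rwa [Real.le_logb_iff_rpow_le (by linarith) (by linarith), Real.rpow_one]
  have hs₁ : 1 ≤ s := (Nat.one_le_ceil_iff.mpr (by linarith)).trans hs
  have hns : n ≤ Fintype.card F ^ s := by
    have := (Real.logb_le_iff_le_rpow (by linarith) (by linarith)).mp (Nat.ceil_le.mp hs)
    rw [Real.rpow_natCast] at this
    exact_mod_cast this
  have hb' : (1 : ℝ) ≤ b := by exact_mod_cast hb₁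
  have hs' : (1 : ℝ) ≤ s := by exact_mod_cast hs₁
  refine ⟨FiniteFieldCS.existsUnique_mul_rpow_eq hq hε₀ hρ.1 (by positivity), fun x hx => ?_⟩
  obtain ⟨ht, hκ, hκt, hm₁, hm₂, hdim, ht₃⟩ := H b s hb hs₁ x hx
  have hk : FiniteFieldCS.outerDim (Fintype.card F) ε ρ ⌈x⌉₊ ≤ _ :=
    FiniteFieldCS.outerDim_le_outerLength hρ.2.le
  refine ⟨⟨hm₁, hm₂.trans ?_⟩, fun hsn => ⟨le_trans ?_ hm₁, hm₂.trans ?_⟩, ?_⟩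
  · have : 0 ≤ c₂ * (b * s) := by positivity
    linarith
  · have := Nat.ceil_le.mp hs
    gcongr
  · have : (s : ℝ) ≤ 2 * Real.logb (Fintype.card F) n := by
      rw [hsn]
      linarith [Nat.ceil_lt_add_one (zero_le_one.trans hlog)]
    calc c₂ * (b * s) ≤ c₂ * (b * (2 * Real.logb (Fintype.card F) n)) := by gcongr
      _ = _ := by ring
  intro K _ _ α hK hα
  refine ⟨FiniteFieldCS.exists_design hα hK (by omega) ht hμ₀ hμ₁ hε hinv hκ hk hdim hbn.le hns,
    fun G A' h => ?_⟩
  obtain ⟨P, hP, hdec⟩ := h.exists_program hα hK (by omega) hb₁ hbn.le ht hκ hκt hk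
    (hinv ▸ hμ₀) (hinv ▸ hμ_le)
    (hinv ▸ FiniteFieldCS.two_mul_noise_lt (by omega) hρ hδ.1 ht)
  exact ⟨P, (Nat.cast_le.mpr hP).trans
      (FiniteFieldCS.operations_le hc₂.le hc₃.le (by omega) hb₁ hs₁ hm₂ ht₃),
    fun alphabet h0 φ hφ y hy e he =>
      hdec y (FiniteFieldCS.hammingNorm_le_of_mem_fieldSignals hφ hy) e he⟩
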